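/- **Setting.** Fix integers $T,k\ge 0$, and let $N$ run through a sequence of integers tending to infinity. For each such $N$ let $W=W_N$ be a real $N\times N$ matrix and let $X=(X_1',\dots,X_T')'$ be a nonrandom $NT\times k$ matrix ($X_t$ is $N\times k$). For $\theta=(\lambda,\gamma,\rho)\in\mathbb R^3$ put $$S(\lambda)=I_N-\lambda W,\qquad R(\theta)=\rho W+\gamma I_N,\qquad A(\theta)=R(\theta)S(\lambda)^{-1},\qquad K(\theta)=\sum_{j\ge 0}A(\theta)^jA(\theta)'^{\,j}.$$ Let $B(\theta)$ be the $NT\times NT$ block matrix with $T$ diagonal blocks $S(\lambda)$, blocks $-R(\theta)$ immediately below the diagonal and zeros elsewhere, let $\Omega(\theta)=\mathrm{Diag}(K(\theta),I_N,\dots,I_N)$ and $\Sigma(\theta)^{-1}=B(\theta)'\Omega(\theta)^{-1}B(\theta)$. Call $\theta$ *admissible for $N$* if $S(\lambda)$ is nonsingular and all eigenvalues of $A(\theta)$ are less than $1$ in magnitude. The data are $Y_t=X_t\beta_0+U_t$, $t=1,\dots,T$, where $(U_t)_{t\in\mathbb Z}$ is a weakly stationary solution of $$U_t=\lambda_0WU_t+\rho_0WU_{t-1}+\gamma_0U_{t-1}+V_t,\qquad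 V_t=(v_{1,t},\dots,v_{N,t})',\quad t\in\mathbb Z .$$ The true parameter is $\delta_0=(\beta_0,\theta_0,\sigma_0^2)$ with $\theta_0=(\lambda_0,\gamma_0,\rho_0)$. With $Y=(Y_1',\dots,Y_T')'$, the quasi log likelihood at $\delta=(\beta,\theta,\sigma^2)$ is $$\log L_{NT}(\delta)=-\tfrac{NT}{2}\log(2\pi\sigma^2)-\tfrac12\log\det K(\theta)+T\log|\det S(\lambda)|-\tfrac1{2\sigma^2}(Y-X\beta)'\Sigma(\theta)^{-1}(Y-X\beta),$$ $\ell_N=-2\log L_{NT}$, and the quasi-maximum likelihood estimator $\widehat\delta=\widehat\delta_N$ is any maximizer of $\log L_{NT}$ over the parameter space $\Theta_\delta$ below. A sequence of square matrices is called UB if the maximal absolute row sums and the maximal absolute column sums are bounded along the sequence. **Assumptions.** 1. $W$ is symmetric with zero diagonal. 2. $\Theta_\delta=\Theta_\beta\times\Theta_\theta\times[\underline\sigma^2,\overline\sigma^2]$, where $\Theta_\beta\subset\mathbb R^k$ and $\Theta_\theta\subset\mathbb R^3$ are compact and $\underline\sigma^2>0$; every $\theta\in\Theta_\theta$ is admissible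 for every $N$, and $\Theta_\theta$ is contained in a connected set of parameters that are admissible for every $N$; $\delta_0$ lies in the interior of $\Theta_\delta$. 3. The innovations $v_{j,t}$ are i.i.d. over $j$ and $t$ (with a law that does not depend on $N$), with mean $0$, variance $\sigma_0^2$ and $E|v_{j,t}|^{4+\eta}<\infty$ for some $\eta>0$. 4. (i) For every $\theta\in\Theta_\theta$, $\Sigma(\theta)^{-1}$ and $S(\lambda)^{-1}$ are UB; (ii) $\sum_{h\ge1}\mathrm{abs}(A(\theta_0)^h)$, with entrywise absolute values, is UB; (iii) the entries of $X$ are bounded uniformly in $N$. 5. For every $\theta\in\Theta_\theta$ the limit $\lim_{N\to\infty}N^{-1}X'\Sigma(\theta)^{-1}X$ exists and is nonsingular. 6. Let $\lambda_1(\theta),\dots,\lambda_{NT}(\theta)$ be the eigenvalues of $\Sigma(\theta)^{-1}\Sigma(\theta_0)$ with multiplicity, $\alpha=(\theta,\sigma^2)$, $f_j(\alpha)=-\log\big(\lambda_j(\theta)\sigma_0^2/\sigma^2\big)+\lambda_j(\theta)\sigma_0^2/\sigma^2$, and let $H_N=\nabla^2\big(\sum_{j=1}^{NT}f_j\big)(\alpha_0)$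 be the $4\times4$ Hessian at $\alpha_0=(\theta_0,\sigma_0^2)$. Then $N^{-1}H_N$ is asymptotically nonsingular: $\liminf_{N\to\infty}|\det(N^{-1}H_N)|>0$. **Theorem.** Suppose that $W$ has more than two distinct eigenvalues for every $N$, and that Assumptions 1–6 hold. Then $\delta_0$ is identifiably unique: for every $N$ it minimizes $N^{-1}E\,\ell_N$ over $\Theta_\delta$, and for every $\varepsilon>0$ $$\liminf_{N\to\infty}\ \inf_{\delta\in\Theta_\delta,\ \|\delta-\delta_0\|\ge\varepsilon}N^{-1}\{E\,\ell_N(\delta)-E\,\ell_N(\delta_0)\}>0 .$$ Moreover $\widehat\delta_N\to\delta_0$ in probability as $N\to\infty$, with $T$ fixed. -/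

import Mathlib

open MeasureTheory ProbabilityTheory Filter Topology
open scoped Matrix

noncomputable section

namespace STAR

/-- Spatio-temporal dependence parameters `θ = (λ, γ, ρ)`: `θ 0 = λ`, `θ 1 = γ`, `θ 2 = ρ`. -/
abbrev Theta := Fin 3 → ℝ

/-- The full parameter `δ = (β, θ, σ²)`; the last component is the variance `σ²`. -/
abbrev Param (k : ℕ) := (Fin k → ℝ) × Theta × ℝ

section Model

variable {N : ℕ}

/-- `S(λ) = I - λ W`. -/
def S (W : Matrix (Fin N) (Fin N) ℝ) (θ : Theta) : Matrix (Fin N) (Fin N) ℝ :=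
  1 - θ 0 • W

/-- `R(θ) = ρ W + γ I`. -/
def R (W : Matrix (Fin N) (Fin N) ℝ) (θ : Theta) : Matrix (Fin N) (Fin N) ℝ :=
  θ 2 • W + θ 1 • (1 : Matrix (Fin N) (Fin N) ℝ)

/-- `A(θ) = R(θ) S(λ)⁻¹`. -/
def A (W : Matrix (Fin N) (Fin N) ℝ) (θ : Theta) : Matrix (Fin N) (Fin N) ℝ :=
  R W θ * (S W θ)⁻¹

/-- `K(θ) = ∑_{j ≥ 0} A(θ)^j (A(θ)ᵀ)^j`. -/
def K (W : Matrix (Fin N) (Fin N) ℝ) (θ : Theta) : Matrix (Fin N) (Fin N) ℝ :=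
  ∑' j : ℕ, A W θ ^ j * (A W θ)ᵀ ^ j

/-- The `NT × NT` operator `B(θ)`: blocks `S(λ)` on the diagonal and `-R(θ)` just below it.
The index `(t, i)` is the cell `i` at the `t`-th observation time. -/
def B (T : ℕ) (W : Matrix (Fin N) (Fin N) ℝ) (θ : Theta) :
    Matrix (Fin T × Fin N) (Fin T × Fin N) ℝ :=
  Matrix.of fun p q =>
    if p.1 = q.1 then S W θ p.2 q.2
    else if (p.1 : ℕ) = (q.1 : ℕ) + 1 then -R W θ p.2 q.2
    else 0

/-- `Ω(θ) = Diag(K(θ), I, …, I)`. -/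
def Omega (T : ℕ) (W : Matrix (Fin N) (Fin N) ℝ) (θ : Theta) :
    Matrix (Fin T × Fin N) (Fin T × Fin N) ℝ :=
  Matrix.of fun p q =>
    if p.1 = q.1 then
      (if (p.1 : ℕ) = 0 then K W θ p.2 q.2 else (1 : Matrix (Fin N) (Fin N) ℝ) p.2 q.2)
    else 0

/-- The precision matrix `Σ(θ)⁻¹ = B(θ)ᵀ Ω(θ)⁻¹ B(θ)`. -/
def Prec (T : ℕ) (W : Matrix (Fin N) (Fin N) ℝ) (θ : Theta) :
    Matrix (Fin T × Fin N) (Fin T × Fin N) ℝ :=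
  (B T W θ)ᵀ * (Omega T W θ)⁻¹ * B T W θ

/-- The quasi log likelihood `log L_{NT}(δ)` for the data `Y` and the stacked design matrix `X`. -/
def logLik {T k : ℕ} (W : Matrix (Fin N) (Fin N) ℝ) (X : Matrix (Fin T × Fin N) (Fin k) ℝ)
    (Y : Fin T × Fin N → ℝ) (δ : Param k) : ℝ :=
  -((N : ℝ) * T / 2) * Real.log (2 * Real.pi * δ.2.2)
    - (1 / 2) * Real.log (K W δ.2.1).det
    + T * Real.log |(S W δ.2.1).det|
    - 1 / (2 * δ.2.2) *
        ((Y - X *ᵥ δ.1) ⬝ᵥ (Prec T W δ.2.1 *ᵥ (Y - X *ᵥ δ.1)))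

/-- `S(λ)` is nonsingular and the eigenvalues of `A(θ)` are less than one in magnitude.
(This is only used for symmetric `W`; then `A(θ)` is symmetric and all its eigenvalues are real.) -/
def Admissible (W : Matrix (Fin N) (Fin N) ℝ) (θ : Theta) : Prop :=
  IsUnit (S W θ).det ∧ ∀ a ∈ spectrum ℝ (A W θ), |a| < 1

/-- `∑_{h ≥ 1} abs(A(θ)^h)`, where `abs` is taken entrywise. -/
def absPowSum (W : Matrix (Fin N) (Fin N) ℝ) (θ : Theta) : Matrix (Fin N) (Fin N) ℝ :=
  Matrix.of fun i j => ∑' h : ℕ, |(A W θ ^ (h + 1)) i j|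

/-- `∑_j f_j(α)` for `α = (λ, γ, ρ, σ²)`, with
`f_j(α) = -log(λ_j(θ) σ₀²/σ²) + λ_j(θ) σ₀²/σ²`, where `λ_j(θ)` runs through the eigenvalues of
`Σ(θ)⁻¹ Σ(θ₀)`, counted with multiplicity. -/
def sumF (T : ℕ) (W : Matrix (Fin N) (Fin N) ℝ) (θ₀ : Theta) (v₀ : ℝ) (α : Fin 4 → ℝ) : ℝ :=
  ((Prec T W ![α 0, α 1, α 2] * (Prec T W θ₀)⁻¹).charpoly.roots.map
    fun l => -Real.log (l * (v₀ / α 3)) + l * (v₀ / α 3)).sum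

end Model

/-- The Hessian matrix of a function of `d` real variables. -/
def hessian {d : ℕ} (f : (Fin d → ℝ) → ℝ) (x : Fin d → ℝ) : Matrix (Fin d) (Fin d) ℝ :=
  Matrix.of fun i j =>
    fderiv ℝ (fun y => fderiv ℝ f y (Pi.single j 1)) x (Pi.single i 1)

/-- A sequence of square matrices is uniformly bounded in row and column sums. -/
def UB {ι : ℕ → Type} [∀ m, Fintype (ι m)] (P : ∀ m, Matrix (ι m) (ι m) ℝ) : Prop :=
  ∃ C : ℝ, ∀ m, (∀ j, ∑ i, |P m i j| ≤ C) ∧ (∀ i, ∑ j, |P m i j| ≤ C)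

section Probability

variable {Ω : Type*} [MeasurableSpace Ω]

/-- The random variables `v j t`, over all cells `j` and times `t`, are independent and
identically distributed with mean zero, variance `v₀`, and a finite absolute moment of some order
greater than four. -/
def IIDInnovations (P : Measure Ω) (v : ℕ → ℤ → Ω → ℝ) (v₀ : ℝ) : Prop :=
  iIndepFun (fun p : ℕ × ℤ => v p.1 p.2) P ∧
  (∀ j t, IdentDistrib (v j t) (v 0 0) P P) ∧
  (∃ η : ℝ, 0 < η ∧ ∀ j t, Integrable (fun ω => |v j t ω| ^ (4 + η)) P) ∧
  (∀ j t, ∫ ω, v j t ω ∂P = 0) ∧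
  (∀ j t, ∫ ω, (v j t ω) ^ 2 ∂P = v₀)

/-- Weak stationarity of a vector-valued process indexed by the integers: finite second moments,
and means and cross moments that are invariant under time shifts. -/
def WeaklyStationary {N : ℕ} (P : Measure Ω) (U : ℤ → Ω → Fin N → ℝ) : Prop :=
  (∀ t i, MemLp (fun ω => U t ω i) 2 P) ∧
  (∀ t i, ∫ ω, U t ω i ∂P = ∫ ω, U 0 ω i ∂P) ∧
  (∀ t h i j, ∫ ω, U t ω i * U (t + h) ω j ∂P = ∫ ω, U 0 ω i * U h ω j ∂P)

/-- `U` is a weakly stationary solution of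
`U_t = λ W U_t + ρ W U_{t-1} + γ U_{t-1} + V_t`, `t ∈ ℤ`, where `V_t = (v_{1,t}, …, v_{N,t})`. -/
def IsErrorProcess {N : ℕ} (P : Measure Ω) (W : Matrix (Fin N) (Fin N) ℝ) (θ : Theta)
    (v : ℕ → ℤ → Ω → ℝ) (U : ℤ → Ω → Fin N → ℝ) : Prop :=
  WeaklyStationary P U ∧
  ∀ t, ∀ᵐ ω ∂P, U t ω = θ 0 • (W *ᵥ U t ω) + θ 2 • (W *ᵥ U (t - 1) ω) + θ 1 • U (t - 1) ω
    + fun i : Fin N => v i t ω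

/-- The observed responses `Y_t = X_t β + U_t` at the times `t = 1, …, T`. -/
def response {N T k : ℕ} (X : Matrix (Fin T × Fin N) (Fin k) ℝ) (β : Fin k → ℝ)
    (U : ℤ → Ω → Fin N → ℝ) (ω : Ω) : Fin T × Fin N → ℝ :=
  X *ᵥ β + fun p => U ((p.1 : ℕ) + 1 : ℤ) ω p.2

/-- `δ₀` is identifiably unique on `Θ` for the sequence of nonrandom criteria `Q m` (to be
minimized): it minimizes every `Q m` over `Θ`, and outside every ball around it the values of `Q m`
eventually exceed the minimum by a fixed positive amount. -/
def IdentifiablyUnique {E : Type*} [PseudoMetricSpace E] (Q : ℕ → E → ℝ) (Θ : Set E) (δ₀ : E) :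
    Prop :=
  (∀ m, IsMinOn (Q m) Θ δ₀) ∧
  ∀ ε > 0, ∃ c > 0, ∀ᶠ m in atTop, ∀ δ ∈ Θ, ε ≤ dist δ δ₀ → c ≤ Q m δ - Q m δ₀

end Probability

end STAR

end

/-! Since `W` is symmetric, S, R, A and K share an orthonormal eigenbasis. In that basis the
quasi-likelihood splits into N scalar AR(1) likelihoods of length T, one for each eigenvalue w: s
u_t = r u_{t-1} + noise with s = 1 - λw and r = ρw + γ (`Prec_eq`, `neg_two_mul_logLik`). Weak
stationarity alone determines the second moments of the rotated errors (`hasMean_eigProc_mul`), so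
the expected criterion has the explicit form `meanCrit`.

Identification. The excess of the expected criterion over its value at the truth is a sum of
Kullback-Leibler type terms, one per eigenvalue, plus a nonnegative regression term. `divergence_ge`
bounds each term below by a constant times T - 1 times the squared distance of (s, r)/σ from (s₀,
r₀)/σ₀; connectedness of the parameter region enters because s and s₀ must have the same sign. Both
s and r are affine in w and the eigenvalues sum to tr W = 0, so after summation the cross terms
vanish: the changes of 1/σ and γ/σ are weighted by N, those of λ/σ and ρ/σ by ∑ w²
(`sum_divergence_ge`). This separates (θ, σ²) provided that T ≥ 2 and that the mean of w² stays away
from zero.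

Both facts come from the Hessian assumption. For T = 1 the criterion depends on the parameter only
through (s² - r²)/σ², which hyperbolic rotations of (s, r) with a matching rescaling of σ² preserve,
so the Hessian is singular (`det_hessian_sumF_one`). For w = 0 the criterion does not contain λ, so
a small mean of w² would make a column of the normalized Hessian small
(`exists_le_mean_sq_of_hessian`). Finally β is separated by the design limit at θ₀, which persists
for nearby θ; for θ far away the divergence already suffices (`exists_meanCrit_separation`).

Consistency. On each eigenspace the entries of the precision matrix are quadratic polynomials in w
whose coefficients are continuous in θ (`precMat_apply`). The deviation of the criterion from its
mean is therefore a combination of finitely many parameter-free random moments with bounded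
coefficients, and uniformity in the parameter is automatic. Each moment has mean absolute deviation
of order √N, by truncating the moving average and bounding the variance of a quadratic form in
independent variables (`integral_abs_quadratic_le`). Markov's inequality against a separation of
order N concludes. The constants are uniform because the UB assumptions confine all spectra to one
compact set (`exists_mem_eigSet`). -/

noncomputable section

namespace STAR

/-! ### Simultaneous diagonalization of matrices and of block matrices -/

section Spectral

variable {N T : ℕ}

/-- The matrix with eigenvalues `d` in the orthonormal basis of columns of `O`. -/
def specMat (O : Matrix (Fin N) (Fin N) ℝ) (d : Fin N → ℝ) : Matrix (Fin N) (Fin N) ℝ :=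
  O * Matrix.diagonal d * Oᵀ

/-- `W` is diagonalized by the orthogonal matrix `O` with eigenvalues `w`. -/
structure Diagonalizes (O : Matrix (Fin N) (Fin N) ℝ) (w : Fin N → ℝ)
    (W : Matrix (Fin N) (Fin N) ℝ) : Prop where
  left : Oᵀ * O = 1
  right : O * Oᵀ = 1
  eq : W = specMat O w

theorem exists_diagonalizes {W : Matrix (Fin N) (Fin N) ℝ} (hW : W.IsSymm) :
    ∃ O w, Diagonalizes O w W := by
  have hH : W.IsHermitian := by
    rw [Matrix.IsHermitian, Matrix.conjTranspose_eq_transpose_of_trivial]; exact hW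
  refine ⟨hH.eigenvectorUnitary, hH.eigenvalues, ?_, ?_, ?_⟩
  · have := Unitary.coe_star_mul_self hH.eigenvectorUnitary
    rwa [Matrix.star_eq_conjTranspose,
      Matrix.conjTranspose_eq_transpose_of_trivial] at this
  · have := Unitary.coe_mul_star_self hH.eigenvectorUnitary
    rwa [Unitary.coe_star, Matrix.star_eq_conjTranspose,
      Matrix.conjTranspose_eq_transpose_of_trivial] at this
  · have := hH.spectral_theorem
    rw [Unitary.conjStarAlgAut_apply, Matrix.star_eq_conjTranspose,
      Matrix.conjTranspose_eq_transpose_of_trivial] at this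
    exact this

theorem specMat_apply (O : Matrix (Fin N) (Fin N) ℝ) (d : Fin N → ℝ) (i j : Fin N) :
    specMat O d i j = ∑ l, O i l * d l * O j l := by
  simp [specMat, Matrix.mul_apply, Matrix.diagonal_apply]

theorem specMat_transpose (O : Matrix (Fin N) (Fin N) ℝ) (d : Fin N → ℝ) :
    (specMat O d)ᵀ = specMat O d := by
  simp [specMat, Matrix.transpose_mul, Matrix.mul_assoc]

variable {O : Matrix (Fin N) (Fin N) ℝ}

theorem specMat_mul (hO : Oᵀ * O = 1) (d e : Fin N → ℝ) :
    specMat O d * specMat O e = specMat O (d * e) := by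
  calc specMat O d * specMat O e
      = O * Matrix.diagonal d * (Oᵀ * O) * Matrix.diagonal e * Oᵀ := by
        simp only [specMat, Matrix.mul_assoc]
    _ = _ := by
        rw [hO, Matrix.mul_one, Matrix.mul_assoc O, Matrix.diagonal_mul_diagonal]; rfl

theorem specMat_one (hO : O * Oᵀ = 1) : specMat O 1 = 1 := by
  rw [specMat]
  have : Matrix.diagonal (1 : Fin N → ℝ) = 1 := Matrix.diagonal_one
  rw [this, Matrix.mul_one, hO]

theorem specMat_add (d e : Fin N → ℝ) : specMat O d + specMat O e = specMat O (d + e) := by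
  ext i j; simp only [Matrix.add_apply, specMat_apply, ← Finset.sum_add_distrib, Pi.add_apply]
  exact Finset.sum_congr rfl fun l _ => by ring

theorem specMat_smul (c : ℝ) (d : Fin N → ℝ) : c • specMat O d = specMat O (c • d) := by
  ext i j
  simp only [Matrix.smul_apply, specMat_apply, Pi.smul_apply, smul_eq_mul, Finset.mul_sum]
  exact Finset.sum_congr rfl fun l _ => by ring

theorem specMat_inv (hO : Oᵀ * O = 1) (hO' : O * Oᵀ = 1) {d : Fin N → ℝ} (hd : ∀ l, d l ≠ 0) :
    (specMat O d)⁻¹ = specMat O d⁻¹ := by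
  refine Matrix.inv_eq_right_inv ?_
  rw [specMat_mul hO, ← specMat_one hO']
  congr 1; ext l; simp [hd l]

theorem specMat_pow (hO : Oᵀ * O = 1) (hO' : O * Oᵀ = 1) (d : Fin N → ℝ) (h : ℕ) :
    specMat O d ^ h = specMat O (d ^ h) := by
  induction h with
  | zero => simp [specMat_one hO']
  | succ h ih => rw [pow_succ, ih, specMat_mul hO, pow_succ]

theorem specMat_det (hO : Oᵀ * O = 1) (d : Fin N → ℝ) : (specMat O d).det = ∏ l, d l := by
  rw [specMat, Matrix.det_mul, Matrix.det_mul, Matrix.det_diagonal]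
  have : Oᵀ.det * O.det = 1 := by rw [← Matrix.det_mul, hO, Matrix.det_one]
  linear_combination (∏ l, d l) * this

theorem specMat_trace (hO : Oᵀ * O = 1) (d : Fin N → ℝ) : (specMat O d).trace = ∑ l, d l := by
  rw [specMat, Matrix.trace_mul_comm, ← Matrix.mul_assoc, hO, Matrix.one_mul,
    Matrix.trace_diagonal]

theorem mem_spectrum_specMat (hO : Oᵀ * O = 1) (hO' : O * Oᵀ = 1) (d : Fin N → ℝ) (l : Fin N) :
    d l ∈ spectrum ℝ (specMat O d) := by
  rw [spectrum.mem_iff, Matrix.isUnit_iff_isUnit_det]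
  have : algebraMap ℝ (Matrix (Fin N) (Fin N) ℝ) (d l) - specMat O d
      = specMat O (fun j => d l - d j) := by
    rw [Algebra.algebraMap_eq_smul_one, ← specMat_one hO', specMat_smul, sub_eq_add_neg,
      ← neg_one_smul ℝ, specMat_smul, specMat_add]
    congr 1; ext j; simp [sub_eq_add_neg]
  rw [this, specMat_det hO, isUnit_iff_ne_zero, not_not]
  exact Finset.prod_eq_zero (Finset.mem_univ l) (sub_self _)

theorem sum_col_mul_col (hO : Oᵀ * O = 1) (l l' : Fin N) :
    ∑ i, O i l * O i l' = if l = l' then 1 else 0 := by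
  have := congrFun (congrFun hO l) l'
  simpa [Matrix.mul_apply, Matrix.one_apply] using this

theorem sum_row_mul_row (hO' : O * Oᵀ = 1) (i j : Fin N) :
    ∑ l, O i l * O j l = if i = j then 1 else 0 := by
  have := congrFun (congrFun hO' i) j
  simpa [Matrix.mul_apply, Matrix.one_apply] using this

/-- The squared Frobenius norm is the sum of the squared eigenvalues. -/
theorem sum_sq_specMat (hO : Oᵀ * O = 1) (d : Fin N → ℝ) :
    ∑ i, ∑ j, (specMat O d i j) ^ 2 = ∑ l, d l ^ 2 := by
  have h := specMat_trace hO (d * d)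
  rw [← specMat_mul hO] at h
  have h2 : (specMat O d * specMat O d).trace = ∑ i, ∑ j, (specMat O d i j) ^ 2 := by
    rw [Matrix.trace]
    refine Finset.sum_congr rfl fun i _ => ?_
    rw [Matrix.diag_apply, Matrix.mul_apply]
    refine Finset.sum_congr rfl fun j _ => ?_
    rw [sq]; congr 1
    exact congrFun (congrFun (specMat_transpose O d) i) j
  rw [← h2, h]
  exact Finset.sum_congr rfl fun l _ => by simp [sq]

/-- The coordinates of the time slices of `y` in the basis of columns of `O`. -/
def rot (O : Matrix (Fin N) (Fin N) ℝ) (y : Fin T × Fin N → ℝ) (l : Fin N) (t : Fin T) : ℝ :=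
  ∑ i, O i l * y (t, i)

theorem sum_rot_sq (hO' : O * Oᵀ = 1) (y : Fin T × Fin N → ℝ) (t : Fin T) :
    ∑ l, rot O y l t ^ 2 = ∑ i, y (t, i) ^ 2 := by
  have : ∀ l, rot O y l t ^ 2 = ∑ i, ∑ j, y (t, i) * y (t, j) * (O i l * O j l) := by
    intro l
    rw [rot, sq, Finset.sum_mul_sum]
    exact Finset.sum_congr rfl fun i _ => Finset.sum_congr rfl fun j _ => by ring
  simp_rw [this]
  rw [Finset.sum_comm]
  refine Finset.sum_congr rfl fun i _ => ?_
  rw [Finset.sum_comm]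
  simp_rw [← Finset.mul_sum, sum_row_mul_row hO']
  simp [sq]

/-- The block matrix whose blocks are simultaneously diagonalized by `O`; the `T × T` matrix of the
`l`-th eigenvalues of the blocks is `b l`. -/
def specBlock (O : Matrix (Fin N) (Fin N) ℝ) (b : Fin N → Matrix (Fin T) (Fin T) ℝ) :
    Matrix (Fin T × Fin N) (Fin T × Fin N) ℝ :=
  Matrix.of fun p q => ∑ l, O p.2 l * b l p.1 q.1 * O q.2 l

/-- `I_T ⊗ O`. -/
def liftBasis (T : ℕ) (O : Matrix (Fin N) (Fin N) ℝ) :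
    Matrix (Fin T × Fin N) (Fin T × Fin N) ℝ :=
  Matrix.of fun p q => if p.1 = q.1 then O p.2 q.2 else 0

/-- Conjugation by the orthogonal matrix I_T ⊗ O; products, inverses, determinants and traces of
such block matrices are read off from the blocks through this form. -/
theorem specBlock_eq (b : Fin N → Matrix (Fin T) (Fin T) ℝ) :
    specBlock O b = liftBasis T O * Matrix.blockDiagonal b * (liftBasis T O)ᵀ := by
  ext ⟨t, i⟩ ⟨s, j⟩
  simp only [specBlock, liftBasis, Matrix.mul_apply, Matrix.of_apply, Matrix.transpose_apply,
    Matrix.blockDiagonal_apply, Fintype.sum_prod_type, mul_ite, ite_mul, zero_mul, mul_zero]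
  simp [Finset.sum_ite_eq]

theorem liftBasis_transpose_mul (hO : Oᵀ * O = 1) :
    (liftBasis T O)ᵀ * liftBasis T O = 1 := by
  ext ⟨t, i⟩ ⟨s, j⟩
  simp only [liftBasis, Matrix.mul_apply, Matrix.of_apply, Matrix.transpose_apply,
    Fintype.sum_prod_type, mul_ite, ite_mul, zero_mul, mul_zero, Matrix.one_apply, Prod.mk.injEq]
  by_cases h : t = s
  · subst h; simp [sum_col_mul_col hO]
  · simp [h, Ne.symm h]

theorem liftBasis_mul_transpose (hO' : O * Oᵀ = 1) :
    liftBasis T O * (liftBasis T O)ᵀ = 1 := by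
  have := liftBasis_transpose_mul (T := T) (O := Oᵀ) (by simpa using hO')
  convert this using 2
  · ext p q; simp [liftBasis, eq_comm]
  · ext p q; simp [liftBasis, eq_comm]

theorem specBlock_mul (hO : Oᵀ * O = 1) (b c : Fin N → Matrix (Fin T) (Fin T) ℝ) :
    specBlock O b * specBlock O c = specBlock O (fun l => b l * c l) := by
  rw [specBlock_eq, specBlock_eq, specBlock_eq, Matrix.blockDiagonal_mul]
  calc _ = liftBasis T O * Matrix.blockDiagonal b * ((liftBasis T O)ᵀ * liftBasis T O) *
        Matrix.blockDiagonal c * (liftBasis T O)ᵀ := by simp only [Matrix.mul_assoc]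
    _ = _ := by rw [liftBasis_transpose_mul hO, Matrix.mul_one]; simp only [Matrix.mul_assoc]

theorem specBlock_one (hO' : O * Oᵀ = 1) :
    specBlock O (fun _ => (1 : Matrix (Fin T) (Fin T) ℝ)) = 1 := by
  rw [specBlock_eq]
  have : Matrix.blockDiagonal (fun _ : Fin N => (1 : Matrix (Fin T) (Fin T) ℝ)) = 1 :=
    Matrix.blockDiagonal_one
  rw [this, Matrix.mul_one, liftBasis_mul_transpose hO']

theorem specBlock_transpose (b : Fin N → Matrix (Fin T) (Fin T) ℝ) :
    (specBlock O b)ᵀ = specBlock O (fun l => (b l)ᵀ) := by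
  ext p q
  simp only [specBlock, Matrix.transpose_apply, Matrix.of_apply]
  exact Finset.sum_congr rfl fun l _ => by ring

theorem specBlock_inv (hO : Oᵀ * O = 1) (hO' : O * Oᵀ = 1)
    {b c : Fin N → Matrix (Fin T) (Fin T) ℝ} (h : ∀ l, b l * c l = 1) :
    (specBlock O b)⁻¹ = specBlock O c := by
  refine Matrix.inv_eq_right_inv ?_
  rw [specBlock_mul hO, ← specBlock_one hO']
  congr 1; ext1 l; exact h l

theorem specBlock_det (hO : Oᵀ * O = 1) (b : Fin N → Matrix (Fin T) (Fin T) ℝ) :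
    (specBlock O b).det = ∏ l, (b l).det := by
  rw [specBlock_eq, Matrix.det_mul, Matrix.det_mul, Matrix.det_blockDiagonal]
  have : (liftBasis T O)ᵀ.det * (liftBasis T O).det = 1 := by
    rw [← Matrix.det_mul, liftBasis_transpose_mul hO, Matrix.det_one]
  linear_combination (∏ l, (b l).det) * this

theorem specBlock_trace (hO : Oᵀ * O = 1) (b : Fin N → Matrix (Fin T) (Fin T) ℝ) :
    (specBlock O b).trace = ∑ l, (b l).trace := by
  rw [specBlock_eq, Matrix.trace_mul_comm, ← Matrix.mul_assoc, liftBasis_transpose_mul hO,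
    Matrix.one_mul, Matrix.trace_blockDiagonal]

/-- Bilinear forms of simultaneously diagonalized block matrices decouple. -/
theorem dotProduct_specBlock_mulVec (b : Fin N → Matrix (Fin T) (Fin T) ℝ)
    (x y : Fin T × Fin N → ℝ) :
    x ⬝ᵥ (specBlock O b *ᵥ y) = ∑ l, rot O x l ⬝ᵥ (b l *ᵥ rot O y l) := by
  have hL : ∀ l, rot O x l ⬝ᵥ (b l *ᵥ rot O y l)
      = ∑ t, ∑ i, ∑ s, ∑ j, x (t, i) * (O i l * b l t s * O j l * y (s, j)) := by
    intro l
    simp only [dotProduct, Matrix.mulVec, rot, Finset.sum_mul, Finset.mul_sum]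
    refine Finset.sum_congr rfl fun t _ => ?_
    refine (Finset.sum_congr rfl fun s _ => Finset.sum_comm).trans ?_
    rw [Finset.sum_comm]
    refine Finset.sum_congr rfl fun i _ => Finset.sum_congr rfl fun s _ =>
      Finset.sum_congr rfl fun j _ => by ring
  simp_rw [hL]
  simp only [dotProduct, Matrix.mulVec, specBlock, Matrix.of_apply, Fintype.sum_prod_type,
    Finset.sum_mul, Finset.mul_sum]
  symm
  rw [Finset.sum_comm]
  refine Finset.sum_congr rfl fun t _ => ?_
  rw [Finset.sum_comm]
  refine Finset.sum_congr rfl fun i _ => ?_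
  rw [Finset.sum_comm]
  refine Finset.sum_congr rfl fun s _ => ?_
  rw [Finset.sum_comm]

end Spectral

/-! ### From row and column sums to eigenvalue bounds -/

section Schur

/-- Schur's test for the quadratic form of a matrix with bounded absolute row and column sums. -/
theorem abs_dotProduct_mulVec_le {ι : Type*} [Fintype ι] {M : Matrix ι ι ℝ} {C : ℝ}
    (hc : ∀ j, ∑ i, |M i j| ≤ C) (hr : ∀ i, ∑ j, |M i j| ≤ C) (y : ι → ℝ) :
    |y ⬝ᵥ (M *ᵥ y)| ≤ C * ∑ i, y i ^ 2 := by
  have h1 : |y ⬝ᵥ (M *ᵥ y)| ≤ ∑ i, ∑ j, |M i j| * ((y i ^ 2 + y j ^ 2) / 2) := by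
    simp only [dotProduct, Matrix.mulVec, Finset.mul_sum]
    refine (Finset.abs_sum_le_sum_abs _ _).trans (Finset.sum_le_sum fun i _ => ?_)
    refine (Finset.abs_sum_le_sum_abs _ _).trans (Finset.sum_le_sum fun j _ => ?_)
    rw [abs_mul, abs_mul]
    have : |y i| * |y j| ≤ (y i ^ 2 + y j ^ 2) / 2 := by
      nlinarith [sq_nonneg (|y i| - |y j|), sq_abs (y i), sq_abs (y j)]
    nlinarith [abs_nonneg (M i j)]
  have h2 : ∑ i, ∑ j, |M i j| * ((y i ^ 2 + y j ^ 2) / 2)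
      = (∑ i, (∑ j, |M i j|) * y i ^ 2) / 2 + (∑ j, (∑ i, |M i j|) * y j ^ 2) / 2 := by
    have e : ∑ j, (∑ i, |M i j|) * y j ^ 2 = ∑ i, ∑ j, |M i j| * y j ^ 2 := by
      simp_rw [Finset.sum_mul]; rw [Finset.sum_comm]
    rw [e, ← add_div, ← Finset.sum_add_distrib, Finset.sum_div]
    refine Finset.sum_congr rfl fun i _ => ?_
    rw [Finset.sum_mul, ← Finset.sum_add_distrib, Finset.sum_div]
    exact Finset.sum_congr rfl fun j _ => by ring
  have h3 : ∑ i, (∑ j, |M i j|) * y i ^ 2 ≤ C * ∑ i, y i ^ 2 := by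
    rw [Finset.mul_sum]
    exact Finset.sum_le_sum fun i _ => mul_le_mul_of_nonneg_right (hr i) (sq_nonneg _)
  have h4 : ∑ j, (∑ i, |M i j|) * y j ^ 2 ≤ C * ∑ i, y i ^ 2 := by
    rw [Finset.mul_sum]
    exact Finset.sum_le_sum fun i _ => mul_le_mul_of_nonneg_right (hc i) (sq_nonneg _)
  linarith

variable {N : ℕ} {O : Matrix (Fin N) (Fin N) ℝ}

theorem specMat_quadForm_col (hO : Oᵀ * O = 1) (d : Fin N → ℝ) (l : Fin N) :
    (fun i => O i l) ⬝ᵥ (specMat O d *ᵥ fun i => O i l) = d l := by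
  have h : (specMat O d *ᵥ fun i => O i l) = fun i => O i l * d l := by
    ext i
    simp only [Matrix.mulVec, dotProduct, specMat_apply, Finset.sum_mul]
    rw [Finset.sum_comm]
    have : ∀ l', ∑ j, O i l' * d l' * O j l' * O j l
        = O i l' * d l' * (if l' = l then 1 else 0) := by
      intro l'
      rw [← sum_col_mul_col hO, Finset.mul_sum]
      exact Finset.sum_congr rfl fun j _ => by ring
    simp [this]
  rw [h, dotProduct]
  have : ∀ i, O i l * (O i l * d l) = O i l * O i l * d l := fun i => by ring
  simp_rw [this]
  rw [← Finset.sum_mul, sum_col_mul_col hO]; simp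

/-- Schur's test evaluated at a unit eigenvector. Through this bound the UB assumptions become
statements about spectra. -/
theorem abs_le_of_specMat_sums_le (hO : Oᵀ * O = 1) {d : Fin N → ℝ} {C : ℝ}
    (hc : ∀ j, ∑ i, |specMat O d i j| ≤ C) (hr : ∀ i, ∑ j, |specMat O d i j| ≤ C) (l : Fin N) :
    |d l| ≤ C := by
  have h := abs_dotProduct_mulVec_le hc hr (fun i => O i l)
  rw [specMat_quadForm_col hO] at h
  have h1 : ∑ i, O i l ^ 2 = 1 := by
    have := sum_col_mul_col hO l l
    simpa [sq] using this
  rwa [h1, mul_one] at h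

end Schur

/-! ### The AR(1) model on one eigenspace -/

section Scalar

/-- The eigenvalue of `S(λ)` belonging to the eigenvalue `w` of `W`. -/
def sv (θ : Theta) (w : ℝ) : ℝ := 1 - θ 0 * w

/-- The eigenvalue of `R(θ)` belonging to the eigenvalue `w` of `W`. -/
def rv (θ : Theta) (w : ℝ) : ℝ := θ 2 * w + θ 1

/-- The bidiagonal `T × T` matrix that `B(θ)` induces on an eigenspace of `W`. -/
def bMat (T : ℕ) (θ : Theta) (w : ℝ) : Matrix (Fin T) (Fin T) ℝ :=
  Matrix.of fun p q =>
    if p = q then sv θ w else if (p : ℕ) = (q : ℕ) + 1 then -rv θ w else 0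

/-- The weights of the one-step prediction errors on an eigenspace of `W`. -/
def predWeight (T : ℕ) (θ : Theta) (w : ℝ) (t : Fin T) : ℝ :=
  if (t : ℕ) = 0 then 1 - (rv θ w / sv θ w) ^ 2 else 1

/-- The tridiagonal `T × T` matrix that the precision matrix induces on an eigenspace of `W`. -/
def precMat (T : ℕ) (θ : Theta) (w : ℝ) : Matrix (Fin T) (Fin T) ℝ :=
  (bMat T θ w)ᵀ * Matrix.diagonal (predWeight T θ w) * bMat T θ w

/-- The stationary autocovariance matrix on an eigenspace of `W`, for unit innovation variance. -/
def covMat (T : ℕ) (θ : Theta) (w : ℝ) : Matrix (Fin T) (Fin T) ℝ :=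
  Matrix.of fun p q =>
    -- One of the two truncated subtractions is zero, so the exponent is the lag |p - q|.
    (sv θ w ^ 2 - rv θ w ^ 2)⁻¹ * (rv θ w / sv θ w) ^ (((p : ℕ) - q) + ((q : ℕ) - p))

variable {n : ℕ} (θ : Theta) (w : ℝ)

theorem bMat_zero (q : Fin (n + 1)) : bMat (n + 1) θ w 0 q = if q = 0 then sv θ w else 0 := by
  simp [bMat, eq_comm]

theorem bMat_succ (u : Fin n) (q : Fin (n + 1)) :
    bMat (n + 1) θ w u.succ q
      = (if q = u.succ then sv θ w else 0) - (if q = u.castSucc then rv θ w else 0) := by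
  simp only [bMat, Matrix.of_apply, Fin.val_succ, add_left_inj]
  by_cases h : q = u.succ
  · subst h
    have : u.succ ≠ u.castSucc := by
      intro h; have := congrArg Fin.val h; simp at this
    simp [this]
  · rw [if_neg (Ne.symm h), if_neg h]
    by_cases h2 : q = u.castSucc
    · subst h2; simp
    · rw [if_neg h2, if_neg]
      · simp
      · intro h3; exact h2 (Fin.ext (by simp [h3]))

theorem bMat_mul_zero {κ : Type*} (M : Matrix (Fin (n + 1)) κ ℝ) (q : κ) :
    (bMat (n + 1) θ w * M) 0 q = sv θ w * M 0 q := by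
  simp [Matrix.mul_apply, bMat_zero]

theorem bMat_mul_succ {κ : Type*} (M : Matrix (Fin (n + 1)) κ ℝ) (u : Fin n) (q : κ) :
    (bMat (n + 1) θ w * M) u.succ q = sv θ w * M u.succ q - rv θ w * M u.castSucc q := by
  simp [Matrix.mul_apply, bMat_succ, sub_mul, Finset.sum_sub_distrib]

theorem bMat_mulVec_zero (y : Fin (n + 1) → ℝ) :
    (bMat (n + 1) θ w *ᵥ y) 0 = sv θ w * y 0 := by
  simp [Matrix.mulVec, dotProduct, bMat_zero]

theorem bMat_mulVec_succ (y : Fin (n + 1) → ℝ) (u : Fin n) :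
    (bMat (n + 1) θ w *ᵥ y) u.succ = sv θ w * y u.succ - rv θ w * y u.castSucc := by
  simp [Matrix.mulVec, dotProduct, bMat_succ, sub_mul, Finset.sum_sub_distrib]

theorem mul_bMat_transpose_zero {κ : Type*} (M : Matrix κ (Fin (n + 1)) ℝ) (p : κ) :
    (M * (bMat (n + 1) θ w)ᵀ) p 0 = sv θ w * M p 0 := by
  simp [Matrix.mul_apply, bMat_zero, mul_comm]

theorem mul_bMat_transpose_succ {κ : Type*} (M : Matrix κ (Fin (n + 1)) ℝ) (p : κ) (u : Fin n) :
    (M * (bMat (n + 1) θ w)ᵀ) p u.succ = sv θ w * M p u.succ - rv θ w * M p u.castSucc := by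
  simp [Matrix.mul_apply, bMat_succ, mul_sub, Finset.sum_sub_distrib, mul_comm]

theorem bMat_det (T : ℕ) : (bMat T θ w).det = sv θ w ^ T := by
  rw [Matrix.det_of_isLowerTriangular]
  · simp [bMat]
  · intro i j hij
    have hij : i < j := hij
    have h1 : (i : ℕ) < j := hij
    simp only [bMat, Matrix.of_apply]
    rw [if_neg hij.ne, if_neg (by omega)]

theorem precMat_det : (precMat (n + 1) θ w).det
    = sv θ w ^ (2 * (n + 1)) * (1 - (rv θ w / sv θ w) ^ 2) := by
  rw [precMat, Matrix.det_mul, Matrix.det_mul, Matrix.det_transpose, bMat_det, Matrix.det_diagonal,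
    Fin.prod_univ_succ]
  simp [predWeight]
  ring

variable {θ w}

/-- The quadratic form of the precision matrix as a sum of weighted squared prediction errors. -/
theorem precMat_bilin (hs : sv θ w ≠ 0) (x y : Fin (n + 1) → ℝ) :
    x ⬝ᵥ (precMat (n + 1) θ w *ᵥ y) = (sv θ w ^ 2 - rv θ w ^ 2) * (x 0 * y 0)
      + ∑ u : Fin n, (sv θ w * x u.succ - rv θ w * x u.castSucc)
          * (sv θ w * y u.succ - rv θ w * y u.castSucc) := by
  rw [precMat, ← Matrix.mulVec_mulVec, ← Matrix.mulVec_mulVec, Matrix.dotProduct_mulVec,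
    Matrix.vecMul_transpose, dotProduct, Fin.sum_univ_succ]
  simp only [Matrix.mulVec_diagonal, bMat_mulVec_zero, bMat_mulVec_succ]
  congr 1
  · simp only [predWeight, Fin.val_zero, if_true]; field_simp
  · simp [predWeight]

theorem precMat_form_nonneg (hs : sv θ w ≠ 0) (ha : |rv θ w / sv θ w| < 1)
    (y : Fin (n + 1) → ℝ) : 0 ≤ y ⬝ᵥ (precMat (n + 1) θ w *ᵥ y) := by
  rw [precMat_bilin hs]
  have : 0 ≤ sv θ w ^ 2 - rv θ w ^ 2 := by
    rw [abs_div, div_lt_one (abs_pos.mpr hs)] at ha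
    have := sq_lt_sq.mpr ha
    linarith
  exact add_nonneg (mul_nonneg this (mul_self_nonneg _))
    (Finset.sum_nonneg fun u _ => mul_self_nonneg _)

theorem sq_sub_sq_pos (hs : sv θ w ≠ 0) (ha : |rv θ w / sv θ w| < 1) :
    0 < sv θ w ^ 2 - rv θ w ^ 2 := by
  rw [abs_div, div_lt_one (abs_pos.mpr hs)] at ha
  have := sq_lt_sq.mpr ha
  linarith

theorem one_sub_sq_pos (ha : |rv θ w / sv θ w| < 1) : 0 < 1 - (rv θ w / sv θ w) ^ 2 := by
  have := (sq_lt_one_iff_abs_lt_one _).mpr ha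
  linarith

/-- Forming one-step prediction errors whitens a stationary AR(1) path. Off the diagonal the terms
cancel because each extra lag multiplies the autocovariance by r/s; only the first error, which has
no predecessor, keeps the variance 1/(1 - (r/s)²). -/
theorem bMat_mul_covMat_mul (hs : sv θ w ≠ 0) (ha : |rv θ w / sv θ w| < 1) :
    bMat (n + 1) θ w * covMat (n + 1) θ w * (bMat (n + 1) θ w)ᵀ
      = Matrix.diagonal (fun t => (predWeight (n + 1) θ w t)⁻¹) := by
  have hg := sq_sub_sq_pos hs ha
  have hd := one_sub_sq_pos ha
  have hs2 : sv θ w ^ 2 - rv θ w ^ 2 = sv θ w ^ 2 * (1 - (rv θ w / sv θ w) ^ 2) := by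
    field_simp
  have hr : rv θ w = sv θ w * (rv θ w / sv θ w) := by field_simp
  have hcov : ∀ p q, covMat (n + 1) θ w p q = (sv θ w ^ 2 * (1 - (rv θ w / sv θ w) ^ 2))⁻¹ *
      (rv θ w / sv θ w) ^ (((p : ℕ) - q) + ((q : ℕ) - p)) := by
    intro p q; rw [covMat, Matrix.of_apply, hs2]
  set a := rv θ w / sv θ w with ha_def
  set s := sv θ w with hs_def
  have hdn := hd.ne'
  ext p q
  rcases Fin.eq_zero_or_eq_succ p with rfl | ⟨u, rfl⟩
  · rcases Fin.eq_zero_or_eq_succ q with rfl | ⟨u', rfl⟩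
    · rw [mul_bMat_transpose_zero, bMat_mul_zero, hcov, ← hs_def]
      simp only [Matrix.diagonal_apply_eq, predWeight, Fin.val_zero, if_true]
      rw [← hs_def, ← ha_def]
      simp
      field_simp
    · rw [mul_bMat_transpose_succ, bMat_mul_zero, bMat_mul_zero, hcov, hcov, hr, ← hs_def,
        Matrix.diagonal_apply_ne _ (Fin.succ_ne_zero u').symm]
      simp only [Fin.val_zero, Fin.val_succ, Fin.val_castSucc, Nat.zero_sub, zero_add, Nat.sub_zero,
        pow_succ]
      ring
  · rcases Fin.eq_zero_or_eq_succ q with rfl | ⟨u', rfl⟩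
    · rw [mul_bMat_transpose_zero, bMat_mul_succ, hcov, hcov, hr, ← hs_def,
        Matrix.diagonal_apply_ne _ (Fin.succ_ne_zero u)]
      simp only [Fin.val_zero, Fin.val_succ, Fin.val_castSucc, Nat.zero_sub, add_zero, Nat.sub_zero,
        pow_succ]
      ring
    · rw [mul_bMat_transpose_succ, bMat_mul_succ, bMat_mul_succ, hcov, hcov, hcov, hcov, hr,
        ← hs_def]
      simp only [Fin.val_succ, Fin.val_castSucc]
      rcases lt_trichotomy (u : ℕ) u' with h | h | h
      · obtain ⟨d, hd'⟩ := Nat.exists_eq_add_of_lt h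
        rw [Matrix.diagonal_apply_ne _ (by intro e; rw [Fin.succ_inj] at e; subst e; omega)]
        rw [show ((u : ℕ) + 1 - (u' + 1)) + ((u' : ℕ) + 1 - (u + 1)) = d + 1 by omega,
          show ((u : ℕ) - (u' + 1)) + ((u' : ℕ) + 1 - u) = d + 2 by omega,
          show ((u : ℕ) + 1 - u') + ((u' : ℕ) - (u + 1)) = d by omega,
          show ((u : ℕ) - u') + ((u' : ℕ) - u) = d + 1 by omega]
        ring
      · have : u = u' := Fin.ext h
        subst this
        rw [Matrix.diagonal_apply_eq]
        simp [predWeight]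
        field_simp
        ring
      · obtain ⟨d, hd'⟩ := Nat.exists_eq_add_of_lt h
        rw [Matrix.diagonal_apply_ne _ (by intro e; rw [Fin.succ_inj] at e; subst e; omega)]
        rw [show ((u : ℕ) + 1 - (u' + 1)) + ((u' : ℕ) + 1 - (u + 1)) = d + 1 by omega,
          show ((u : ℕ) - (u' + 1)) + ((u' : ℕ) + 1 - u) = d by omega,
          show ((u : ℕ) + 1 - u') + ((u' : ℕ) - (u + 1)) = d + 2 by omega,
          show ((u : ℕ) - u') + ((u' : ℕ) - u) = d + 1 by omega]
        ring

theorem predWeight_ne_zero {T : ℕ} (ha : |rv θ w / sv θ w| < 1) (t : Fin T) :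
    predWeight T θ w t ≠ 0 := by
  rw [predWeight]
  split_ifs
  · exact (one_sub_sq_pos ha).ne'
  · exact one_ne_zero

/-- Whitening makes the product the identity after right multiplication by the transposed bidiagonal
matrix, which is invertible and can be cancelled. -/
theorem precMat_mul_covMat (hs : sv θ w ≠ 0) (ha : |rv θ w / sv θ w| < 1) :
    precMat (n + 1) θ w * covMat (n + 1) θ w = 1 := by
  have hdet : IsUnit (bMat (n + 1) θ w)ᵀ.det := by
    rw [Matrix.det_transpose, bMat_det]; exact (pow_ne_zero _ hs).isUnit
  have h : precMat (n + 1) θ w * covMat (n + 1) θ w * (bMat (n + 1) θ w)ᵀ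
      = 1 * (bMat (n + 1) θ w)ᵀ := by
    rw [precMat, Matrix.one_mul]
    calc _ = (bMat (n + 1) θ w)ᵀ * Matrix.diagonal (predWeight (n + 1) θ w) *
          (bMat (n + 1) θ w * covMat (n + 1) θ w * (bMat (n + 1) θ w)ᵀ) := by
          simp only [Matrix.mul_assoc]
      _ = _ := by
          rw [bMat_mul_covMat_mul hs ha, Matrix.mul_assoc, Matrix.diagonal_mul_diagonal]
          have : (fun i => predWeight (n + 1) θ w i * (predWeight (n + 1) θ w i)⁻¹)
              = fun _ => 1 := by
            ext i; exact mul_inv_cancel₀ (predWeight_ne_zero ha i)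
          rw [this, Matrix.diagonal_one, Matrix.mul_one]
  have h2 := congrArg (· * (bMat (n + 1) θ w)ᵀ⁻¹) h
  simpa only [Matrix.mul_assoc, Matrix.mul_nonsing_inv _ hdet, Matrix.mul_one] using h2

/-- The expected quadratic form of the precision matrix under the stationary law with parameter
`θ₀` and unit innovation variance. -/
def expForm (n : ℕ) (θ₀ θ : Theta) (w : ℝ) : ℝ :=
  (sv θ₀ w ^ 2 - rv θ₀ w ^ 2)⁻¹ * ((sv θ w ^ 2 - rv θ w ^ 2)
    + n * (sv θ w ^ 2 + rv θ w ^ 2 - 2 * (rv θ w * sv θ w * (rv θ₀ w / sv θ₀ w))))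

/-- Cyclicity of the trace turns this into the weighted sum of the mean squared prediction errors
made with `θ` under the law of `θ₀`. It links the eigenvalue sum of Assumption 6 to the expected
likelihood. -/
theorem trace_precMat_mul_covMat {θ₀ : Theta} (hs : sv θ w ≠ 0) :
    (precMat (n + 1) θ w * covMat (n + 1) θ₀ w).trace = expForm n θ₀ θ w := by
  rw [precMat, Matrix.mul_assoc, Matrix.mul_assoc, Matrix.trace_mul_comm, Matrix.mul_assoc]
  simp only [Matrix.trace, Matrix.diag_apply, Fin.sum_univ_succ, Matrix.diagonal_mul,
    mul_bMat_transpose_zero, mul_bMat_transpose_succ, bMat_mul_zero, bMat_mul_succ, covMat,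
    Matrix.of_apply]
  simp [predWeight, expForm]
  field_simp
  ring

/-- The constant part of a row of the bidiagonal matrix as an affine function of `w`. -/
def rowConst (θ : Theta) (u : Fin n) (t : Fin (n + 1)) : ℝ :=
  (if t = u.succ then 1 else 0) - (if t = u.castSucc then θ 1 else 0)

/-- The linear part of a row of the bidiagonal matrix as an affine function of `w`. -/
def rowLin (θ : Theta) (u : Fin n) (t : Fin (n + 1)) : ℝ :=
  -(if t = u.succ then θ 0 else 0) - (if t = u.castSucc then θ 2 else 0)

/-- The coefficients of the entries of `precMat` as quadratic polynomials in `w`. -/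
def precCoef (θ : Theta) (t s : Fin (n + 1)) : Fin 3 → ℝ :=
  (if t = 0 ∧ s = 0 then
    -- The coefficients of s² - r² in powers of w.
    ![1 - θ 1 ^ 2, -2 * (θ 0 + θ 2 * θ 1), θ 0 ^ 2 - θ 2 ^ 2] else 0)
  + ∑ u : Fin n, ![rowConst θ u t * rowConst θ u s,
      rowConst θ u t * rowLin θ u s + rowLin θ u t * rowConst θ u s, rowLin θ u t * rowLin θ u s]

/-- The quotient r/s in the first prediction weight is harmless: it occurs only as s²(1 - (r/s)²) =
s² - r², so every entry is polynomial in w. The parameter and the spectrum are thereby separated,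
which yields uniformity in θ later. -/
theorem precMat_apply (hs : sv θ w ≠ 0) (t s : Fin (n + 1)) :
    precMat (n + 1) θ w t s = ∑ q : Fin 3, precCoef θ t s q * w ^ (q : ℕ) := by
  have hb : ∀ (u : Fin n) t, bMat (n + 1) θ w u.succ t = rowConst θ u t + rowLin θ u t * w := by
    intro u t
    rw [bMat_succ, rowConst, rowLin, sv, rv]
    split_ifs <;> ring
  rw [precMat, Matrix.mul_apply, Fin.sum_univ_succ]
  simp only [Matrix.mul_diagonal, Matrix.transpose_apply, hb, bMat_zero]
  have hL : ∑ q : Fin 3, precCoef θ t s q * w ^ (q : ℕ)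
      = (if t = 0 ∧ s = 0 then sv θ w ^ 2 - rv θ w ^ 2 else 0)
        + ∑ u : Fin n, (rowConst θ u t + rowLin θ u t * w)
          * (rowConst θ u s + rowLin θ u s * w) := by
    simp only [precCoef, Pi.add_apply, Finset.sum_apply]
    rw [Finset.sum_congr rfl (fun q _ => add_mul _ _ _), Finset.sum_add_distrib]
    congr 1
    · split_ifs
      · simp [Fin.sum_univ_three, sv, rv]; ring
      · simp
    · rw [Finset.sum_congr rfl (fun q _ => Finset.sum_mul _ _ _), Finset.sum_comm]
      refine Finset.sum_congr rfl fun u _ => ?_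
      simp [Fin.sum_univ_three]; ring
  rw [hL]
  congr 1
  · by_cases h1 : t = 0 <;> by_cases h2 : s = 0 <;> simp [h1, h2, predWeight]
    field_simp
  · simp [predWeight]

theorem continuous_precCoef (t s : Fin (n + 1)) (q : Fin 3) :
    Continuous fun θ : Theta => precCoef θ t s q := by
  have h1 : ∀ (u : Fin n) t, Continuous fun θ : Theta => rowConst θ u t := by
    intro u t; unfold rowConst; split_ifs <;> fun_prop
  have h2 : ∀ (u : Fin n) t, Continuous fun θ : Theta => rowLin θ u t := by
    intro u t; unfold rowLin; split_ifs <;> fun_prop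
  simp only [precCoef, Pi.add_apply, Finset.sum_apply]
  refine Continuous.add ?_ (continuous_finsetSum _ fun u _ => ?_)
  · split_ifs
    · fin_cases q <;> simp <;> fun_prop
    · exact continuous_const
  · have := h1 u t
    have := h1 u s
    have := h2 u t
    have := h2 u s
    fin_cases q <;> simp <;> fun_prop

theorem continuous_sv (w : ℝ) : Continuous fun θ : Theta => sv θ w := by
  unfold sv; fun_prop

end Scalar

/-! ### Spectral form of the model matrices and of the likelihood -/

section Eigen

variable {N : ℕ} {O : Matrix (Fin N) (Fin N) ℝ} {w : Fin N → ℝ} {W : Matrix (Fin N) (Fin N) ℝ}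

theorem S_eq (hD : Diagonalizes O w W) (θ : Theta) : S W θ = specMat O fun l => sv θ (w l) := by
  rw [S, ← specMat_one hD.right, hD.eq, specMat_smul, sub_eq_add_neg, ← neg_one_smul ℝ,
    specMat_smul, specMat_add]
  congr 1; ext l; simp [sv, sub_eq_add_neg]

theorem R_eq (hD : Diagonalizes O w W) (θ : Theta) : R W θ = specMat O fun l => rv θ (w l) := by
  rw [R, ← specMat_one hD.right, hD.eq, specMat_smul, specMat_smul, specMat_add]
  congr 1; ext l; simp [rv]

theorem sv_ne_zero (hD : Diagonalizes O w W) {θ : Theta} (h : IsUnit (S W θ).det) (l : Fin N) :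
    sv θ (w l) ≠ 0 := by
  rw [S_eq hD, specMat_det hD.left, isUnit_iff_ne_zero, Finset.prod_ne_zero_iff] at h
  exact h l (Finset.mem_univ l)

theorem S_inv_eq (hD : Diagonalizes O w W) {θ : Theta} (hs : ∀ l, sv θ (w l) ≠ 0) :
    (S W θ)⁻¹ = specMat O fun l => (sv θ (w l))⁻¹ := by
  rw [S_eq hD, specMat_inv hD.left hD.right hs]; rfl

theorem A_eq (hD : Diagonalizes O w W) {θ : Theta} (hs : ∀ l, sv θ (w l) ≠ 0) :
    A W θ = specMat O fun l => rv θ (w l) / sv θ (w l) := by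
  rw [A, S_inv_eq hD hs, R_eq hD, specMat_mul hD.left]; rfl

theorem abs_ratio_lt_one (hD : Diagonalizes O w W) {θ : Theta} (h : Admissible W θ) (l : Fin N) :
    |rv θ (w l) / sv θ (w l)| < 1 := by
  have hs := sv_ne_zero hD h.1
  refine h.2 _ ?_
  rw [A_eq hD hs]
  exact mem_spectrum_specMat hD.left hD.right (fun l => rv θ (w l) / sv θ (w l)) l

/-- A geometric series in each squared eigenvalue of A, transported through the continuous additive
map `specMat O`. -/
theorem K_eq (hD : Diagonalizes O w W) {θ : Theta} (hs : ∀ l, sv θ (w l) ≠ 0)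
    (ha : ∀ l, |rv θ (w l) / sv θ (w l)| < 1) :
    K W θ = specMat O fun l => (1 - (rv θ (w l) / sv θ (w l)) ^ 2)⁻¹ := by
  set a : Fin N → ℝ := fun l => rv θ (w l) / sv θ (w l) with ha_def
  have h1 : HasSum (fun j : ℕ => fun l => (a l ^ 2) ^ j) (fun l => (1 - a l ^ 2)⁻¹) := by
    refine Pi.hasSum.mpr fun l => hasSum_geometric_of_lt_one (sq_nonneg _) ?_
    exact (sq_lt_one_iff_abs_lt_one _).mpr (ha l)
  have hc : Continuous (specMat O) := by unfold specMat; fun_prop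
  have h2 := h1.map (AddMonoidHom.mk' (specMat O) fun d e => (specMat_add d e).symm) hc
  rw [K]
  refine HasSum.tsum_eq ?_
  convert h2 using 1
  swap
  · rfl
  ext1 j
  rw [A_eq hD hs, specMat_transpose, specMat_pow hD.left hD.right, specMat_mul hD.left]
  simp only [Function.comp_apply, AddMonoidHom.mk'_apply]
  congr 1; ext l
  simp only [Pi.mul_apply, Pi.pow_apply]
  simp only [a]; ring

theorem B_eq (hD : Diagonalizes O w W) (T : ℕ) (θ : Theta) :
    B T W θ = specBlock O fun l => bMat T θ (w l) := by
  ext ⟨t, i⟩ ⟨s, j⟩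
  simp only [B, specBlock, bMat, Matrix.of_apply, S_eq hD, R_eq hD, specMat_apply]
  split_ifs <;> simp

theorem Omega_eq (hD : Diagonalizes O w W) (T : ℕ) {θ : Theta} (hs : ∀ l, sv θ (w l) ≠ 0)
    (ha : ∀ l, |rv θ (w l) / sv θ (w l)| < 1) :
    Omega T W θ = specBlock O fun l => Matrix.diagonal fun t => (predWeight T θ (w l) t)⁻¹ := by
  ext ⟨t, i⟩ ⟨s, j⟩
  simp only [Omega, specBlock, Matrix.of_apply, K_eq hD hs ha, specMat_apply,
    Matrix.diagonal_apply, predWeight]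
  split_ifs
  · rfl
  · simp [Matrix.one_apply, sum_row_mul_row hD.right]
  · simp

theorem Prec_eq (hD : Diagonalizes O w W) (T : ℕ) {θ : Theta} (hs : ∀ l, sv θ (w l) ≠ 0)
    (ha : ∀ l, |rv θ (w l) / sv θ (w l)| < 1) :
    Prec T W θ = specBlock O fun l => precMat T θ (w l) := by
  rw [Prec, B_eq hD, Omega_eq hD T hs ha, specBlock_transpose]
  rw [specBlock_inv hD.left hD.right (c := fun l => Matrix.diagonal (predWeight T θ (w l))),
    specBlock_mul hD.left, specBlock_mul hD.left]
  · rfl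
  · intro l
    rw [Matrix.diagonal_mul_diagonal, ← Matrix.diagonal_one]
    congr 1; ext t
    exact inv_mul_cancel₀ (predWeight_ne_zero (ha l) t)

theorem Prec_inv_eq (hD : Diagonalizes O w W) (n : ℕ) {θ : Theta} (hs : ∀ l, sv θ (w l) ≠ 0)
    (ha : ∀ l, |rv θ (w l) / sv θ (w l)| < 1) :
    (Prec (n + 1) W θ)⁻¹ = specBlock O fun l => covMat (n + 1) θ (w l) := by
  rw [Prec_eq hD _ hs ha]
  exact specBlock_inv hD.left hD.right fun l => precMat_mul_covMat (hs l) (ha l)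

/-- The nonrandom part of `-2 log L` on an eigenspace of `W`. -/
def logPart (n : ℕ) (θ : Theta) (v w : ℝ) : ℝ :=
  -- There are n + 1 observation times, and `Real.log` ignores signs, so a negative s contributes
  -- log |s|.
  (n + 1) * Real.log v - 2 * (n + 1) * Real.log (sv θ w) - Real.log (1 - (rv θ w / sv θ w) ^ 2)

theorem neg_two_mul_logLik (hD : Diagonalizes O w W) {n k : ℕ}
    (X : Matrix (Fin (n + 1) × Fin N) (Fin k) ℝ) (Y : Fin (n + 1) × Fin N → ℝ) {δ : Param k}
    (hv : 0 < δ.2.2) (hs : ∀ l, sv δ.2.1 (w l) ≠ 0)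
    (ha : ∀ l, |rv δ.2.1 (w l) / sv δ.2.1 (w l)| < 1) :
    -2 * logLik W X Y δ = N * ((n + 1) * Real.log (2 * Real.pi))
      + ∑ l, logPart n δ.2.1 δ.2.2 (w l)
      + 1 / δ.2.2 * ∑ l, rot O (Y - X *ᵥ δ.1) l ⬝ᵥ
          (precMat (n + 1) δ.2.1 (w l) *ᵥ rot O (Y - X *ᵥ δ.1) l) := by
  rw [logLik, Prec_eq hD _ hs ha, dotProduct_specBlock_mulVec, K_eq hD hs ha, S_eq hD,
    specMat_det hD.left, specMat_det hD.left, Real.log_abs,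
    Real.log_prod fun l _ => inv_ne_zero (one_sub_sq_pos (ha l)).ne',
    Real.log_prod fun l _ => hs l, Real.log_mul (by positivity) hv.ne']
  simp only [logPart, Finset.sum_sub_distrib, ← Finset.mul_sum, Real.log_inv,
    Finset.sum_neg_distrib, Finset.sum_const, Finset.card_univ, Fintype.card_fin, nsmul_eq_mul]
  push_cast
  field_simp
  ring

end Eigen

/-! ### The eigenvalue sum of Assumption 6 in terms of determinant and trace -/

section Roots

/-- A sum over the eigenvalues of a product of a symmetric and a positive definite matrix in
terms of determinant and trace. -/
theorem sum_roots_charpoly_mul_inv {ι : Type*} [Fintype ι] [DecidableEq ι] {Q G : Matrix ι ι ℝ}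
    (hQ : Qᵀ = Q) {c : ℝ} (hc : c ≠ 0) (hdet : (Q * (Gᵀ * G)⁻¹).det ≠ 0) :
    ((Q * (Gᵀ * G)⁻¹).charpoly.roots.map fun l => -Real.log (l * c) + l * c).sum
      = -Real.log (Q * (Gᵀ * G)⁻¹).det - Fintype.card ι * Real.log c
        + c * (Q * (Gᵀ * G)⁻¹).trace := by
  -- The product itself need not be symmetric. Moving one factor around cyclically gives a symmetric
  -- matrix with the same characteristic polynomial, so its roots are real eigenvalues whose product
  -- and sum are the determinant and the trace.
  set H := (G⁻¹)ᵀ * (Q * G⁻¹) with hH_def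
  have hM : Q * (Gᵀ * G)⁻¹ = Q * G⁻¹ * (G⁻¹)ᵀ := by
    rw [Matrix.mul_inv_rev, Matrix.transpose_nonsing_inv, Matrix.mul_assoc]
  have hH : H.IsHermitian := by
    rw [Matrix.IsHermitian, Matrix.conjTranspose_eq_transpose_of_trivial, hH_def]
    simp only [Matrix.transpose_mul, Matrix.transpose_transpose, hQ, Matrix.mul_assoc]
  have hdet' : (Q * (Gᵀ * G)⁻¹).det = H.det := by rw [hM, Matrix.det_mul_comm]
  have htr : (Q * (Gᵀ * G)⁻¹).trace = H.trace := by rw [hM, Matrix.trace_mul_comm]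
  have hcp : (Q * (Gᵀ * G)⁻¹).charpoly = H.charpoly := by rw [hM, Matrix.charpoly_mul_comm]
  rw [hdet'] at hdet
  have hprod : H.det = ∏ i, hH.eigenvalues i := by simpa using hH.det_eq_prod_eigenvalues
  have hne : ∀ i, hH.eigenvalues i ≠ 0 := by
    rw [hprod, Finset.prod_ne_zero_iff] at hdet
    exact fun i => hdet i (Finset.mem_univ i)
  rw [hcp, hdet', htr, hH.roots_charpoly_eq_eigenvalues, Multiset.map_map]
  have htr2 : H.trace = ∑ i, hH.eigenvalues i := by simpa using hH.trace_eq_sum_eigenvalues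
  rw [hprod, htr2, Real.log_prod fun i _ => hne i, Finset.mul_sum]
  change ∑ i, (-Real.log (hH.eigenvalues i * c) + hH.eigenvalues i * c) = _
  simp_rw [Real.log_mul (hne _) hc]
  simp only [neg_add, Finset.sum_add_distrib, Finset.sum_neg_distrib, Finset.sum_const,
    Finset.card_univ, nsmul_eq_mul]
  simp_rw [mul_comm c]
  ring

variable {N : ℕ} {O : Matrix (Fin N) (Fin N) ℝ} {w : Fin N → ℝ} {W : Matrix (Fin N) (Fin N) ℝ}

/-- The factor scales each prediction error by the square root of its weight. The factorization
supplies both the symmetry and the Gram form required by `sum_roots_charpoly_mul_inv`. -/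
theorem Prec_eq_transpose_mul (hD : Diagonalizes O w W) (T : ℕ) {θ : Theta}
    (hs : ∀ l, sv θ (w l) ≠ 0) (ha : ∀ l, |rv θ (w l) / sv θ (w l)| < 1) :
    ∃ G, Prec T W θ = Gᵀ * G := by
  refine ⟨specBlock O fun l =>
    Matrix.diagonal (fun t => √(predWeight T θ (w l) t)) * bMat T θ (w l), ?_⟩
  rw [Prec_eq hD T hs ha, specBlock_transpose, specBlock_mul hD.left]
  congr 1; ext1 l
  have : Matrix.diagonal (predWeight T θ (w l))
      = Matrix.diagonal (fun t => √(predWeight T θ (w l) t)) *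
        Matrix.diagonal (fun t => √(predWeight T θ (w l) t)) := by
    rw [Matrix.diagonal_mul_diagonal]
    congr 1; ext t
    refine (Real.mul_self_sqrt ?_).symm
    rw [predWeight]; split_ifs
    · exact (one_sub_sq_pos (ha l)).le
    · exact zero_le_one
  rw [precMat, this, Matrix.transpose_mul, Matrix.diagonal_transpose]
  simp only [Matrix.mul_assoc]

/-- The contribution of an eigenspace of `W` to the criterion `∑_j f_j(α)`. -/
def eigCrit (n : ℕ) (θ₀ : Theta) (v₀ : ℝ) (w : ℝ) (α : Fin 4 → ℝ) : ℝ :=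
  logPart n ![α 0, α 1, α 2] (α 3) w - logPart n θ₀ v₀ w
    + v₀ / α 3 * expForm n θ₀ ![α 0, α 1, α 2] w

/-- Determinants multiply and traces add over the eigenspaces, so the criterion becomes a sum over
the spectrum of `W` of one smooth function of (w, α). The Hessian can then be studied one eigenvalue
at a time. -/
theorem sumF_eq (hD : Diagonalizes O w W) {n : ℕ} {θ₀ : Theta} {v₀ : ℝ} (hv₀ : 0 < v₀)
    (hs₀ : ∀ l, sv θ₀ (w l) ≠ 0) (ha₀ : ∀ l, |rv θ₀ (w l) / sv θ₀ (w l)| < 1)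
    {α : Fin 4 → ℝ} (hα : 0 < α 3) (hs : ∀ l, sv ![α 0, α 1, α 2] (w l) ≠ 0)
    (ha : ∀ l, |rv ![α 0, α 1, α 2] (w l) / sv ![α 0, α 1, α 2] (w l)| < 1) :
    sumF (n + 1) W θ₀ v₀ α = ∑ l, eigCrit n θ₀ v₀ (w l) α := by
  set θ : Theta := ![α 0, α 1, α 2] with hθ
  obtain ⟨G, hG⟩ := Prec_eq_transpose_mul hD (n + 1) hs₀ ha₀
  have hsymm : (Prec (n + 1) W θ)ᵀ = Prec (n + 1) W θ := by
    obtain ⟨G', hG'⟩ := Prec_eq_transpose_mul hD (n + 1) hs ha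
    rw [hG', Matrix.transpose_mul, Matrix.transpose_transpose]
  have hdetp : ∀ {θ : Theta}, (∀ l, sv θ (w l) ≠ 0) → (∀ l, |rv θ (w l) / sv θ (w l)| < 1) →
      ∀ l, (precMat (n + 1) θ (w l)).det ≠ 0 := by
    intro θ hs ha l
    rw [precMat_det]
    exact mul_ne_zero (pow_ne_zero _ (hs l)) (one_sub_sq_pos (ha l)).ne'
  have hlog : ∀ {θ : Theta}, (∀ l, sv θ (w l) ≠ 0) → (∀ l, |rv θ (w l) / sv θ (w l)| < 1) →
      Real.log (Prec (n + 1) W θ).det = ∑ l, (2 * (n + 1) * Real.log (sv θ (w l))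
        + Real.log (1 - (rv θ (w l) / sv θ (w l)) ^ 2)) := by
    intro θ hs ha
    rw [Prec_eq hD _ hs ha, specBlock_det hD.left, Real.log_prod fun l _ => hdetp hs ha l]
    refine Finset.sum_congr rfl fun l _ => ?_
    rw [precMat_det, Real.log_mul (pow_ne_zero _ (hs l)) (one_sub_sq_pos (ha l)).ne', Real.log_pow]
    push_cast; ring
  have hne : ∀ {θ : Theta}, (∀ l, sv θ (w l) ≠ 0) → (∀ l, |rv θ (w l) / sv θ (w l)| < 1) →
      (Prec (n + 1) W θ).det ≠ 0 := by
    intro θ hs ha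
    rw [Prec_eq hD _ hs ha, specBlock_det hD.left, Finset.prod_ne_zero_iff]
    exact fun l _ => hdetp hs ha l
  have hdet : (Prec (n + 1) W θ * (Prec (n + 1) W θ₀)⁻¹).det
      = (Prec (n + 1) W θ).det * ((Prec (n + 1) W θ₀).det)⁻¹ := by
    rw [Matrix.det_mul, Matrix.det_nonsing_inv, Ring.inverse_eq_inv]
  have htr : (Prec (n + 1) W θ * (Prec (n + 1) W θ₀)⁻¹).trace = ∑ l, expForm n θ₀ θ (w l) := by
    rw [Prec_eq hD _ hs ha, Prec_inv_eq hD n hs₀ ha₀, specBlock_mul hD.left,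
      specBlock_trace hD.left]
    exact Finset.sum_congr rfl fun l _ => trace_precMat_mul_covMat (hs l)
  rw [sumF, ← hθ]
  have key := sum_roots_charpoly_mul_inv (G := G) hsymm (c := v₀ / α 3) (by positivity) (by
    rw [← hG, hdet]; exact mul_ne_zero (hne hs ha) (inv_ne_zero (hne hs₀ ha₀)))
  rw [← hG] at key
  rw [key, htr, hdet, Real.log_mul (hne hs ha) (inv_ne_zero (hne hs₀ ha₀)), Real.log_inv,
    hlog hs ha, hlog hs₀ ha₀, Real.log_div hv₀.ne' hα.ne']
  simp only [eigCrit, logPart, ← hθ, Finset.sum_add_distrib, Finset.sum_sub_distrib,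
    ← Finset.mul_sum, Finset.sum_const, Finset.card_univ, Fintype.card_fin, nsmul_eq_mul,
    Fintype.card_prod]
  push_cast
  ring

end Roots

/-! ### Calculus of Hessians and two elementary bounds -/

section Hessian

variable {d : ℕ}

theorem hessian_congr {f g : (Fin d → ℝ) → ℝ} {x : Fin d → ℝ} (h : f =ᶠ[𝓝 x] g) :
    hessian f x = hessian g x := by
  ext i j
  simp only [hessian, Matrix.of_apply]
  have h1 : (fun y => fderiv ℝ f y (Pi.single j 1)) =ᶠ[𝓝 x]
      fun y => fderiv ℝ g y (Pi.single j 1) :=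
    (h.fderiv (𝕜 := ℝ)).mono fun y hy => by simp only [hy]
  rw [h1.fderiv_eq]

theorem differentiableAt_fderiv_apply {f : (Fin d → ℝ) → ℝ} {x : Fin d → ℝ}
    (hf : ContDiffAt ℝ 2 f x) (e : Fin d → ℝ) :
    DifferentiableAt ℝ (fun y => fderiv ℝ f y e) x := by
  have h : ContDiffAt ℝ 1 (fderiv ℝ f) x := hf.fderiv_right (by norm_num)
  exact (h.differentiableAt (by norm_num)).clm_apply (differentiableAt_const _)

theorem hessian_sum {ι : Type*} [Fintype ι] {f : ι → (Fin d → ℝ) → ℝ} {x : Fin d → ℝ}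
    (hf : ∀ l, ContDiffAt ℝ 2 (f l) x) :
    hessian (fun y => ∑ l, f l y) x = ∑ l, hessian (f l) x := by
  ext i j
  simp only [hessian, Matrix.of_apply, Matrix.sum_apply]
  have hev : ∀ᶠ y in 𝓝 x, ∀ l, DifferentiableAt ℝ (f l) y := by
    rw [eventually_all]
    intro l
    filter_upwards [(hf l).eventually (by simp)] with y hy
    exact hy.differentiableAt (by norm_num)
  have h1 : (fun y => fderiv ℝ (fun y => ∑ l, f l y) y (Pi.single j 1)) =ᶠ[𝓝 x]
      fun y => ∑ l, fderiv ℝ (f l) y (Pi.single j 1) := by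
    filter_upwards [hev] with y hy
    rw [fderiv_fun_sum fun l _ => hy l]
    simp
  rw [h1.fderiv_eq, fderiv_fun_sum fun l _ => differentiableAt_fderiv_apply (hf l) _]
  simp

/-- Joint smoothness in the eigenvalue and the parameter is assumed because the entries must be
bounded uniformly over a compact set of eigenvalues. -/
theorem continuousAt_hessian {F : ℝ → (Fin d → ℝ) → ℝ} {w : ℝ} {x : Fin d → ℝ}
    (hF : ContDiffAt ℝ 2 (fun z : ℝ × (Fin d → ℝ) => F z.1 z.2) (w, x)) (i j : Fin d) :
    ContinuousAt (fun w => hessian (F w) x i j) w := by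
  have h1 : ContDiffAt ℝ 1
      (fun z : ℝ × (Fin d → ℝ) => fderiv ℝ (F z.1) z.2 (Pi.single j 1)) (w, x) := by
    have h0 : ContDiffAt ℝ 1 (fun z : ℝ × (Fin d → ℝ) => fderiv ℝ (F z.1) z.2) (w, x) := by
      refine ContDiffAt.fderiv (f := fun z : ℝ × (Fin d → ℝ) => F z.1) (g := fun z => z.2)
        (n := 2) ?_ contDiffAt_snd (by norm_num)
      have hp : ContDiffAt ℝ 2 (fun q : (ℝ × (Fin d → ℝ)) × (Fin d → ℝ) => (q.1.1, q.2))
          ((w, x), x) := by fun_prop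
      exact ContDiffAt.comp (g := fun z : ℝ × (Fin d → ℝ) => F z.1 z.2) ((w, x), x) hF hp
    exact h0.clm_apply contDiffAt_const
  have h2 : ContDiffAt ℝ 0
      (fun w => fderiv ℝ (fun y => fderiv ℝ (F w) y (Pi.single j 1)) x) w := by
    refine ContDiffAt.fderiv (f := fun w y => fderiv ℝ (F w) y (Pi.single j 1))
      (g := fun _ => x) (n := 1) h1 contDiffAt_const (by norm_num)
  exact (h2.clm_apply contDiffAt_const).continuousAt

theorem hessian_mulVec {f : (Fin d → ℝ) → ℝ} {x : Fin d → ℝ} (hf : ContDiffAt ℝ 2 f x)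
    (e : Fin d → ℝ) (i : Fin d) :
    (hessian f x *ᵥ e) i = fderiv ℝ (fderiv ℝ f) x (Pi.single i 1) e := by
  have h : ContDiffAt ℝ 1 (fderiv ℝ f) x := hf.fderiv_right (by norm_num)
  have hd := h.differentiableAt (by norm_num)
  have h1 : ∀ j, hessian f x i j = fderiv ℝ (fderiv ℝ f) x (Pi.single i 1) (Pi.single j 1) := by
    intro j
    rw [hessian, Matrix.of_apply, fderiv_clm_apply hd (differentiableAt_const _)]
    simp
  simp only [Matrix.mulVec, dotProduct, h1]
  conv_rhs => rw [pi_eq_sum_univ' e, map_sum]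
  refine Finset.sum_congr rfl fun j _ => ?_
  rw [map_smul, smul_eq_mul, mul_comm]

/-- At a critical point, a smooth vector field that annihilates `f` is in the kernel of the
Hessian. -/
theorem hessian_mulVec_eq_zero {f : (Fin d → ℝ) → ℝ} {x : Fin d → ℝ} (hf : ContDiffAt ℝ 2 f x)
    {V : (Fin d → ℝ) → (Fin d → ℝ)} (hV : DifferentiableAt ℝ V x)
    (hVf : ∀ᶠ y in 𝓝 x, fderiv ℝ f y (V y) = 0) (hx : fderiv ℝ f x = 0) :
    hessian f x *ᵥ V x = 0 := by
  ext i
  rw [hessian_mulVec hf]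
  have h : ContDiffAt ℝ 1 (fderiv ℝ f) x := hf.fderiv_right (by norm_num)
  have hd := h.differentiableAt (by norm_num)
  have h1 : fderiv ℝ (fun y => fderiv ℝ f y (V y)) x = 0 := by
    have : (fun y => fderiv ℝ f y (V y)) =ᶠ[𝓝 x] fun _ => 0 := hVf
    rw [this.fderiv_eq, fderiv_fun_const]; rfl
  -- The product rule gives f''(x)(·)(V x) plus f'(x) applied to the derivative of V; the second
  -- term drops out at a critical point.
  rw [fderiv_clm_apply hd hV, hx] at h1
  have h2 := congrArg (fun L => L (Pi.single i 1)) h1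
  simpa using h2

/-- A bound for a determinant in terms of bounds for the entries of the first column and for all
entries. -/
theorem abs_det_le (M : Matrix (Fin 4) (Fin 4) ℝ) {C η : ℝ} (hη : 0 ≤ η)
    (h0 : ∀ i, |M i 0| ≤ η) (hC : ∀ i j, |M i j| ≤ C) : |M.det| ≤ 24 * (η * C ^ 3) := by
  have hC0 : 0 ≤ C := (abs_nonneg _).trans (hC 0 0)
  rw [Matrix.det_apply]
  refine (Finset.abs_sum_le_sum_abs _ _).trans ?_
  have h1 : ∀ σ ∈ (Finset.univ : Finset (Equiv.Perm (Fin 4))),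
      |Equiv.Perm.sign σ • ∏ i, M (σ i) i| ≤ η * C ^ 3 := by
    intro σ _
    have : |Equiv.Perm.sign σ • ∏ i, M (σ i) i| = |∏ i, M (σ i) i| := by
      rcases Int.units_eq_one_or (Equiv.Perm.sign σ) with h | h <;> simp [h]
    rw [this, Fin.prod_univ_succ, abs_mul, Finset.abs_prod]
    refine mul_le_mul (h0 _) ?_ (Finset.prod_nonneg fun _ _ => abs_nonneg _) hη
    calc ∏ i : Fin 3, |M (σ i.succ) i.succ| ≤ ∏ _i : Fin 3, C :=
          Finset.prod_le_prod (fun _ _ => abs_nonneg _) fun i _ => hC _ _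
      _ = C ^ 3 := by simp
  refine (Finset.sum_le_sum h1).trans ?_
  rw [Finset.sum_const, Finset.card_univ, Fintype.card_perm, Fintype.card_fin, nsmul_eq_mul]
  norm_num [Nat.factorial]

/-- A continuous function on a compact set of reals that vanishes at the origin is dominated by
an arbitrarily small constant plus a multiple of the square. -/
theorem exists_abs_le_add_mul_sq {s : Set ℝ} (hs : IsCompact s) {h : ℝ → ℝ}
    (hc : ContinuousOn h s) (h0 : 0 ∈ s → h 0 = 0) {ε : ℝ} (hε : 0 < ε) :
    ∃ C, 0 ≤ C ∧ ∀ w ∈ s, |h w| ≤ ε + C * w ^ 2 := by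
  obtain ⟨H, hH⟩ := hs.exists_bound_of_continuousOn hc
  by_cases h0s : 0 ∈ s
  · have hcont := hc 0 h0s
    rw [Metric.continuousWithinAt_iff] at hcont
    obtain ⟨r, hr, hr'⟩ := hcont ε hε
    -- Within distance r of the origin continuity gives the bound ε; beyond it w² / r² ≥ 1 absorbs
    -- the global bound.
    refine ⟨|H| / r ^ 2, by positivity, fun w hw => ?_⟩
    by_cases hwr : |w| < r
    · have h1 := hr' hw (by simpa using hwr)
      rw [h0 h0s, Real.dist_eq, sub_zero] at h1
      have : 0 ≤ |H| / r ^ 2 * w ^ 2 := by positivity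
      linarith
    · have h1 : r ^ 2 ≤ w ^ 2 := by
        rw [← sq_abs w]; exact pow_le_pow_left₀ hr.le (not_lt.mp hwr) 2
      have h2 : |h w| ≤ |H| := (hH w hw).trans (le_abs_self H)
      have h3 : |H| ≤ |H| / r ^ 2 * w ^ 2 := by
        rw [div_mul_eq_mul_div, le_div_iff₀ (by positivity)]
        exact mul_le_mul_of_nonneg_left h1 (abs_nonneg _)
      linarith
  · obtain ⟨r, hr, hr'⟩ : ∃ r > 0, ∀ w ∈ s, r ≤ |w| := by
      have := hs.isClosed.isOpen_compl.mem_nhds h0s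
      obtain ⟨r, hr, hb⟩ := Metric.mem_nhds_iff.mp this
      refine ⟨r, hr, fun w hw => ?_⟩
      by_contra hlt
      exact hb (by simpa using not_le.mp hlt) hw
    refine ⟨|H| / r ^ 2, by positivity, fun w hw => ?_⟩
    have h1 : r ^ 2 ≤ w ^ 2 := by
      rw [← sq_abs w]; exact pow_le_pow_left₀ hr.le (hr' w hw) 2
    have h2 : |h w| ≤ |H| := (hH w hw).trans (le_abs_self H)
    have h3 : |H| ≤ |H| / r ^ 2 * w ^ 2 := by
      rw [div_mul_eq_mul_div, le_div_iff₀ (by positivity)]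
      exact mul_le_mul_of_nonneg_left h1 (abs_nonneg _)
    linarith

end Hessian

/-! ### Smoothness of the criterion on an eigenspace and the Hessian as a spectral sum -/

section Crit

variable {n : ℕ} {θ₀ : Theta} {v₀ : ℝ}

theorem vec_theta (θ : Theta) : ![θ 0, θ 1, θ 2] = θ := by
  ext i; fin_cases i <;> rfl

theorem contDiffAt_eigCrit {w : ℝ} (hs : sv θ₀ w ≠ 0) (ha : |rv θ₀ w / sv θ₀ w| < 1)
    {α : Fin 4 → ℝ} (hα : 0 < α 3) (hsα : sv ![α 0, α 1, α 2] w ≠ 0)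
    (haα : |rv ![α 0, α 1, α 2] w / sv ![α 0, α 1, α 2] w| < 1) :
    ContDiffAt ℝ 2 (fun z : ℝ × (Fin 4 → ℝ) => eigCrit n θ₀ v₀ z.1 z.2) (w, α) := by
  have h1 := (one_sub_sq_pos haα).ne'
  have h2 := (one_sub_sq_pos ha).ne'
  have h3 := (sq_sub_sq_pos hs ha).ne'
  simp only [sv, rv, Matrix.cons_val_zero, Matrix.cons_val_one, Matrix.cons_val] at h1 h2 h3 hs hsα
  unfold eigCrit logPart expForm
  simp only [sv, rv, Matrix.cons_val_zero, Matrix.cons_val_one, Matrix.cons_val]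
  have hα' := hα.ne'
  have p0 : ContDiffAt ℝ 2 (fun z : ℝ × (Fin 4 → ℝ) => z.1) (w, α) := contDiffAt_fst
  have pj : ∀ j, ContDiffAt ℝ 2 (fun z : ℝ × (Fin 4 → ℝ) => z.2 j) (w, α) := by
    intro j; fun_prop
  have ps : ContDiffAt ℝ 2 (fun z : ℝ × (Fin 4 → ℝ) => 1 - z.2 0 * z.1) (w, α) := by fun_prop
  have pr : ContDiffAt ℝ 2 (fun z : ℝ × (Fin 4 → ℝ) => z.2 2 * z.1 + z.2 1) (w, α) := by fun_prop
  have ps0 : ContDiffAt ℝ 2 (fun z : ℝ × (Fin 4 → ℝ) => 1 - θ₀ 0 * z.1) (w, α) := by fun_prop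
  have pr0 : ContDiffAt ℝ 2 (fun z : ℝ × (Fin 4 → ℝ) => θ₀ 2 * z.1 + θ₀ 1) (w, α) := by fun_prop
  have pa := pr.div ps hsα
  have pa0 := pr0.div ps0 hs
  have q1 := ((contDiffAt_const (c := (1 : ℝ))).sub (pa.pow 2)).log h1
  have q2 := ((contDiffAt_const (c := (1 : ℝ))).sub (pa0.pow 2)).log h2
  have q3 := ((ps0.pow 2).sub (pr0.pow 2)).inv h3
  have c : ∀ x : ℝ, ContDiffAt ℝ 2 (fun _ : ℝ × (Fin 4 → ℝ) => x) (w, α) :=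
    fun x => contDiffAt_const
  have e1 := (((c (n + 1)).mul ((pj 3).log hα')).sub ((c (2 * (n + 1))).mul (ps.log hsα))).sub q1
  have e2 := ((c ((n + 1) * Real.log v₀)).sub ((c (2 * (n + 1))).mul (ps0.log hs))).sub q2
  have e3 := ((c v₀).div (pj 3) hα').mul (q3.mul (((ps.pow 2).sub (pr.pow 2)).add
    ((c n).mul (((ps.pow 2).add (pr.pow 2)).sub ((c 2).mul ((pr.mul ps).mul pa0))))))
  exact (e1.sub e2).add e3

theorem contDiffAt_eigCrit_snd {w : ℝ} (hs : sv θ₀ w ≠ 0) (ha : |rv θ₀ w / sv θ₀ w| < 1)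
    {α : Fin 4 → ℝ} (hα : 0 < α 3) (hsα : sv ![α 0, α 1, α 2] w ≠ 0)
    (haα : |rv ![α 0, α 1, α 2] w / sv ![α 0, α 1, α 2] w| < 1) :
    ContDiffAt ℝ 2 (eigCrit n θ₀ v₀ w) α :=
  ContDiffAt.comp (g := fun z : ℝ × (Fin 4 → ℝ) => eigCrit n θ₀ v₀ z.1 z.2) (f := fun α => (w, α))
    α (contDiffAt_eigCrit hs ha hα hsα haα) (by fun_prop)

theorem fderiv_apply_eq_of_hasDerivAt_line {d : ℕ} {f : (Fin d → ℝ) → ℝ} {x e : Fin d → ℝ} {f' : ℝ}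
    (hf : DifferentiableAt ℝ f x) (h : HasDerivAt (fun t : ℝ => f (x + t • e)) f' 0) :
    fderiv ℝ f x e = f' :=
  (hf.hasFDerivAt.hasLineDerivAt e).unique h

/-- On the eigenspace of the eigenvalue zero the criterion does not depend on `λ`. -/
theorem hessian_eigCrit_zero (hs : sv θ₀ 0 ≠ 0) (ha : |rv θ₀ 0 / sv θ₀ 0| < 1) (hv : 0 < v₀)
    (i : Fin 4) : hessian (eigCrit n θ₀ v₀ 0) ![θ₀ 0, θ₀ 1, θ₀ 2, v₀] i 0 = 0 := by
  have hc : ContDiffAt ℝ 2 (eigCrit n θ₀ v₀ 0) ![θ₀ 0, θ₀ 1, θ₀ 2, v₀] := by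
    refine contDiffAt_eigCrit_snd hs ha ?_ ?_ ?_ <;>
      simpa [vec_theta]
  have h1 : (fun y => fderiv ℝ (eigCrit n θ₀ v₀ 0) y (Pi.single 0 1))
      =ᶠ[𝓝 ![θ₀ 0, θ₀ 1, θ₀ 2, v₀]] fun _ => 0 := by
    filter_upwards [hc.eventually (by simp)] with y hy
    refine fderiv_apply_eq_of_hasDerivAt_line (hy.differentiableAt (by norm_num)) ?_
    have : (fun t : ℝ => eigCrit n θ₀ v₀ 0 (y + t • Pi.single 0 1))
        = fun _ => eigCrit n θ₀ v₀ 0 y := by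
      ext t
      simp [eigCrit, logPart, expForm, sv, rv]
    rw [this]
    exact hasDerivAt_const _ _
  rw [hessian, Matrix.of_apply, h1.fderiv_eq, fderiv_fun_const]
  rfl

/-- The spectral formula is available only for admissible parameters. The true value being interior
gives a whole neighbourhood of them, as second derivatives require. -/
theorem eventually_sumF_eq {N : ℕ} {O : Matrix (Fin N) (Fin N) ℝ} {w : Fin N → ℝ}
    {W : Matrix (Fin N) (Fin N) ℝ} (hD : Diagonalizes O w W) (hv : 0 < v₀)
    {Θθ : Set Theta} (hΘ : Θθ ∈ 𝓝 θ₀) (hadm : ∀ θ ∈ Θθ, Admissible W θ) :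
    sumF (n + 1) W θ₀ v₀ =ᶠ[𝓝 ![θ₀ 0, θ₀ 1, θ₀ 2, v₀]]
      fun α => ∑ l, eigCrit n θ₀ v₀ (w l) α := by
  have h0 := hadm θ₀ (mem_of_mem_nhds hΘ)
  have hc : Continuous fun α : Fin 4 → ℝ => (![α 0, α 1, α 2] : Theta) := by
    refine continuous_pi fun i => ?_
    fin_cases i <;> simp <;> fun_prop
  have hc3 : Continuous fun α : Fin 4 → ℝ => α 3 := by fun_prop
  have e1 : ∀ᶠ α in 𝓝 ![θ₀ 0, θ₀ 1, θ₀ 2, v₀], (![α 0, α 1, α 2] : Theta) ∈ Θθ := by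
    refine hc.continuousAt.eventually_mem ?_
    simpa [vec_theta] using hΘ
  have e2 : ∀ᶠ α in 𝓝 ![θ₀ 0, θ₀ 1, θ₀ 2, v₀], 0 < α 3 :=
    hc3.continuousAt.eventually_mem (Ioi_mem_nhds (by simpa using hv))
  filter_upwards [e1, e2] with α h1 h2
  exact sumF_eq hD hv (sv_ne_zero hD h0.1) (abs_ratio_lt_one hD h0) h2
    (sv_ne_zero hD (hadm _ h1).1) (abs_ratio_lt_one hD (hadm _ h1))

theorem hessian_sumF_eq {N : ℕ} {O : Matrix (Fin N) (Fin N) ℝ} {w : Fin N → ℝ}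
    {W : Matrix (Fin N) (Fin N) ℝ} (hD : Diagonalizes O w W) (hv : 0 < v₀)
    {Θθ : Set Theta} (hΘ : Θθ ∈ 𝓝 θ₀) (hadm : ∀ θ ∈ Θθ, Admissible W θ) :
    hessian (sumF (n + 1) W θ₀ v₀) ![θ₀ 0, θ₀ 1, θ₀ 2, v₀]
      = ∑ l, hessian (eigCrit n θ₀ v₀ (w l)) ![θ₀ 0, θ₀ 1, θ₀ 2, v₀] := by
  have h0 := hadm θ₀ (mem_of_mem_nhds hΘ)
  have hs := sv_ne_zero hD h0.1
  have ha := abs_ratio_lt_one hD h0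
  rw [hessian_congr (eventually_sumF_eq hD hv hΘ hadm), hessian_sum]
  intro l
  exact contDiffAt_eigCrit_snd (hs l) (ha l) (by simpa) (by simpa [vec_theta] using hs l)
    (by simpa [vec_theta] using ha l)

/-! ### Lower bound for the second spectral moment -/

/-- The eigenvalues of `W` that are compatible with given bounds at the parameter `θ₀`. -/
def eigSet (θ₀ : Theta) (M c q : ℝ) : Set ℝ :=
  {w | |w| ≤ M ∧ c ≤ |sv θ₀ w| ∧ |rv θ₀ w| ≤ q * |sv θ₀ w|}

theorem isCompact_eigSet (θ₀ : Theta) (M c q : ℝ) : IsCompact (eigSet θ₀ M c q) := by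
  have h1 : Continuous fun w => sv θ₀ w := by unfold sv; fun_prop
  have h2 : Continuous fun w => rv θ₀ w := by unfold rv; fun_prop
  refine (isCompact_Icc (a := -M) (b := M)).of_isClosed_subset ?_ fun w hw => abs_le.mp hw.1
  exact (isClosed_le continuous_abs continuous_const).inter
    ((isClosed_le continuous_const h1.abs).inter
      (isClosed_le h2.abs (continuous_const.mul h1.abs)))

theorem eigSet_bounds {M c q : ℝ} (hc : 0 < c) (hq : q < 1) {w : ℝ}
    (hw : w ∈ eigSet θ₀ M c q) : sv θ₀ w ≠ 0 ∧ |rv θ₀ w / sv θ₀ w| < 1 := by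
  have h1 : 0 < |sv θ₀ w| := hc.trans_le hw.2.1
  refine ⟨abs_pos.mp h1, ?_⟩
  rw [abs_div, div_lt_one h1]
  exact hw.2.2.trans_lt (by nlinarith)

/-- Asymptotic nonsingularity of the Hessian keeps the second moment of the spectral distribution
of `W` away from zero. -/
theorem exists_le_mean_sq_of_hessian {N : ℕ → ℕ} {O : ∀ m, Matrix (Fin (N m)) (Fin (N m)) ℝ}
    {w : ∀ m, Fin (N m) → ℝ} {W : ∀ m, Matrix (Fin (N m)) (Fin (N m)) ℝ}
    (hD : ∀ m, Diagonalizes (O m) (w m) (W m)) (hv : 0 < v₀)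
    {Θθ : Set Theta} (hΘ : Θθ ∈ 𝓝 θ₀) (hadm : ∀ m, ∀ θ ∈ Θθ, Admissible (W m) θ)
    {M c q : ℝ} (hc : 0 < c) (hq : q < 1) (hw : ∀ m l, w m l ∈ eigSet θ₀ M c q)
    (hH : ∃ c > 0, ∀ᶠ m in atTop, c ≤ |((1 / (N m : ℝ)) •
      hessian (sumF (n + 1) (W m) θ₀ v₀) ![θ₀ 0, θ₀ 1, θ₀ 2, v₀]).det|) :
    ∃ c > 0, ∀ᶠ m in atTop, c ≤ 1 / (N m : ℝ) * ∑ l, w m l ^ 2 := by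
  obtain ⟨c₁, hc₁, hH⟩ := hH
  set α₀ : Fin 4 → ℝ := ![θ₀ 0, θ₀ 1, θ₀ 2, v₀] with hα₀
  have hcont : ∀ i j, ContinuousOn (fun w => hessian (eigCrit n θ₀ v₀ w) α₀ i j)
      (eigSet θ₀ M c q) := by
    intro i j w hw
    obtain ⟨h1, h2⟩ := eigSet_bounds hc hq hw
    refine (continuousAt_hessian (contDiffAt_eigCrit h1 h2 ?_ ?_ ?_) i j).continuousWithinAt
    · simpa [hα₀] using hv
    · simpa [hα₀, vec_theta] using h1
    · simpa [hα₀, vec_theta] using h2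
  have hbd : ∀ i j, ∃ C, ∀ w ∈ eigSet θ₀ M c q, |hessian (eigCrit n θ₀ v₀ w) α₀ i j| ≤ C :=
    fun i j => (isCompact_eigSet θ₀ M c q).exists_bound_of_continuousOn (hcont i j)
  choose C hC using hbd
  set C' : ℝ := 1 + ∑ i, ∑ j, |C i j| with hC'
  have hC'1 : 1 ≤ C' := by
    have : 0 ≤ ∑ i, ∑ j, |C i j| :=
      Finset.sum_nonneg fun _ _ => Finset.sum_nonneg fun _ _ => abs_nonneg _
    linarith
  have hCle : ∀ i j, C i j ≤ C' := by
    intro i j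
    have h1 : |C i j| ≤ ∑ j, |C i j| :=
      Finset.single_le_sum (f := fun j => |C i j|) (fun _ _ => abs_nonneg _) (Finset.mem_univ j)
    have h2 : ∑ j, |C i j| ≤ ∑ i, ∑ j, |C i j| :=
      Finset.single_le_sum (f := fun i => ∑ j, |C i j|)
        (fun _ _ => Finset.sum_nonneg fun _ _ => abs_nonneg _) (Finset.mem_univ i)
    have := le_abs_self (C i j)
    linarith
  -- With this choice the part 24 ε C'³ of the determinant bound is c₁ / 2, and the other half of c₁
  -- must come from the second moment.
  set ε : ℝ := c₁ / (48 * C' ^ 3) with hε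
  have hε0 : 0 < ε := by positivity
  have hcol : ∀ i, ∃ D, 0 ≤ D ∧ ∀ w ∈ eigSet θ₀ M c q,
      |hessian (eigCrit n θ₀ v₀ w) α₀ i 0| ≤ ε + D * w ^ 2 := by
    intro i
    refine exists_abs_le_add_mul_sq (isCompact_eigSet θ₀ M c q) (hcont i 0) (fun h0 => ?_) hε0
    obtain ⟨h1, h2⟩ := eigSet_bounds hc hq h0
    exact hessian_eigCrit_zero h1 h2 hv i
  choose D hD0 hDle using hcol
  set D' : ℝ := 1 + ∑ i, D i with hD'
  have hDD : ∀ i, D i ≤ D' := by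
    intro i
    have := Finset.single_le_sum (f := D) (fun i _ => hD0 i) (Finset.mem_univ i)
    linarith
  have hD'0 : 0 < D' := by
    have : 0 ≤ ∑ i, D i := Finset.sum_nonneg fun i _ => hD0 i
    linarith
  refine ⟨c₁ / (48 * C' ^ 3 * D'), by positivity, ?_⟩
  filter_upwards [hH] with m hm
  rw [hessian_sumF_eq (hD m) hv hΘ (hadm m), ← hα₀] at hm
  set μ := 1 / (N m : ℝ) * ∑ l, w m l ^ 2 with hμ
  have hμ0 : 0 ≤ μ := by positivity
  rcases Nat.eq_zero_or_pos (N m) with hN | hN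
  · exfalso
    -- For N = 0 the convention 1 / 0 = 0 makes the normalized Hessian zero, which contradicts the
    -- lower bound.
    rw [show 1 / (N m : ℝ) = 0 by simp [hN], zero_smul, Matrix.det_zero] at hm
    simp at hm
    linarith
  have hNr : (0 : ℝ) < N m := by exact_mod_cast hN
  have hmean : ∀ (f : Fin (N m) → ℝ) (x : ℝ), (∀ l, |f l| ≤ x) →
      |1 / (N m : ℝ) * ∑ l, f l| ≤ x := by
    intro f x hf
    rw [abs_mul, abs_of_pos (by positivity : 0 < 1 / (N m : ℝ)), one_div, inv_mul_le_iff₀ hNr]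
    refine (Finset.abs_sum_le_sum_abs _ _).trans ((Finset.sum_le_sum fun l _ => hf l).trans ?_)
    simp
  -- The first column consists of derivatives involving λ; averaged over the spectrum it is at most
  -- ε + D'μ, while all entries are at most C'.
  have hdet := abs_det_le ((1 / (N m : ℝ)) • ∑ l, hessian (eigCrit n θ₀ v₀ (w m l)) α₀)
    (C := C') (η := ε + D' * μ) (by positivity) (fun i => by
      rw [Matrix.smul_apply, Matrix.sum_apply, smul_eq_mul, abs_mul,
        abs_of_pos (by positivity : 0 < 1 / (N m : ℝ)), one_div, inv_mul_le_iff₀ hNr]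
      refine (Finset.abs_sum_le_sum_abs _ _).trans ?_
      have : ∀ l ∈ Finset.univ, |hessian (eigCrit n θ₀ v₀ (w m l)) α₀ i 0|
          ≤ ε + D' * w m l ^ 2 := fun l _ => (hDle i _ (hw m l)).trans
        (by nlinarith [hDD i, sq_nonneg (w m l)])
      refine (Finset.sum_le_sum this).trans (le_of_eq ?_)
      rw [Finset.sum_add_distrib, ← Finset.mul_sum, hμ]
      simp only [Finset.sum_const, Finset.card_univ, Fintype.card_fin, nsmul_eq_mul]
      field_simp) (fun i j => by
      rw [Matrix.smul_apply, Matrix.sum_apply, smul_eq_mul]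
      exact hmean _ _ fun l => (hC i j _ (hw m l)).trans (hCle i j))
  have h1 : c₁ ≤ 24 * ((ε + D' * μ) * C' ^ 3) := hm.trans hdet
  have h2 : 24 * (ε * C' ^ 3) = c₁ / 2 := by rw [hε]; field_simp; norm_num
  rw [div_le_iff₀ (by positivity)]
  nlinarith

/-! ### Degeneracy for fewer than two observation times -/

/-- The derivative along a line of the criterion for a single observation time. -/
theorem fderiv_eigCrit_single {w : ℝ} {α e : Fin 4 → ℝ} (hα : 0 < α 3)
    (hs : sv θ₀ w ≠ 0) (ha : |rv θ₀ w / sv θ₀ w| < 1) (hsα : sv ![α 0, α 1, α 2] w ≠ 0)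
    (haα : |rv ![α 0, α 1, α 2] w / sv ![α 0, α 1, α 2] w| < 1) {s r : ℝ}
    (hs_eq : s = sv ![α 0, α 1, α 2] w) (hr_eq : r = rv ![α 0, α 1, α 2] w) {s' r' : ℝ}
    (hs' : s' = -(e 0 * w)) (hr' : r' = e 2 * w + e 1) :
    fderiv ℝ (eigCrit 0 θ₀ v₀ w) α e = e 3 / α 3 - (2 * s * s' - 2 * r * r') / (s ^ 2 - r ^ 2)
      + v₀ * (sv θ₀ w ^ 2 - rv θ₀ w ^ 2)⁻¹ * ((2 * s * s' - 2 * r * r') / α 3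
        - (s ^ 2 - r ^ 2) * e 3 / α 3 ^ 2) := by
  have hc := contDiffAt_eigCrit_snd (n := 0) (v₀ := v₀) hs ha hα hsα haα
  refine fderiv_apply_eq_of_hasDerivAt_line (hc.differentiableAt (by norm_num)) ?_
  have hg := (sq_sub_sq_pos hsα haα).ne'
  have h1 := (one_sub_sq_pos haα).ne'
  have hα' := hα.ne'
  set γ := (sv θ₀ w ^ 2 - rv θ₀ w ^ 2)⁻¹ with hγ
  have hS : HasDerivAt (fun t : ℝ => sv ![(α + t • e) 0, (α + t • e) 1, (α + t • e) 2] w) s' 0 := by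
    have := (((hasDerivAt_id (0 : ℝ)).mul_const (e 0)).const_add (α 0)).mul_const w
    exact (this.const_sub 1).congr_deriv (by rw [hs']; ring)
  have hR : HasDerivAt (fun t : ℝ => rv ![(α + t • e) 0, (α + t • e) 1, (α + t • e) 2] w) r' 0 := by
    have h2 := (((hasDerivAt_id (0 : ℝ)).mul_const (e 2)).const_add (α 2)).mul_const w
    have h3 := ((hasDerivAt_id (0 : ℝ)).mul_const (e 1)).const_add (α 1)
    exact (h2.add h3).congr_deriv (by rw [hr']; ring)
  have hV : HasDerivAt (fun t : ℝ => (α + t • e) 3) (e 3) 0 := by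
    have := ((hasDerivAt_id (0 : ℝ)).mul_const (e 3)).const_add (α 3)
    exact this.congr_deriv (one_mul _)
  have hS0 : sv ![(α + (0 : ℝ) • e) 0, (α + (0 : ℝ) • e) 1, (α + (0 : ℝ) • e) 2] w = s := by
    rw [hs_eq]; simp
  have hR0 : rv ![(α + (0 : ℝ) • e) 0, (α + (0 : ℝ) • e) 1, (α + (0 : ℝ) • e) 2] w = r := by
    rw [hr_eq]; simp
  have hV0 : (α + (0 : ℝ) • e) 3 = α 3 := by simp
  rw [← hs_eq] at hsα h1 hg
  rw [← hr_eq] at h1 hg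
  have d1 := hV.log (by rw [hV0]; exact hα')
  have d2 := hS.log (by rw [hS0]; exact hsα)
  have d3 := (((hR.fun_div hS (by rw [hS0]; exact hsα)).fun_pow 2).const_sub 1).log
    (by rw [hS0, hR0]; exact h1)
  have d4 := ((hasDerivAt_const (0 : ℝ) v₀).fun_div hV (by rw [hV0]; exact hα')).fun_mul
    (((hS.fun_pow 2).fun_sub (hR.fun_pow 2)).const_mul γ)
  have d := ((((d1.fun_sub (d2.const_mul 2)).fun_sub d3).sub_const
    (logPart 0 θ₀ v₀ w))).fun_add d4
  refine (d.congr_deriv ?_).congr_of_eventuallyEq (Eventually.of_forall fun t => ?_)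
  · rw [hS0, hR0, hV0]
    simp only [show (2 : ℕ) - 1 = 1 from rfl, pow_one, Nat.cast_ofNat]
    have h2 : s ^ 2 - r ^ 2 ≠ 0 := hg
    have h3 : 1 - (r / s) ^ 2 = (s ^ 2 - r ^ 2) / s ^ 2 := by field_simp
    rw [h3]
    field_simp
    ring
  · simp only [eigCrit, logPart, expForm, Nat.cast_zero, zero_add, one_mul, mul_one, zero_mul,
      add_zero, ← hγ]

/-- The infinitesimal hyperbolic rotation that leaves `(S² - R²) / σ²` invariant. -/
def hypField (α : Fin 4 → ℝ) : Fin 4 → ℝ :=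
  ![-(α 2 + α 0 * α 1), 1 - α 1 ^ 2, -(α 0 + α 2 * α 1), -2 * α 1 * α 3]

/-- With a single observation time the Hessian is singular. -/
theorem det_hessian_sumF_one {N : ℕ} {W : Matrix (Fin N) (Fin N) ℝ} (hsymm : W.IsSymm)
    (hv : 0 < v₀) {Θθ : Set Theta} (hΘ : Θθ ∈ 𝓝 θ₀) (hadm : ∀ θ ∈ Θθ, Admissible W θ) :
    (hessian (sumF 1 W θ₀ v₀) ![θ₀ 0, θ₀ 1, θ₀ 2, v₀]).det = 0 := by
  obtain ⟨O, w, hD⟩ := exists_diagonalizes hsymm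
  have h0 := hadm θ₀ (mem_of_mem_nhds hΘ)
  have hs := sv_ne_zero hD h0.1
  have ha := abs_ratio_lt_one hD h0
  set α₀ : Fin 4 → ℝ := ![θ₀ 0, θ₀ 1, θ₀ 2, v₀] with hα₀
  have hθ : (![α₀ 0, α₀ 1, α₀ 2] : Theta) = θ₀ := by simp [hα₀, vec_theta]
  -- The γ- and σ²-components 1 - γ² and -2γσ² cannot both vanish.
  have hne : hypField α₀ ≠ 0 := by
    intro h
    have e1 : 1 - θ₀ 1 ^ 2 = 0 := by simpa [hypField, hα₀] using congrFun h 1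
    have e3 : θ₀ 1 = 0 ∨ v₀ = 0 := by simpa [hypField, hα₀] using congrFun h 3
    rcases e3 with e3 | e3
    · rw [e3] at e1; norm_num at e1
    · exact hv.ne' e3
  refine Matrix.exists_mulVec_eq_zero_iff.mp ⟨hypField α₀, hne, ?_⟩
  rw [hα₀, hessian_sumF_eq (n := 0) hD hv hΘ hadm, ← hα₀, Matrix.sum_mulVec]
  refine Finset.sum_eq_zero fun l _ => ?_
  have hc : ContDiffAt ℝ 2 (eigCrit 0 θ₀ v₀ (w l)) α₀ :=
    contDiffAt_eigCrit_snd (hs l) (ha l) (by simpa [hα₀]) (by rw [hθ]; exact hs l)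
      (by rw [hθ]; exact ha l)
  refine hessian_mulVec_eq_zero hc ?_ ?_ ?_
  · refine differentiableAt_pi.mpr fun i => ?_
    fin_cases i <;> simp [hypField] <;> fun_prop
  · have hcθ : Continuous fun α : Fin 4 → ℝ => (![α 0, α 1, α 2] : Theta) := by
      refine continuous_pi fun i => ?_
      fin_cases i <;> simp <;> fun_prop
    have hc3 : Continuous fun α : Fin 4 → ℝ => α 3 := by fun_prop
    have e1 : ∀ᶠ α in 𝓝 α₀, (![α 0, α 1, α 2] : Theta) ∈ Θθ :=
      hcθ.continuousAt.eventually_mem (by rw [hθ]; exact hΘ)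
    have e2 : ∀ᶠ α in 𝓝 α₀, 0 < α 3 :=
      hc3.continuousAt.eventually_mem (Ioi_mem_nhds (by simpa [hα₀] using hv))
    filter_upwards [e1, e2] with α h1 h2
    have hsα := sv_ne_zero hD (hadm _ h1).1 l
    have haα := abs_ratio_lt_one hD (hadm _ h1) l
    have hg := (sq_sub_sq_pos hsα haα).ne'
    rw [fderiv_eigCrit_single h2 (hs l) (ha l) hsα haα rfl rfl rfl rfl]
    set s := sv ![α 0, α 1, α 2] (w l) with hs_def
    set r := rv ![α 0, α 1, α 2] (w l) with hr_def
    -- Along the field s' = r - γs and r' = s - γr, hence (s² - r²)' = -2γ(s² - r²), the same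
    -- relative rate as that of σ². The field is the same for every w, so it annihilates all
    -- summands at once.
    have f0 : -(hypField α 0 * w l) = r - α 1 * s := by
      simp [hypField, hs_def, hr_def, sv, rv]; ring
    have f1 : hypField α 2 * w l + hypField α 1 = s - α 1 * r := by
      simp [hypField, hs_def, hr_def, sv, rv]; ring
    have f3 : hypField α 3 = -2 * α 1 * α 3 := by simp [hypField]
    rw [f0, f1, f3]
    field_simp
    ring
  -- The true parameter is critical: with x = v₀(s² - r²)/((s₀² - r₀²)σ²) the criterion is x - log x
  -- up to a constant, and x = 1 there.
  · ext e
    have hsα : sv ![α₀ 0, α₀ 1, α₀ 2] (w l) ≠ 0 := by rw [hθ]; exact hs l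
    have haα : |rv ![α₀ 0, α₀ 1, α₀ 2] (w l) / sv ![α₀ 0, α₀ 1, α₀ 2] (w l)| < 1 := by
      rw [hθ]; exact ha l
    have hα3 : α₀ 3 = v₀ := by simp [hα₀]
    rw [fderiv_eigCrit_single (by rw [hα3]; exact hv) (hs l) (ha l) hsα haα rfl rfl rfl rfl, hθ,
      hα3]
    have hg := (sq_sub_sq_pos (hs l) (ha l)).ne'
    simp only [zero_apply]
    field_simp
    ring

theorem det_hessian_sumF_zero {N : ℕ} (W : Matrix (Fin N) (Fin N) ℝ) (α : Fin 4 → ℝ) :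
    (hessian (sumF 0 W θ₀ v₀) α).det = 0 := by
  have h : sumF 0 W θ₀ v₀ = fun _ => 0 := by
    ext α
    rw [sumF, Matrix.charpoly_isEmpty]
    simp
  have h2 : hessian (sumF 0 W θ₀ v₀) α = 0 := by
    rw [h]; ext i j; simp [hessian]
  rw [h2, Matrix.det_zero]

/-- Nonsingularity of the Hessian requires at least two observation times. -/
theorem two_le_of_det_hessian_ne_zero {N T : ℕ} {W : Matrix (Fin N) (Fin N) ℝ} (hsymm : W.IsSymm)
    (hv : 0 < v₀) {Θθ : Set Theta} (hΘ : Θθ ∈ 𝓝 θ₀) (hadm : ∀ θ ∈ Θθ, Admissible W θ)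
    (h : (hessian (sumF T W θ₀ v₀) ![θ₀ 0, θ₀ 1, θ₀ 2, v₀]).det ≠ 0) : 2 ≤ T := by
  by_contra hT
  have : T = 0 ∨ T = 1 := by omega
  rcases this with rfl | rfl
  · exact h (det_hessian_sumF_zero W _)
  · exact h (det_hessian_sumF_one hsymm hv hΘ hadm)

end Crit

/-! ### Bookkeeping for integrable functions with known integral -/

section Mean

variable {Ω : Type*} [MeasurableSpace Ω] {P : Measure Ω}

/-- `f` is integrable with integral `x`. -/
def HasMean (P : Measure Ω) (f : Ω → ℝ) (x : ℝ) : Prop :=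
  Integrable f P ∧ ∫ ω, f ω ∂P = x

theorem HasMean.add {f g : Ω → ℝ} {x y : ℝ} (hf : HasMean P f x) (hg : HasMean P g y) :
    HasMean P (fun ω => f ω + g ω) (x + y) :=
  ⟨hf.1.add hg.1, by rw [integral_add hf.1 hg.1, hf.2, hg.2]⟩

theorem HasMean.sub {f g : Ω → ℝ} {x y : ℝ} (hf : HasMean P f x) (hg : HasMean P g y) :
    HasMean P (fun ω => f ω - g ω) (x - y) :=
  ⟨hf.1.sub hg.1, by rw [integral_sub hf.1 hg.1, hf.2, hg.2]⟩

theorem HasMean.const_mul {f : Ω → ℝ} {x : ℝ} (c : ℝ) (hf : HasMean P f x) :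
    HasMean P (fun ω => c * f ω) (c * x) :=
  ⟨hf.1.const_mul c, by rw [integral_const_mul, hf.2]⟩

theorem HasMean.sum {ι : Type*} {s : Finset ι} {f : ι → Ω → ℝ} {x : ι → ℝ}
    (hf : ∀ i ∈ s, HasMean P (f i) (x i)) :
    HasMean P (fun ω => ∑ i ∈ s, f i ω) (∑ i ∈ s, x i) :=
  ⟨integrable_finsetSum s fun i hi => (hf i hi).1, by
    rw [integral_finsetSum s fun i hi => (hf i hi).1]
    exact Finset.sum_congr rfl fun i hi => (hf i hi).2⟩

theorem HasMean.congr {f g : Ω → ℝ} {x y : ℝ} (hf : HasMean P f x) (h : f =ᵐ[P] g) (hxy : x = y) :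
    HasMean P g y :=
  ⟨hf.1.congr h, by rw [← integral_congr_ae h, hf.2, hxy]⟩

theorem HasMean.of_eq {f g : Ω → ℝ} {x y : ℝ} (hf : HasMean P f x) (h : ∀ ω, f ω = g ω)
    (hxy : x = y) : HasMean P g y :=
  hf.congr (Eventually.of_forall h) hxy

theorem hasMean_const [IsProbabilityMeasure P] (c : ℝ) : HasMean P (fun _ => c) c :=
  ⟨integrable_const c, by simp⟩

theorem HasMean.unique {f : Ω → ℝ} {x y : ℝ} (hf : HasMean P f x) (hg : HasMean P f y) : x = y :=
  hf.2.symm.trans hg.2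

theorem HasMean.mul_of_indepFun {f g : Ω → ℝ} {x y : ℝ} (hf : HasMean P f x) (hg : HasMean P g y)
    (h : IndepFun f g P) : HasMean P (fun ω => f ω * g ω) (x * y) :=
  ⟨h.integrable_mul hf.1 hg.1, by
    rw [h.integral_fun_mul_eq_mul_integral hf.1.aestronglyMeasurable hg.1.aestronglyMeasurable,
      hf.2, hg.2]⟩

theorem integrable_mul_of_memLp_two {f g : Ω → ℝ} (hf : MemLp f 2 P) (hg : MemLp g 2 P) :
    Integrable (fun ω => f ω * g ω) P :=
  hf.integrable_mul hg

end Mean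

/-! ### Variance of quadratic forms in independent variables -/

section QuadraticForms

variable {Ω : Type*} [MeasurableSpace Ω] {P : Measure Ω} {ι : Type*} {Z : ι → Ω → ℝ} {v₀ : ℝ}

theorem memLp_mul_of_memLp_four {f g : Ω → ℝ} (hf : MemLp f 4 P) (hg : MemLp g 4 P) :
    MemLp (fun ω => f ω * g ω) 2 P := by
  have : ENNReal.HolderTriple 4 4 2 := ⟨by
    rw [show (4 : ENNReal) = 2 * 2 by norm_num, ENNReal.mul_inv (by simp) (by simp), ← two_mul,
      ← mul_assoc, ENNReal.mul_inv_cancel (by simp) (by simp), one_mul]⟩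
  exact hg.mul' hf

theorem hasMean_mul_of_indep [IsProbabilityMeasure P] [DecidableEq ι] (hind : iIndepFun Z P)
    (hZ : ∀ i, MemLp (Z i) 4 P)
    (hmean : ∀ i, ∫ ω, Z i ω ∂P = 0) (hvar : ∀ i, ∫ ω, Z i ω ^ 2 ∂P = v₀) (i j : ι) :
    HasMean P (fun ω => Z i ω * Z j ω) (if i = j then v₀ else 0) := by
  have h2 : ∀ i, MemLp (Z i) 2 P := fun i => (hZ i).mono_exponent (by norm_num)
  by_cases h : i = j
  · subst h
    rw [if_pos rfl]
    refine ⟨integrable_mul_of_memLp_two (h2 i) (h2 i), ?_⟩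
    rw [← hvar i]; simp_rw [sq]
  · rw [if_neg h]
    have h1 : ∀ i, HasMean P (Z i) 0 := fun i => ⟨(h2 i).integrable (by norm_num), hmean i⟩
    exact ((h1 i).mul_of_indepFun (h1 j) (hind.indepFun h)).of_eq (fun _ => rfl) (by simp)

theorem hasMean_sq_linear [IsProbabilityMeasure P] (hind : iIndepFun Z P)
    (hZ : ∀ i, MemLp (Z i) 4 P)
    (hmean : ∀ i, ∫ ω, Z i ω ∂P = 0) (hvar : ∀ i, ∫ ω, Z i ω ^ 2 ∂P = v₀) (s : Finset ι)
    (c : ι → ℝ) :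
    HasMean P (fun ω => (∑ j ∈ s, c j * Z j ω) ^ 2) (v₀ * ∑ j ∈ s, c j ^ 2) := by
  classical
  have h := HasMean.sum (s := s) fun i _ => HasMean.sum (s := s) fun j _ =>
    (hasMean_mul_of_indep hind hZ hmean hvar i j).const_mul (c i * c j)
  refine h.of_eq (fun ω => ?_) ?_
  · rw [sq, Finset.sum_mul_sum]
    exact Finset.sum_congr rfl fun i _ => Finset.sum_congr rfl fun j _ => by ring
  · rw [Finset.mul_sum]
    refine Finset.sum_congr rfl fun i hi => ?_
    simp [hi]; ring

/-- The centred quadratic form of the variables with indices in `s`. -/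
def centredForm {Ω : Type*} (Z : ι → Ω → ℝ) (v₀ : ℝ) (Q : ι → ι → ℝ) (s : Finset ι) (ω : Ω) : ℝ :=
  ∑ i ∈ s, ∑ j ∈ s, Q i j * (Z i ω * Z j ω) - v₀ * ∑ i ∈ s, Q i i

theorem memLp_centredForm [IsProbabilityMeasure P] (hZ : ∀ i, MemLp (Z i) 4 P) (Q : ι → ι → ℝ)
    (s : Finset ι) :
    MemLp (centredForm Z v₀ Q s) 2 P := by
  refine MemLp.sub ?_ (memLp_const _)
  exact memLp_finsetSum _ fun i _ => memLp_finsetSum _ fun j _ =>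
    (memLp_mul_of_memLp_four (hZ i) (hZ j)).const_mul _

/-- The increment is a linear form in the old variables times the new one, plus a centred square.
Both parts have mean zero given the old variables, which drives the induction on the index set. -/
theorem centredForm_insert {Ω : Type*} {Z : ι → Ω → ℝ} [DecidableEq ι] (Q : ι → ι → ℝ)
    {s : Finset ι} {a : ι} (ha : a ∉ s) (ω : Ω) :
    centredForm Z v₀ Q (insert a s) ω = centredForm Z v₀ Q s ω
      + (∑ j ∈ s, (Q a j + Q j a) * Z j ω) * Z a ω + Q a a * (Z a ω ^ 2 - v₀) := by
  simp only [centredForm, Finset.sum_insert ha, Finset.sum_add_distrib, Finset.sum_mul, add_mul,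
    mul_add, Finset.mul_sum]
  have h1 : ∑ i ∈ s, Q a i * (Z a ω * Z i ω) = ∑ i ∈ s, Q a i * Z i ω * Z a ω :=
    Finset.sum_congr rfl fun i _ => by ring
  have h2 : ∑ i ∈ s, Q i a * (Z i ω * Z a ω) = ∑ i ∈ s, Q i a * Z i ω * Z a ω :=
    Finset.sum_congr rfl fun i _ => by ring
  rw [h1, h2]
  ring

/-- The second moment of a centred quadratic form in independent variables is controlled by the
Frobenius norm. -/
theorem integral_centredForm_sq_le [IsProbabilityMeasure P] (hind : iIndepFun Z P)
    (hZ : ∀ i, MemLp (Z i) 4 P)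
    (hmean : ∀ i, ∫ ω, Z i ω ∂P = 0) (hvar : ∀ i, ∫ ω, Z i ω ^ 2 ∂P = v₀) {κ : ℝ}
    (hκ : ∀ i, ∫ ω, (Z i ω ^ 2 - v₀) ^ 2 ∂P ≤ κ) (Q : ι → ι → ℝ) (s : Finset ι) :
    ∫ ω, centredForm Z v₀ Q s ω ^ 2 ∂P ≤ (κ + 2 * v₀ ^ 2) * ∑ i ∈ s, ∑ j ∈ s, Q i j ^ 2 := by
  classical
  have h2 : ∀ i, MemLp (Z i) 2 P := fun i => (hZ i).mono_exponent (by norm_num)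
  have hZ1 : ∀ i, HasMean P (Z i) 0 := fun i => ⟨(h2 i).integrable (by norm_num), hmean i⟩
  have hsq2 : ∀ i, MemLp (fun ω => Z i ω ^ 2 - v₀) 2 P := by
    intro i
    refine MemLp.sub ?_ (memLp_const _)
    have := memLp_mul_of_memLp_four (hZ i) (hZ i)
    simpa only [sq] using this
  have hZ2 : ∀ i, HasMean P (fun ω => Z i ω ^ 2) v₀ := fun i => ⟨(h2 i).integrable_sq, hvar i⟩
  have hZ2c : ∀ i, HasMean P (fun ω => Z i ω ^ 2 - v₀) 0 := fun i =>
    ((hZ2 i).sub (hasMean_const v₀)).of_eq (fun _ => rfl) (sub_self _)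
  have hG1 : ∀ s, HasMean P (centredForm Z v₀ Q s) 0 := by
    intro s
    have h := (HasMean.sum (s := s) fun i _ => HasMean.sum (s := s) fun j _ =>
      (hasMean_mul_of_indep hind hZ hmean hvar i j).const_mul (Q i j)).sub
        (hasMean_const (P := P) (v₀ * ∑ i ∈ s, Q i i))
    refine h.of_eq (fun ω => rfl) ?_
    rw [sub_eq_zero, Finset.mul_sum]
    refine Finset.sum_congr rfl fun i hi => ?_
    simp [hi]; ring
  induction s using Finset.induction_on with
  | empty => simp [centredForm]
  | insert a s ha ih =>
    set G := centredForm Z v₀ Q s with hG_def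
    set L : Ω → ℝ := fun ω => ∑ j ∈ s, (Q a j + Q j a) * Z j ω with hL_def
    set q := Q a a with hq
    -- After squaring the increment formula every cross term factors by this independence, with one
    -- factor of mean zero. Third moments of the new variable occur only next to the centred linear
    -- form `L`, so no symmetry of the law is needed.
    have hI : IndepFun (fun ω (j : s) => Z j ω) (Z a) P := by
      have h1 := hind.indepFun_finset₀ s {a} (by simpa using ha) fun i => (hZ i).1.aemeasurable
      exact h1.comp measurable_id (measurable_pi_apply (⟨a, by simp⟩ : ({a} : Finset ι)))
    let gφ : (s → ℝ) → ℝ := fun y =>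
      ∑ i : s, ∑ j : s, Q (i : ι) (j : ι) * (y i * y j) - v₀ * ∑ i ∈ s, Q i i
    let lφ : (s → ℝ) → ℝ := fun y => ∑ j : s, (Q a j + Q (j : ι) a) * y j
    have hgφ : Measurable gφ := by fun_prop
    have hlφ : Measurable lφ := by fun_prop
    have hGe : G = fun ω => gφ (fun j : s => Z j ω) := by
      ext ω
      simp only [hG_def, centredForm, gφ]
      congr 1
      rw [← Finset.sum_coe_sort s]
      refine Finset.sum_congr rfl fun i _ => ?_
      rw [← Finset.sum_coe_sort s]
    have hLe : L = fun ω => lφ (fun j : s => Z j ω) := by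
      ext ω
      simp only [hL_def, lφ]
      rw [← Finset.sum_coe_sort s]
    have hL2 : MemLp L 2 P := memLp_finsetSum _ fun j _ => (h2 j).const_mul _
    have hL1 : HasMean P L 0 :=
      (HasMean.sum (s := s) fun j _ => (hZ1 j).const_mul (Q a j + Q j a)).of_eq (fun _ => rfl)
        (by simp)
    have hG2 : MemLp G 2 P := memLp_centredForm hZ Q s
    have hind' : ∀ {φ : (s → ℝ) → ℝ} {ψ : ℝ → ℝ}, Measurable φ → Measurable ψ →
        IndepFun (fun ω => φ (fun j : s => Z j ω)) (fun ω => ψ (Z a ω)) P :=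
      fun hφ hψ => hI.comp hφ hψ
    have t1 : HasMean P (fun ω => G ω ^ 2) (∫ ω, G ω ^ 2 ∂P) := ⟨hG2.integrable_sq, rfl⟩
    have t2 : HasMean P (fun ω => L ω ^ 2 * Z a ω ^ 2)
        (v₀ * ∑ j ∈ s, (Q a j + Q j a) ^ 2 * v₀) := by
      refine HasMean.of_eq ((hasMean_sq_linear hind hZ hmean hvar s
        fun j => Q a j + Q j a).mul_of_indepFun (hZ2 a) ?_) (fun _ => rfl) ?_
      · have := hind' (φ := fun y => lφ y ^ 2) (ψ := fun z => z ^ 2) (by fun_prop) (by fun_prop)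
        convert this using 3 with ω
        exact congrFun hLe ω
      · rw [mul_assoc, Finset.sum_mul]
    have t3 : HasMean P (fun ω => q ^ 2 * (Z a ω ^ 2 - v₀) ^ 2)
        (q ^ 2 * ∫ ω, (Z a ω ^ 2 - v₀) ^ 2 ∂P) :=
      HasMean.const_mul _ ⟨(hsq2 a).integrable_sq, rfl⟩
    have t4 : HasMean P (fun ω => 2 * (G ω * L ω * Z a ω)) 0 := by
      refine ((HasMean.mul_of_indepFun (f := fun ω => G ω * L ω)
        ⟨integrable_mul_of_memLp_two hG2 hL2, rfl⟩ (hZ1 a) ?_).const_mul 2).of_eq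
        (fun _ => rfl) (by simp)
      have := hind' (φ := fun y => gφ y * lφ y) (ψ := fun z => z) (by fun_prop) (by fun_prop)
      rw [hGe, hLe]; exact this
    have t5 : HasMean P (fun ω => 2 * q * (G ω * (Z a ω ^ 2 - v₀))) 0 := by
      refine (((hG1 s).mul_of_indepFun (hZ2c a) ?_).const_mul (2 * q)).of_eq
        (fun _ => rfl) (by simp)
      have := hind' (φ := gφ) (ψ := fun z => z ^ 2 - v₀) (by fun_prop) (by fun_prop)
      rw [← hG_def, hGe]; exact this
    have t6 : HasMean P (fun ω => 2 * q * (L ω * (Z a ω * (Z a ω ^ 2 - v₀)))) 0 := by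
      refine ((hL1.mul_of_indepFun (g := fun ω => Z a ω * (Z a ω ^ 2 - v₀))
        ⟨integrable_mul_of_memLp_two (h2 a) (hsq2 a), rfl⟩ ?_).const_mul (2 * q)).of_eq
        (fun _ => rfl) (by simp)
      have := hind' (φ := lφ) (ψ := fun z => z * (z ^ 2 - v₀)) (by fun_prop) (by fun_prop)
      rw [hLe]; exact this
    have htot := ((((t1.add t2).add t3).add t4).add t5).add t6
    have hfin : HasMean P (fun ω => centredForm Z v₀ Q (insert a s) ω ^ 2)
        ((∫ ω, G ω ^ 2 ∂P) + v₀ * ∑ j ∈ s, (Q a j + Q j a) ^ 2 * v₀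
          + q ^ 2 * ∫ ω, (Z a ω ^ 2 - v₀) ^ 2 ∂P) := by
      refine htot.of_eq (fun ω => ?_) (by ring)
      rw [centredForm_insert Q ha]
      change _ = (G ω + L ω * Z a ω + q * (Z a ω ^ 2 - v₀)) ^ 2
      ring
    rw [hfin.2]
    have hκ0 : 0 ≤ κ := (integral_nonneg fun ω => sq_nonneg _).trans (hκ a)
    have b2 : v₀ * ∑ j ∈ s, (Q a j + Q j a) ^ 2 * v₀
        ≤ (κ + 2 * v₀ ^ 2) * (∑ j ∈ s, Q a j ^ 2 + ∑ j ∈ s, Q j a ^ 2) := by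
      rw [← Finset.sum_add_distrib, Finset.mul_sum, Finset.mul_sum]
      refine Finset.sum_le_sum fun j _ => ?_
      have h1 : (Q a j + Q j a) ^ 2 ≤ 2 * (Q a j ^ 2 + Q j a ^ 2) := by
        nlinarith [sq_nonneg (Q a j - Q j a)]
      have h3 : 0 ≤ Q a j ^ 2 + Q j a ^ 2 := by positivity
      nlinarith [mul_le_mul_of_nonneg_left h1 (sq_nonneg v₀), mul_nonneg hκ0 h3]
    have b3 : q ^ 2 * ∫ ω, (Z a ω ^ 2 - v₀) ^ 2 ∂P ≤ (κ + 2 * v₀ ^ 2) * q ^ 2 := by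
      have := hκ a
      nlinarith [mul_le_mul_of_nonneg_left this (sq_nonneg q), sq_nonneg (v₀ * q)]
    have hsum : ∑ i ∈ insert a s, ∑ j ∈ insert a s, Q i j ^ 2
        = q ^ 2 + (∑ j ∈ s, Q a j ^ 2 + ∑ j ∈ s, Q j a ^ 2) + ∑ i ∈ s, ∑ j ∈ s, Q i j ^ 2 := by
      simp only [Finset.sum_insert ha, Finset.sum_add_distrib]
      ring
    rw [hsum]
    linarith

end QuadraticForms

/-! ### Moments of the innovations -/

section Innovations

variable {Ω : Type*} [MeasurableSpace Ω] {P : Measure Ω}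
  {v : ℕ → ℤ → Ω → ℝ} {v₀ : ℝ}

theorem IIDInnovations.memLp_four [IsProbabilityMeasure P] (hv : IIDInnovations P v v₀) (j : ℕ)
    (t : ℤ) :
    MemLp (v j t) 4 P := by
  obtain ⟨-, hid, ⟨η, hη, hint⟩, -, -⟩ := hv
  have hm : AEStronglyMeasurable (v j t) P := (hid j t).aemeasurable_fst.aestronglyMeasurable
  have h4 : (0 : ℝ) < 4 + η := by linarith
  have h1 : MemLp (v j t) (ENNReal.ofReal (4 + η)) P := by
    rw [← integrable_norm_rpow_iff hm (by simpa using h4) (by simp), ENNReal.toReal_ofReal h4.le]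
    exact hint j t
  refine h1.mono_exponent ?_
  rw [show (4 : ENNReal) = ENNReal.ofReal 4 by simp]
  exact ENNReal.ofReal_le_ofReal (by linarith)

theorem IIDInnovations.exists_fourth_moment_bound (hv : IIDInnovations P v v₀) :
    ∃ κ, ∀ j t, ∫ ω, (v j t ω ^ 2 - v₀) ^ 2 ∂P ≤ κ := by
  refine ⟨∫ ω, (v 0 0 ω ^ 2 - v₀) ^ 2 ∂P, fun j t => le_of_eq ?_⟩
  have h : IdentDistrib (fun ω => (v j t ω ^ 2 - v₀) ^ 2) (fun ω => (v 0 0 ω ^ 2 - v₀) ^ 2) P P :=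
    (hv.2.1 j t).comp (u := fun x : ℝ => (x ^ 2 - v₀) ^ 2) (by fun_prop)
  exact h.integral_eq

theorem IIDInnovations.hasMean_mul [IsProbabilityMeasure P] (hv : IIDInnovations P v v₀)
    (p q : ℕ × ℤ) :
    HasMean P (fun ω => v p.1 p.2 ω * v q.1 q.2 ω) (if p = q then v₀ else 0) :=
  hasMean_mul_of_indep (Z := fun p : ℕ × ℤ => v p.1 p.2) hv.1 (fun p => hv.memLp_four p.1 p.2)
    (fun p => hv.2.2.2.1 p.1 p.2) (fun p => hv.2.2.2.2 p.1 p.2) p q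

end Innovations

/-! ### Second moments of the error process in spectral coordinates -/

section Eigenprocess

variable {Ω : Type*} {N : ℕ}

/-- The coordinates of the error process in the basis of columns of `O`. -/
def eigProc (O : Matrix (Fin N) (Fin N) ℝ) (U : ℤ → Ω → Fin N → ℝ) (l : Fin N) (t : ℤ) (ω : Ω) :
    ℝ :=
  ∑ i, O i l * U t ω i

/-- The coordinates of the innovations in the basis of columns of `O`. -/
def eigNoise (O : Matrix (Fin N) (Fin N) ℝ) (v : ℕ → ℤ → Ω → ℝ) (l : Fin N) (t : ℤ) (ω : Ω) : ℝ :=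
  ∑ i, O i l * v i t ω

theorem sum_col_mul_mulVec {O : Matrix (Fin N) (Fin N) ℝ} {w : Fin N → ℝ}
    {W : Matrix (Fin N) (Fin N) ℝ} (hD : Diagonalizes O w W) (x : Fin N → ℝ) (l : Fin N) :
    ∑ i, O i l * (W *ᵥ x) i = w l * ∑ i, O i l * x i := by
  have h : Oᵀ *ᵥ (W *ᵥ x) = Matrix.diagonal w *ᵥ (Oᵀ *ᵥ x) := by
    rw [hD.eq, specMat, Matrix.mulVec_mulVec, Matrix.mulVec_mulVec, ← Matrix.mul_assoc,
      ← Matrix.mul_assoc, hD.left, Matrix.one_mul]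
  have := congrFun h l
  rw [Matrix.mulVec_diagonal] at this
  simpa [Matrix.mulVec, dotProduct] using this

variable [MeasurableSpace Ω] {P : Measure Ω} {v : ℕ → ℤ → Ω → ℝ} {v₀ : ℝ}
  {O : Matrix (Fin N) (Fin N) ℝ} {w : Fin N → ℝ} {W : Matrix (Fin N) (Fin N) ℝ} {θ₀ : Theta}
  {U : ℤ → Ω → Fin N → ℝ}

/-- An orthogonal rotation preserves the white-noise covariance. Independence across coordinates is
generally lost, so only second moments are used here; the concentration argument returns to the
original innovations. -/
theorem hasMean_eigNoise_mul [IsProbabilityMeasure P] (hO : Oᵀ * O = 1)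
    (hv : IIDInnovations P v v₀) (l l' : Fin N)
    (t t' : ℤ) :
    HasMean P (fun ω => eigNoise O v l t ω * eigNoise O v l' t' ω)
      (if l = l' ∧ t = t' then v₀ else 0) := by
  have h := HasMean.sum (s := Finset.univ) fun (i : Fin N) _ =>
    HasMean.sum (s := Finset.univ) fun (j : Fin N) _ =>
      (hv.hasMean_mul ((i : ℕ), t) ((j : ℕ), t')).const_mul (O i l * O j l')
  refine h.of_eq (fun ω => ?_) ?_
  · rw [eigNoise, eigNoise, Finset.sum_mul_sum]
    exact Finset.sum_congr rfl fun i _ => Finset.sum_congr rfl fun j _ => by ring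
  · by_cases ht : t = t'
    · subst ht
      simp only [Prod.mk.injEq, Fin.val_inj, and_true, mul_ite, mul_zero, Finset.sum_ite_eq,
        Finset.mem_univ, if_true]
      rw [← Finset.sum_mul, sum_col_mul_col hO]
      simp
    · simp [ht]

theorem memLp_eigNoise [IsProbabilityMeasure P] (hv : IIDInnovations P v v₀) (l : Fin N) (t : ℤ) :
    MemLp (eigNoise O v l t) 2 P :=
  memLp_finsetSum _ fun i _ => ((hv.memLp_four i t).mono_exponent (by norm_num)).const_mul _

theorem hasMean_eigNoise [IsProbabilityMeasure P] (hv : IIDInnovations P v v₀) (l : Fin N) (t : ℤ) :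
    HasMean P (eigNoise O v l t) 0 := by
  have h := HasMean.sum (s := Finset.univ) fun (i : Fin N) _ =>
    HasMean.const_mul (O i l) (P := P) (f := v i t) (x := 0)
      ⟨(hv.memLp_four i t).integrable (by norm_num), hv.2.2.2.1 i t⟩
  exact h.of_eq (fun _ => rfl) (by simp)

theorem memLp_eigProc (hU : IsErrorProcess P W θ₀ v U) (l : Fin N) (t : ℤ) :
    MemLp (eigProc O U l t) 2 P :=
  memLp_finsetSum _ fun i _ => (hU.1.1 t i).const_mul _

theorem integrable_eigProc_mul (hU : IsErrorProcess P W θ₀ v U) (l l' : Fin N) (t t' : ℤ) :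
    Integrable (fun ω => eigProc O U l t ω * eigProc O U l' t' ω) P :=
  integrable_mul_of_memLp_two (memLp_eigProc hU l t) (memLp_eigProc hU l' t')

/-- Projecting the model equation onto an eigenvector replaces `W` by its eigenvalue and decouples
the system into scalar AR(1) equations. -/
theorem eigProc_recursion (hD : Diagonalizes O w W) (hU : IsErrorProcess P W θ₀ v U) (l : Fin N)
    (t : ℤ) : ∀ᵐ ω ∂P, sv θ₀ (w l) * eigProc O U l t ω
      = rv θ₀ (w l) * eigProc O U l (t - 1) ω + eigNoise O v l t ω := by
  filter_upwards [hU.2 t] with ω hω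
  have h1 : eigProc O U l t ω = ∑ i, O i l * (θ₀ 0 • (W *ᵥ U t ω) + θ₀ 2 • (W *ᵥ U (t - 1) ω)
      + θ₀ 1 • U (t - 1) ω + fun i : Fin N => v i t ω) i := by
    rw [← hω]; rfl
  have h2 : ∀ i, O i l * (θ₀ 0 • (W *ᵥ U t ω) + θ₀ 2 • (W *ᵥ U (t - 1) ω)
      + θ₀ 1 • U (t - 1) ω + fun i : Fin N => v i t ω) i
      = θ₀ 0 * (O i l * (W *ᵥ U t ω) i) + θ₀ 2 * (O i l * (W *ᵥ U (t - 1) ω) i)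
        + θ₀ 1 * (O i l * U (t - 1) ω i) + O i l * v i t ω := by
    intro i; simp only [Pi.add_apply, Pi.smul_apply, smul_eq_mul]; ring
  simp_rw [h2, Finset.sum_add_distrib, ← Finset.mul_sum, sum_col_mul_mulVec hD] at h1
  simp only [eigProc, eigNoise, sv, rv] at h1 ⊢
  linear_combination h1

theorem integral_eigProc_mul_shift (hU : IsErrorProcess P W θ₀ v U) (l l' : Fin N) (t : ℤ) :
    ∫ ω, eigProc O U l t ω * eigProc O U l' t ω ∂P
      = ∫ ω, eigProc O U l 0 ω * eigProc O U l' 0 ω ∂P := by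
  have h : ∀ t, ∫ ω, eigProc O U l t ω * eigProc O U l' t ω ∂P
      = ∑ i, ∑ j, O i l * O j l' * ∫ ω, U t ω i * U t ω j ∂P := by
    intro t
    have := HasMean.sum (s := Finset.univ) fun (i : Fin N) _ =>
      HasMean.sum (s := Finset.univ) fun (j : Fin N) _ =>
        HasMean.const_mul (O i l * O j l') (P := P) (f := fun ω => U t ω i * U t ω j)
          ⟨integrable_mul_of_memLp_two (hU.1.1 t i) (hU.1.1 t j), rfl⟩
    refine (this.of_eq (fun ω => ?_) rfl).2
    rw [eigProc, eigProc, Finset.sum_mul_sum]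
    exact Finset.sum_congr rfl fun i _ => Finset.sum_congr rfl fun j _ => by ring
  rw [h, h]
  refine Finset.sum_congr rfl fun i _ => Finset.sum_congr rfl fun j _ => ?_
  have := hU.1.2.2 t 0 i j
  rw [add_zero] at this
  rw [this]

/-- By stationarity the mean m satisfies s m = r m, and |r| < |s| leaves only m = 0. -/
theorem hasMean_eigProc [IsProbabilityMeasure P] (hD : Diagonalizes O w W)
    (hU : IsErrorProcess P W θ₀ v U)
    (hv : IIDInnovations P v v₀) (hs : ∀ l, sv θ₀ (w l) ≠ 0)
    (ha : ∀ l, |rv θ₀ (w l) / sv θ₀ (w l)| < 1) (l : Fin N) (t : ℤ) :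
    HasMean P (eigProc O U l t) 0 := by
  have hint : ∀ t, Integrable (eigProc O U l t) P := fun t =>
    (memLp_eigProc hU l t).integrable (by norm_num)
  have h : ∀ t, ∫ ω, eigProc O U l t ω ∂P = ∑ i, O i l * ∫ ω, U 0 ω i ∂P := by
    intro t
    have := HasMean.sum (s := Finset.univ) fun (i : Fin N) _ =>
      HasMean.const_mul (O i l) (P := P) (f := fun ω => U t ω i)
        ⟨(hU.1.1 t i).integrable (by norm_num), hU.1.2.1 t i⟩
    exact this.2
  set m := ∑ i, O i l * ∫ ω, U 0 ω i ∂P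
  have h1 : HasMean P (fun ω => sv θ₀ (w l) * eigProc O U l t ω) (sv θ₀ (w l) * m) :=
    HasMean.const_mul _ ⟨hint t, h t⟩
  have h2 : HasMean P (fun ω => sv θ₀ (w l) * eigProc O U l t ω) (rv θ₀ (w l) * m + 0) :=
    (((HasMean.const_mul (rv θ₀ (w l)) ⟨hint (t - 1), h (t - 1)⟩).add
      (hasMean_eigNoise hv l t)).congr
      ((eigProc_recursion hD hU l t).mono fun ω hω => hω.symm) rfl)
  have h3 := h1.unique h2
  have hm : m = 0 := by
    have h4 : (sv θ₀ (w l) - rv θ₀ (w l)) * m = 0 := by linear_combination h3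
    rcases mul_eq_zero.mp h4 with h5 | h5
    · exfalso
      have h6 := sq_sub_sq_pos (hs l) (ha l)
      rw [sub_eq_zero.mp h5, sub_self] at h6
      exact lt_irrefl _ h6
    · exact h5
  exact ⟨hint t, (h t).trans hm⟩

theorem integral_abs_mul_le {f g : Ω → ℝ} (hf : MemLp f 2 P) (hg : MemLp g 2 P) :
    ∫ ω, |f ω * g ω| ∂P ≤ ((∫ ω, f ω ^ 2 ∂P) + ∫ ω, g ω ^ 2 ∂P) / 2 := by
  rw [← integral_add hf.integrable_sq hg.integrable_sq, ← integral_div]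
  refine integral_mono (integrable_mul_of_memLp_two hf hg).abs
    ((hf.integrable_sq.add hg.integrable_sq).div_const 2) fun ω => ?_
  change |f ω * g ω| ≤ (f ω ^ 2 + g ω ^ 2) / 2
  rw [abs_mul]
  nlinarith [sq_nonneg (|f ω| - |g ω|), sq_abs (f ω), sq_abs (g ω)]

/-- The error process is uncorrelated with future innovations. -/
theorem hasMean_eigProc_mul_eigNoise [IsProbabilityMeasure P] (hD : Diagonalizes O w W)
    (hU : IsErrorProcess P W θ₀ v U)
    (hv : IIDInnovations P v v₀) (hs : ∀ l, sv θ₀ (w l) ≠ 0)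
    (ha : ∀ l, |rv θ₀ (w l) / sv θ₀ (w l)| < 1) (l l' : Fin N) (t : ℤ) :
    HasMean P (fun ω => eigProc O U l (t - 1) ω * eigNoise O v l' t ω) 0 := by
  have hint : ∀ t', Integrable (fun ω => eigProc O U l t' ω * eigNoise O v l' t ω) P := fun t' =>
    integrable_mul_of_memLp_two (memLp_eigProc hU l t') (memLp_eigNoise hv l' t)
  set D : ℕ → ℝ := fun j => ∫ ω, eigProc O U l (t - 1 - j) ω * eigNoise O v l' t ω ∂P with hD_def
  set a := rv θ₀ (w l) / sv θ₀ (w l) with ha_def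
  -- One step back in time multiplies the covariance with the fixed innovation by a, since
  -- innovations at different times are uncorrelated. Iterating, D 0 = a^j D j with D bounded by
  -- stationarity and |a| < 1, so D 0 = 0. No causal representation has to be assumed.
  have hrec : ∀ j, D j = a * D (j + 1) := by
    intro j
    have h1 : HasMean P (fun ω => sv θ₀ (w l) *
        (eigProc O U l (t - 1 - j) ω * eigNoise O v l' t ω)) (sv θ₀ (w l) * D j) :=
      HasMean.const_mul _ ⟨hint _, rfl⟩
    have h2 : HasMean P (fun ω => rv θ₀ (w l) *
        (eigProc O U l (t - 1 - (j + 1 : ℕ)) ω * eigNoise O v l' t ω)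
        + eigNoise O v l (t - 1 - j) ω * eigNoise O v l' t ω) (rv θ₀ (w l) * D (j + 1) + 0) := by
      refine HasMean.add (HasMean.const_mul _ ⟨hint _, rfl⟩) ?_
      refine (hasMean_eigNoise_mul hD.left hv l l' (t - 1 - j) t).of_eq (fun _ => rfl) ?_
      rw [if_neg]
      rintro ⟨-, h⟩
      omega
    have h3 := h1.unique (h2.congr ?_ rfl)
    · have := hs l
      rw [ha_def]; field_simp; linear_combination h3
    · filter_upwards [eigProc_recursion hD hU l (t - 1 - j)] with ω hω
      rw [show t - 1 - ((j + 1 : ℕ) : ℤ) = t - 1 - j - 1 by push_cast; ring]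
      linear_combination -(eigNoise O v l' t ω) * hω
  set Bd := ((∫ ω, eigProc O U l 0 ω * eigProc O U l 0 ω ∂P)
    + ∫ ω, eigNoise O v l' t ω ^ 2 ∂P) / 2 with hBd
  have hbd : ∀ j, |D j| ≤ Bd := by
    intro j
    refine (abs_integral_le_integral_abs).trans ?_
    refine (integral_abs_mul_le (memLp_eigProc hU l _) (memLp_eigNoise hv l' t)).trans ?_
    rw [hBd, ← integral_eigProc_mul_shift hU l l (t - 1 - j)]
    simp_rw [sq]
    exact le_rfl
  have hpow : ∀ j, |D 0| ≤ |a| ^ j * Bd := by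
    have : ∀ j, D 0 = a ^ j * D j := by
      intro j
      induction j with
      | zero => simp
      | succ j ih => rw [ih, hrec j]; ring
    intro j
    rw [this j, abs_mul, abs_pow]
    exact mul_le_mul_of_nonneg_left (hbd j) (by positivity)
  have hlim : Tendsto (fun j : ℕ => |a| ^ j * Bd) atTop (𝓝 (0 * Bd)) :=
    (tendsto_pow_atTop_nhds_zero_of_lt_one (abs_nonneg a) (ha l)).mul_const Bd
  have h0 : |D 0| ≤ 0 := by
    have := ge_of_tendsto' hlim hpow
    rwa [zero_mul] at this
  have h1 : D 0 = 0 := abs_eq_zero.mp (le_antisymm h0 (abs_nonneg _))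
  refine ⟨hint _, ?_⟩
  simpa [hD_def] using h1

/-- The stationary variance on an eigenspace of `W`, for unit innovation variance. -/
def statVar (θ₀ : Theta) (w : ℝ) : ℝ := (sv θ₀ w ^ 2 - rv θ₀ w ^ 2)⁻¹

/-- Multiplying the recursions of two coordinates and using stationarity gives (s s' - r r') x = v₀
or 0 for their covariance x, and |r r'| < |s s'| makes the factor nonzero. -/
theorem hasMean_eigProc_mul [IsProbabilityMeasure P] (hD : Diagonalizes O w W)
    (hU : IsErrorProcess P W θ₀ v U)
    (hv : IIDInnovations P v v₀) (hs : ∀ l, sv θ₀ (w l) ≠ 0)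
    (ha : ∀ l, |rv θ₀ (w l) / sv θ₀ (w l)| < 1) (l l' : Fin N) (t : ℤ) :
    HasMean P (fun ω => eigProc O U l t ω * eigProc O U l' t ω)
      (if l = l' then v₀ * statVar θ₀ (w l) else 0) := by
  set x := ∫ ω, eigProc O U l 0 ω * eigProc O U l' 0 ω ∂P with hx
  have hm : ∀ t, HasMean P (fun ω => eigProc O U l t ω * eigProc O U l' t ω) x := fun t =>
    ⟨integrable_eigProc_mul hU l l' t t, integral_eigProc_mul_shift hU l l' t⟩
  have h1 := (hm t).const_mul (sv θ₀ (w l) * sv θ₀ (w l'))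
  have h2 := ((((hm (t - 1)).const_mul (rv θ₀ (w l) * rv θ₀ (w l'))).add
    ((hasMean_eigProc_mul_eigNoise hD hU hv hs ha l l' t).const_mul (rv θ₀ (w l)))).add
    ((hasMean_eigProc_mul_eigNoise hD hU hv hs ha l' l t).const_mul (rv θ₀ (w l')))).add
    (hasMean_eigNoise_mul hD.left hv l l' t t)
  have h3 := h1.unique (h2.congr (by
    filter_upwards [eigProc_recursion hD hU l t, eigProc_recursion hD hU l' t] with ω e1 e2
    linear_combination -(sv θ₀ (w l') * eigProc O U l' t ω) * e1
      - (rv θ₀ (w l) * eigProc O U l (t - 1) ω + eigNoise O v l t ω) * e2) rfl)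
  refine (hm t).of_eq (fun _ => rfl) ?_
  by_cases hl : l = l'
  · subst hl
    have hg := (sq_sub_sq_pos (hs l) (ha l)).ne'
    simp only [and_self, if_true] at h3 ⊢
    rw [statVar, ← div_eq_mul_inv, eq_div_iff hg]
    linear_combination h3
  · simp only [hl, false_and, if_false] at h3 ⊢
    have h4 : (sv θ₀ (w l) * sv θ₀ (w l') - rv θ₀ (w l) * rv θ₀ (w l')) * x = 0 := by
      linear_combination h3
    rcases mul_eq_zero.mp h4 with h5 | h5
    · exfalso
      have a1 := ha l
      have a2 := ha l'
      rw [abs_div, div_lt_one (abs_pos.mpr (hs l))] at a1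
      rw [abs_div, div_lt_one (abs_pos.mpr (hs l'))] at a2
      have h6 : |rv θ₀ (w l) * rv θ₀ (w l')| < |sv θ₀ (w l) * sv θ₀ (w l')| := by
        rw [abs_mul, abs_mul]
        exact mul_lt_mul'' a1 a2 (abs_nonneg _) (abs_nonneg _)
      rw [sub_eq_zero.mp h5] at h6
      exact lt_irrefl _ h6
    · exact h5

theorem hasMean_eigProc_mul_lag [IsProbabilityMeasure P] (hD : Diagonalizes O w W)
    (hU : IsErrorProcess P W θ₀ v U)
    (hv : IIDInnovations P v v₀) (hs : ∀ l, sv θ₀ (w l) ≠ 0)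
    (ha : ∀ l, |rv θ₀ (w l) / sv θ₀ (w l)| < 1) (l : Fin N) (t : ℤ) :
    HasMean P (fun ω => eigProc O U l t ω * eigProc O U l (t - 1) ω)
      (v₀ * statVar θ₀ (w l) * (rv θ₀ (w l) / sv θ₀ (w l))) := by
  have h1 := hasMean_eigProc_mul hD hU hv hs ha l l (t - 1)
  rw [if_pos rfl] at h1
  have h2 := ((h1.const_mul (rv θ₀ (w l))).add
    (hasMean_eigProc_mul_eigNoise hD hU hv hs ha l l t)).const_mul (sv θ₀ (w l))⁻¹
  have hsl := hs l
  refine h2.congr ?_ (by field_simp; ring)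
  filter_upwards [eigProc_recursion hD hU l t] with ω hω
  field_simp
  linear_combination -(eigProc O U l (t - 1) ω) * hω

/-- The expected quadratic form on an eigenspace. -/
theorem hasMean_precMat_form [IsProbabilityMeasure P] (hD : Diagonalizes O w W)
    (hU : IsErrorProcess P W θ₀ v U)
    (hv : IIDInnovations P v v₀) (hs₀ : ∀ l, sv θ₀ (w l) ≠ 0)
    (ha₀ : ∀ l, |rv θ₀ (w l) / sv θ₀ (w l)| < 1) {n : ℕ} {θ : Theta} (l : Fin N)
    (hs : sv θ (w l) ≠ 0) :
    HasMean P (fun ω => (fun t : Fin (n + 1) => eigProc O U l ((t : ℕ) + 1) ω) ⬝ᵥ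
      (precMat (n + 1) θ (w l) *ᵥ fun t : Fin (n + 1) => eigProc O U l ((t : ℕ) + 1) ω))
      (v₀ * expForm n θ₀ θ (w l)) := by
  have hsq : ∀ t, HasMean P (fun ω => eigProc O U l t ω * eigProc O U l t ω)
      (v₀ * statVar θ₀ (w l)) := fun t => by
    simpa using hasMean_eigProc_mul hD hU hv hs₀ ha₀ l l t
  have hlag := hasMean_eigProc_mul_lag hD hU hv hs₀ ha₀ l
  set s := sv θ (w l)
  set r := rv θ (w l)
  have h := ((hsq 1).const_mul (s ^ 2 - r ^ 2)).add (HasMean.sum (s := Finset.univ)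
    fun (u : Fin n) _ => (((hsq ((u : ℕ) + 1 + 1)).const_mul (s ^ 2)).add
      ((hsq ((u : ℕ) + 1)).const_mul (r ^ 2))).sub
        ((hlag ((u : ℕ) + 1 + 1)).const_mul (2 * (r * s))))
  refine h.of_eq (fun ω => ?_) ?_
  · rw [precMat_bilin hs]
    simp only [Fin.val_zero, Nat.cast_zero, zero_add, Fin.val_succ, Fin.val_castSucc,
      Nat.cast_add, Nat.cast_one, add_sub_cancel_right]
    congr 1
    refine Finset.sum_congr rfl fun u _ => ?_
    ring
  · simp only [Finset.sum_const, Finset.card_univ, Fintype.card_fin, nsmul_eq_mul]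
    rw [expForm, statVar]
    ring

end Eigenprocess

/-! ### Mean absolute deviations of linear and quadratic averages -/

section LLN

/-- At the price of a factor two the mean may be replaced by any convenient centre, here that of the
truncated quadratic form. -/
theorem integral_abs_sub_integral_le {Ω : Type*} [MeasurableSpace Ω] {P : Measure Ω}
    [IsProbabilityMeasure P] {F : Ω → ℝ} (hF : Integrable F P) (b : ℝ) :
    ∫ ω, |F ω - ∫ ω', F ω' ∂P| ∂P ≤ 2 * ∫ ω, |F ω - b| ∂P := by
  set m := ∫ ω', F ω' ∂P with hm
  have hb : Integrable (fun ω => F ω - b) P := hF.sub (integrable_const b)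
  have h1 : |m - b| ≤ ∫ ω, |F ω - b| ∂P := by
    have : m - b = ∫ ω, (F ω - b) ∂P := by
      rw [integral_sub hF (integrable_const b)]; simp [hm]
    rw [this]; exact abs_integral_le_integral_abs
  have h2 : ∫ ω, |F ω - m| ∂P ≤ ∫ ω, (|F ω - b| + |m - b|) ∂P := by
    refine integral_mono (hF.sub (integrable_const m)).abs (hb.abs.add (integrable_const _)) ?_
    intro ω
    have : F ω - m = (F ω - b) - (m - b) := by ring
    change |F ω - m| ≤ |F ω - b| + |m - b|
    rw [this]; exact abs_sub _ _
  rw [integral_add hb.abs (integrable_const _)] at h2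
  simp only [integral_const, probReal_univ, one_smul] at h2
  linarith

variable {Ω : Type*} [MeasurableSpace Ω] {P : Measure Ω} {N : ℕ} {v : ℕ → ℤ → Ω → ℝ} {v₀ : ℝ}
  {O : Matrix (Fin N) (Fin N) ℝ} {w : Fin N → ℝ} {W : Matrix (Fin N) (Fin N) ℝ} {θ₀ : Theta}
  {U : ℤ → Ω → Fin N → ℝ}

/-- The moving average coefficients over a window of `n` innovations. -/
def maCoef (θ₀ : Theta) (w : ℝ) (n j : ℕ) : ℝ :=
  if j < n then (rv θ₀ w / sv θ₀ w) ^ (n - 1 - j) / sv θ₀ w else 0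

theorem maCoef_succ (θ₀ : Theta) (w : ℝ) (n j : ℕ) :
    maCoef θ₀ w (n + 1) j
      = rv θ₀ w / sv θ₀ w * maCoef θ₀ w n j + if j = n then (sv θ₀ w)⁻¹ else 0 := by
  simp only [maCoef]
  rcases lt_trichotomy j n with h | h | h
  · rw [if_pos (by omega), if_pos h, if_neg h.ne, show n + 1 - 1 - j = n - 1 - j + 1 by omega]
    ring
  · subst h
    simp
  · rw [if_neg (by omega), if_neg (by omega), if_neg (by omega)]
    simp

/-- Truncated moving average representation of the error process. -/
theorem eigProc_eq_truncated (hD : Diagonalizes O w W) (hU : IsErrorProcess P W θ₀ v U)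
    (hs : ∀ l, sv θ₀ (w l) ≠ 0) (l : Fin N) (b : ℤ) (n L : ℕ) (hn : n ≤ L) :
    ∀ᵐ ω ∂P, eigProc O U l (b + n) ω = (rv θ₀ (w l) / sv θ₀ (w l)) ^ n * eigProc O U l b ω
      + ∑ j : Fin L, maCoef θ₀ (w l) n j * eigNoise O v l (b + 1 + (j : ℕ)) ω := by
  induction n with
  | zero => simp [maCoef]
  | succ n ih =>
    filter_upwards [ih (by omega), eigProc_recursion hD hU l (b + (n + 1 : ℕ))] with ω h1 h2
    have hsl := hs l
    rw [show b + ((n + 1 : ℕ) : ℤ) - 1 = b + n by push_cast; ring] at h2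
    have h3 : ∑ j : Fin L, maCoef θ₀ (w l) (n + 1) j * eigNoise O v l (b + 1 + (j : ℕ)) ω
        = rv θ₀ (w l) / sv θ₀ (w l) *
            ∑ j : Fin L, maCoef θ₀ (w l) n j * eigNoise O v l (b + 1 + (j : ℕ)) ω
          + (sv θ₀ (w l))⁻¹ * eigNoise O v l (b + (n + 1 : ℕ)) ω := by
      simp_rw [maCoef_succ, add_mul, Finset.sum_add_distrib, Finset.mul_sum]
      congr 1
      · exact Finset.sum_congr rfl fun j _ => by ring
      · rw [Finset.sum_eq_single (⟨n, by omega⟩ : Fin L)]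
        · rw [if_pos rfl]
          congr 2; push_cast; ring
        · intro j _ hj
          rw [if_neg (fun h => hj (Fin.ext h)), zero_mul]
        · simp
    rw [h3]
    have h4 : eigProc O U l (b + (n + 1 : ℕ)) ω = (sv θ₀ (w l))⁻¹ *
        (rv θ₀ (w l) * eigProc O U l (b + n) ω
          + eigNoise O v l (b + (n + 1 : ℕ)) ω) := by
      rw [← h2, inv_mul_cancel_left₀ hsl]
    rw [h4, h1]
    ring

/-- Partial sums of the geometric series for the stationary variance; the bound does not depend on
the window length, so the truncation can be removed later. -/
theorem sum_maCoef_sq_le {w : ℝ} (hs : sv θ₀ w ≠ 0) (ha : |rv θ₀ w / sv θ₀ w| < 1) (n L : ℕ) :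
    ∑ j : Fin L, maCoef θ₀ w n j ^ 2 ≤ statVar θ₀ w := by
  set a := rv θ₀ w / sv θ₀ w with ha_def
  have ha2 : a ^ 2 < 1 := (sq_lt_one_iff_abs_lt_one _).mpr ha
  have h1 : statVar θ₀ w = (1 - a ^ 2)⁻¹ * (sv θ₀ w ^ 2)⁻¹ := by
    rw [statVar, ← mul_inv, ha_def]; congr 1; field_simp
  have h2 : ∑ j : Fin L, maCoef θ₀ w n j ^ 2
      ≤ ∑ j ∈ Finset.range n, (a ^ 2) ^ (n - 1 - j) * (sv θ₀ w ^ 2)⁻¹ := by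
    rw [Fin.sum_univ_eq_sum_range fun j => maCoef θ₀ w n j ^ 2]
    have h3 : ∀ j, maCoef θ₀ w n j ^ 2
        = if j < n then (a ^ 2) ^ (n - 1 - j) * (sv θ₀ w ^ 2)⁻¹ else 0 := by
      intro j
      rw [maCoef]
      split_ifs
      · rw [← ha_def, div_pow, ← pow_mul, ← pow_mul, mul_comm 2, div_eq_mul_inv]
      · simp
    simp_rw [h3]
    rw [← Finset.sum_filter]
    refine Finset.sum_le_sum_of_subset_of_nonneg (by intro j; simp) fun j _ _ => by positivity
  refine h2.trans ?_
  rw [h1, ← Finset.sum_mul, Finset.sum_range_reflect (fun j => (a ^ 2) ^ j)]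
  refine mul_le_mul_of_nonneg_right ?_ (by positivity)
  rw [← tsum_geometric_of_lt_one (sq_nonneg a) ha2]
  exact (summable_geometric_of_lt_one (sq_nonneg a) ha2).sum_le_tsum _ fun j _ => by positivity

/-- The truncated process. -/
def truncProc (O : Matrix (Fin N) (Fin N) ℝ) (w : Fin N → ℝ) (θ₀ : Theta) (v : ℕ → ℤ → Ω → ℝ)
    (b : ℤ) (n L : ℕ) (l : Fin N) (ω : Ω) : ℝ :=
  ∑ j : Fin L, maCoef θ₀ (w l) n j * eigNoise O v l (b + 1 + (j : ℕ)) ω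

/-- Concentration of weighted sums of products of truncated processes. -/
theorem exists_integral_truncProc_sq_le [IsProbabilityMeasure P] (hD : Diagonalizes O w W)
    (hv : IIDInnovations P v v₀) {κ : ℝ} (hκ : ∀ j t, ∫ ω, (v j t ω ^ 2 - v₀) ^ 2 ∂P ≤ κ)
    (hs : ∀ l, sv θ₀ (w l) ≠ 0) (ha : ∀ l, |rv θ₀ (w l) / sv θ₀ (w l)| < 1)
    (c : Fin N → ℝ) (b : ℤ) (n n' L : ℕ) :
    ∃ β, MemLp (fun ω => ∑ l, c l * (truncProc O w θ₀ v b n L l ω * truncProc O w θ₀ v b n' L l ω)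
        - β) 2 P ∧
      ∫ ω, (∑ l, c l * (truncProc O w θ₀ v b n L l ω * truncProc O w θ₀ v b n' L l ω) - β) ^ 2 ∂P
        ≤ (κ + 2 * v₀ ^ 2) * ∑ l, c l ^ 2 * statVar θ₀ (w l) ^ 2 := by
  classical
  set Z : Fin N × Fin L → Ω → ℝ := fun p => v p.1 (b + 1 + ((p.2 : ℕ) : ℤ)) with hZ_def
  have hinj : Function.Injective fun p : Fin N × Fin L =>
      (((p.1 : ℕ), b + 1 + ((p.2 : ℕ) : ℤ)) : ℕ × ℤ) := by
    rintro ⟨i, j⟩ ⟨i', j'⟩ h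
    simp only [Prod.mk.injEq] at h
    exact Prod.ext (Fin.ext h.1) (Fin.ext (by have := h.2; dsimp; omega))
  have hind : iIndepFun Z P := hv.1.precomp hinj
  set d : Fin L → Fin L → Fin N → ℝ := fun j j' l =>
    c l * (maCoef θ₀ (w l) n j * maCoef θ₀ (w l) n' j') with hd
  -- Expressed in the original independent innovations, each time block of the form is diagonalized
  -- by O. Its squared Frobenius norm is thus a sum over eigenvalues, with no factor from the
  -- dimension of O.
  set Q : Fin N × Fin L → Fin N × Fin L → ℝ := fun p q => specMat O (d p.2 q.2) p.1 q.1 with hQ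
  have hform : ∀ ω, ∑ l, c l * (truncProc O w θ₀ v b n L l ω * truncProc O w θ₀ v b n' L l ω)
      = ∑ p, ∑ q, Q p q * (Z p ω * Z q ω) := by
    intro ω
    have h1 : ∀ (n : ℕ) l, truncProc O w θ₀ v b n L l ω
        = ∑ p : Fin N × Fin L, maCoef θ₀ (w l) n p.2 * O p.1 l * Z p ω := by
      intro n l
      rw [truncProc, Fintype.sum_prod_type_right]
      refine Finset.sum_congr rfl fun j _ => ?_
      rw [eigNoise, Finset.mul_sum]
      exact Finset.sum_congr rfl fun i _ => by simp only [hZ_def]; ring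
    simp_rw [h1, Finset.sum_mul_sum, Finset.mul_sum]
    rw [Finset.sum_comm]
    refine Finset.sum_congr rfl fun p _ => ?_
    rw [Finset.sum_comm]
    refine Finset.sum_congr rfl fun q _ => ?_
    simp only [hQ, specMat_apply, hd, Finset.sum_mul]
    exact Finset.sum_congr rfl fun l _ => by ring
  have hce : (fun ω => ∑ l, c l * (truncProc O w θ₀ v b n L l ω * truncProc O w θ₀ v b n' L l ω)
      - v₀ * ∑ p, Q p p) = centredForm Z v₀ Q Finset.univ := by
    ext ω; rw [hform]; rfl
  refine ⟨v₀ * ∑ p, Q p p, ?_, ?_⟩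
  · rw [hce]; exact memLp_centredForm (fun p => hv.memLp_four _ _) Q _
  have hmain := integral_centredForm_sq_le hind (fun p => hv.memLp_four _ _)
    (fun p => hv.2.2.2.1 _ _) (fun p => hv.2.2.2.2 _ _) (κ := κ) (fun p => hκ _ _) Q Finset.univ
  rw [← hce] at hmain
  have hK : 0 ≤ κ + 2 * v₀ ^ 2 := by
    have : 0 ≤ κ := (integral_nonneg fun ω => sq_nonneg _).trans (hκ 0 0)
    positivity
  refine hmain.trans (mul_le_mul_of_nonneg_left ?_ hK)
  have hQ2 : ∑ p, ∑ q, Q p q ^ 2 = ∑ j, ∑ j', ∑ l, d j j' l ^ 2 := by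
    rw [Fintype.sum_prod_type_right]
    refine Finset.sum_congr rfl fun j _ => ?_
    simp_rw [Fintype.sum_prod_type_right]
    rw [Finset.sum_comm]
    refine Finset.sum_congr rfl fun j' _ => ?_
    exact sum_sq_specMat hD.left (d j j')
  have hQ3 : ∑ j, ∑ j', ∑ l, d j j' l ^ 2 = ∑ l, c l ^ 2 *
      ((∑ j : Fin L, maCoef θ₀ (w l) n j ^ 2) * ∑ j : Fin L, maCoef θ₀ (w l) n' j ^ 2) := by
    simp_rw [Finset.sum_mul_sum, Finset.mul_sum]
    symm
    rw [Finset.sum_comm]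
    refine Finset.sum_congr rfl fun j _ => ?_
    rw [Finset.sum_comm]
    exact Finset.sum_congr rfl fun j' _ => Finset.sum_congr rfl fun l _ => by
      simp only [hd]; ring
  rw [hQ2, hQ3]
  refine Finset.sum_le_sum fun l _ => mul_le_mul_of_nonneg_left ?_ (sq_nonneg _)
  rw [sq]
  exact mul_le_mul (sum_maCoef_sq_le (hs l) (ha l) n L) (sum_maCoef_sq_le (hs l) (ha l) n' L)
    (Finset.sum_nonneg fun _ _ => sq_nonneg _)
    (inv_nonneg.mpr (sq_sub_sq_pos (hs l) (ha l)).le)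

/-- From 2|f| ≤ f²/η + η. The free parameter is later set to √N, which balances a second moment of
order N. -/
theorem integral_abs_le_of_sq {f : Ω → ℝ} [IsProbabilityMeasure P] (hf : MemLp f 2 P) {η : ℝ}
    (hη : 0 < η) : ∫ ω, |f ω| ∂P ≤ ((∫ ω, f ω ^ 2 ∂P) / η + η) / 2 := by
  have h : HasMean P (fun ω => (f ω ^ 2 / η + η) / 2) (((∫ ω, f ω ^ 2 ∂P) / η + η) / 2) :=
    (((HasMean.const_mul (η⁻¹) ⟨hf.integrable_sq, rfl⟩).add (hasMean_const η)).const_mul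
      (1 / 2)).of_eq (fun ω => by ring) (by ring)
  rw [← h.2]
  refine integral_mono (hf.integrable (by norm_num)).abs h.1 fun ω => ?_
  change |f ω| ≤ (f ω ^ 2 / η + η) / 2
  rw [le_div_iff₀ two_pos, ← sub_nonneg,
    show f ω ^ 2 / η + η - |f ω| * 2 = (|f ω| - η) ^ 2 / η by
      rw [sub_sq, sq_abs]; field_simp; ring]
  positivity

/-- Mean absolute deviation of weighted sums of products of the error process. -/
theorem integral_abs_quadratic_le [IsProbabilityMeasure P] (hD : Diagonalizes O w W)
    (hU : IsErrorProcess P W θ₀ v U) (hv : IIDInnovations P v v₀) {κ : ℝ}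
    (hκ : ∀ j t, ∫ ω, (v j t ω ^ 2 - v₀) ^ 2 ∂P ≤ κ)
    (hs : ∀ l, sv θ₀ (w l) ≠ 0) (ha : ∀ l, |rv θ₀ (w l) / sv θ₀ (w l)| < 1)
    (c : Fin N → ℝ) (t t' : ℕ) {η : ℝ} (hη : 0 < η) :
    ∫ ω, |∑ l, c l * (eigProc O U l t ω * eigProc O U l t' ω)
        - ∫ ω', ∑ l, c l * (eigProc O U l t ω' * eigProc O U l t' ω') ∂P| ∂P
      ≤ (κ + 2 * v₀ ^ 2) * (∑ l, c l ^ 2 * statVar θ₀ (w l) ^ 2) / η + η := by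
  set F : Ω → ℝ := fun ω => ∑ l, c l * (eigProc O U l t ω * eigProc O U l t' ω) with hF
  have hFi : Integrable F P :=
    integrable_finsetSum _ fun l _ => (integrable_eigProc_mul hU l l t t').const_mul _
  set V := (κ + 2 * v₀ ^ 2) * ∑ l, c l ^ 2 * statVar θ₀ (w l) ^ 2 with hV
  have hsq : ∀ l (t : ℤ), ∫ ω, eigProc O U l t ω ^ 2 ∂P = v₀ * statVar θ₀ (w l) := by
    intro l t
    have := (hasMean_eigProc_mul hD hU hv hs ha l l t).2
    rw [if_pos rfl] at this
    rw [← this]; simp_rw [sq]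
  -- Starting the moving average at time -J leaves a remainder of order |r/s|^J for each eigenvalue.
  -- With N fixed, J tends to infinity and the remainder disappears, while the concentration bound
  -- is free of J.
  have hJ : ∀ J : ℕ, ∫ ω, |F ω - ∫ ω', F ω' ∂P| ∂P
      ≤ 2 * (∑ l, |c l| * (|rv θ₀ (w l) / sv θ₀ (w l)| ^ J * (3 * (v₀ * statVar θ₀ (w l)))))
        + (V / η + η) := by
    intro J
    set b : ℤ := -J with hb
    -- A common window long enough for both times; the coefficients beyond each time are zero.
    set L := t + J + (t' + J) with hL
    obtain ⟨β, hβ2, hβ⟩ := exists_integral_truncProc_sq_le hD hv hκ hs ha c b (t + J) (t' + J) L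
    set FJ : Ω → ℝ := fun ω => ∑ l, c l * (truncProc O w θ₀ v b (t + J) L l ω *
      truncProc O w θ₀ v b (t' + J) L l ω) with hFJ
    have hFJi : Integrable FJ P := by
      have h1 := (hβ2.integrable (by norm_num)).add (integrable_const β)
      refine h1.congr (Eventually.of_forall fun ω => ?_)
      simp [hFJ]
    refine (integral_abs_sub_integral_le hFi β).trans ?_
    have h1 : ∫ ω, |F ω - β| ∂P ≤ (∫ ω, |F ω - FJ ω| ∂P) + ∫ ω, |FJ ω - β| ∂P := by
      have i1 : Integrable (fun ω => |F ω - FJ ω|) P := (hFi.sub hFJi).abs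
      have i2 : Integrable (fun ω => |FJ ω - β|) P := (hFJi.sub (integrable_const β)).abs
      rw [← integral_add i1 i2]
      refine integral_mono (hFi.sub (integrable_const β)).abs (i1.add i2) fun ω => ?_
      exact abs_sub_le (F ω) (FJ ω) β
    have h2 : ∫ ω, |FJ ω - β| ∂P ≤ (V / η + η) / 2 := by
      refine (integral_abs_le_of_sq hβ2 hη).trans ?_
      have : (∫ ω, (FJ ω - β) ^ 2 ∂P) / η ≤ V / η := by gcongr
      linarith
    have h3 : ∫ ω, |F ω - FJ ω| ∂P
        ≤ ∑ l, |c l| * (|rv θ₀ (w l) / sv θ₀ (w l)| ^ J * (3 * (v₀ * statVar θ₀ (w l)))) := by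
      set x : Fin N → Ω → ℝ := fun l ω => |eigProc O U l t ω * eigProc O U l b ω|
        + |eigProc O U l b ω * eigProc O U l t' ω| + |eigProc O U l b ω * eigProc O U l b ω|
        with hx
      have hxi : ∀ l, Integrable (x l) P := fun l =>
        ((integrable_eigProc_mul hU l l t b).abs.add
          (integrable_eigProc_mul hU l l b t').abs).add (integrable_eigProc_mul hU l l b b).abs
      have hxm : ∀ l, ∫ ω, x l ω ∂P ≤ 3 * (v₀ * statVar θ₀ (w l)) := by
        intro l
        have e : ∀ t t' : ℤ, ∫ ω, |eigProc O U l t ω * eigProc O U l t' ω| ∂P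
            ≤ v₀ * statVar θ₀ (w l) := by
          intro t t'
          refine (integral_abs_mul_le (memLp_eigProc hU l t) (memLp_eigProc hU l t')).trans ?_
          rw [hsq, hsq]; linarith
        have hm : ∀ t t' : ℤ, HasMean P (fun ω => |eigProc O U l t ω * eigProc O U l t' ω|)
            (∫ ω, |eigProc O U l t ω * eigProc O U l t' ω| ∂P) := fun t t' =>
          ⟨(integrable_eigProc_mul hU l l t t').abs, rfl⟩
        rw [(((hm t b).add (hm b t')).add (hm b b)).2]
        linarith [e t b, e b t', e b b]
      have hle : ∀ᵐ ω ∂P, |F ω - FJ ω|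
          ≤ ∑ l, |c l| * (|rv θ₀ (w l) / sv θ₀ (w l)| ^ J * x l ω) := by
        have e1 : ∀ᵐ ω ∂P, ∀ l, eigProc O U l (b + (t + J : ℕ)) ω
            = (rv θ₀ (w l) / sv θ₀ (w l)) ^ (t + J) * eigProc O U l b ω
              + truncProc O w θ₀ v b (t + J) L l ω :=
          ae_all_iff.mpr fun l => eigProc_eq_truncated hD hU hs l b (t + J) L (by omega)
        have e2 : ∀ᵐ ω ∂P, ∀ l, eigProc O U l (b + (t' + J : ℕ)) ω
            = (rv θ₀ (w l) / sv θ₀ (w l)) ^ (t' + J) * eigProc O U l b ω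
              + truncProc O w θ₀ v b (t' + J) L l ω :=
          ae_all_iff.mpr fun l => eigProc_eq_truncated hD hU hs l b (t' + J) L (by omega)
        filter_upwards [e1, e2] with ω h1 h2
        rw [hF, hFJ]
        simp only
        rw [← Finset.sum_sub_distrib]
        refine (Finset.abs_sum_le_sum_abs _ _).trans (Finset.sum_le_sum fun l _ => ?_)
        rw [← mul_sub, abs_mul]
        refine mul_le_mul_of_nonneg_left ?_ (abs_nonneg _)
        have g1 := h1 l
        have g2 := h2 l
        rw [show b + ((t + J : ℕ) : ℤ) = t by rw [hb]; push_cast; ring] at g1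
        rw [show b + ((t' + J : ℕ) : ℤ) = t' by rw [hb]; push_cast; ring] at g2
        have hal := (ha l).le
        set a := rv θ₀ (w l) / sv θ₀ (w l)
        set X := eigProc O U l t ω
        set Y := eigProc O U l t' ω
        set B' := eigProc O U l b ω with hB'
        have e3 : truncProc O w θ₀ v b (t + J) L l ω = X - a ^ (t + J) * B' := by linarith
        have e4 : truncProc O w θ₀ v b (t' + J) L l ω = Y - a ^ (t' + J) * B' := by linarith
        rw [e3, e4, show X * Y - (X - a ^ (t + J) * B') * (Y - a ^ (t' + J) * B')
          = a ^ J * (a ^ t' * (X * B') + a ^ t * (B' * Y) - a ^ (t + t' + J) * (B' * B')) by ring,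
          abs_mul, abs_pow]
        refine mul_le_mul_of_nonneg_left ?_ (by positivity)
        have hp : ∀ (m : ℕ) (y : ℝ), |a ^ m * y| ≤ |y| := by
          intro m y
          rw [abs_mul, abs_pow]
          exact mul_le_of_le_one_left (abs_nonneg _) (pow_le_one₀ (abs_nonneg _) hal)
        refine (abs_sub _ _).trans (add_le_add ((abs_add_le _ _).trans ?_) (hp _ _))
        exact add_le_add (hp _ _) (hp _ _)
      have hxs : Integrable
          (fun ω => ∑ l, |c l| * (|rv θ₀ (w l) / sv θ₀ (w l)| ^ J * x l ω)) P :=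
        integrable_finsetSum _ fun l _ => ((hxi l).const_mul _).const_mul _
      refine (integral_mono_ae (hFi.sub hFJi).abs hxs hle).trans ?_
      rw [integral_finsetSum _ fun l _ => ((hxi l).const_mul _).const_mul _]
      refine Finset.sum_le_sum fun l _ => ?_
      rw [integral_const_mul, integral_const_mul]
      have := hxm l
      gcongr
    linarith
  have hlim : Tendsto (fun J : ℕ => 2 * (∑ l, |c l| *
      (|rv θ₀ (w l) / sv θ₀ (w l)| ^ J * (3 * (v₀ * statVar θ₀ (w l))))) + (V / η + η)) atTop
      (𝓝 (2 * (∑ l, |c l| * (0 * (3 * (v₀ * statVar θ₀ (w l))))) + (V / η + η))) := by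
    refine (Tendsto.const_mul 2 (tendsto_finsetSum _ fun l _ => Tendsto.const_mul _ ?_)).add_const _
    exact (tendsto_pow_atTop_nhds_zero_of_lt_one (abs_nonneg _) (ha l)).mul_const _
  have h := ge_of_tendsto' hlim hJ
  simpa using h

/-- Second moment of weighted sums of the error process. -/
theorem hasMean_sq_sum_eigProc [IsProbabilityMeasure P] (hD : Diagonalizes O w W)
    (hU : IsErrorProcess P W θ₀ v U) (hv : IIDInnovations P v v₀)
    (hs : ∀ l, sv θ₀ (w l) ≠ 0) (ha : ∀ l, |rv θ₀ (w l) / sv θ₀ (w l)| < 1)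
    (c : Fin N → ℝ) (t : ℤ) :
    HasMean P (fun ω => (∑ l, c l * eigProc O U l t ω) ^ 2)
      (∑ l, c l ^ 2 * (v₀ * statVar θ₀ (w l))) := by
  have h := HasMean.sum (s := Finset.univ) fun (l : Fin N) _ =>
    HasMean.sum (s := Finset.univ) fun (l' : Fin N) _ =>
      (hasMean_eigProc_mul hD hU hv hs ha l l' t).const_mul (c l * c l')
  refine h.of_eq (fun ω => ?_) ?_
  · rw [sq, Finset.sum_mul_sum]
    exact Finset.sum_congr rfl fun i _ => Finset.sum_congr rfl fun j _ => by ring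
  · refine Finset.sum_congr rfl fun l _ => ?_
    simp only [mul_ite, mul_zero, Finset.sum_ite_eq, Finset.mem_univ, if_true]
    ring

theorem integral_abs_linear_le [IsProbabilityMeasure P] (hD : Diagonalizes O w W)
    (hU : IsErrorProcess P W θ₀ v U) (hv : IIDInnovations P v v₀)
    (hs : ∀ l, sv θ₀ (w l) ≠ 0) (ha : ∀ l, |rv θ₀ (w l) / sv θ₀ (w l)| < 1)
    (c : Fin N → ℝ) (t : ℤ) {η : ℝ} (hη : 0 < η) :
    ∫ ω, |∑ l, c l * eigProc O U l t ω| ∂P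
      ≤ ((∑ l, c l ^ 2 * (v₀ * statVar θ₀ (w l))) / η + η) / 2 := by
  have hm : MemLp (fun ω => ∑ l, c l * eigProc O U l t ω) 2 P :=
    memLp_finsetSum _ fun l _ => (memLp_eigProc hU l t).const_mul _
  have h := integral_abs_le_of_sq hm hη
  rwa [(hasMean_sq_sum_eigProc hD hU hv hs ha c t).2] at h

end LLN

/-! ### Spectral consequences of uniform boundedness -/

section UniformBounds

variable {N : ℕ} {O : Matrix (Fin N) (Fin N) ℝ} {w : Fin N → ℝ} {W : Matrix (Fin N) (Fin N) ℝ}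

theorem abs_sv_inv_le (hD : Diagonalizes O w W) {θ : Theta} (hs : ∀ l, sv θ (w l) ≠ 0) {C : ℝ}
    (hc : ∀ j, ∑ i, |(S W θ)⁻¹ i j| ≤ C) (hr : ∀ i, ∑ j, |(S W θ)⁻¹ i j| ≤ C) (l : Fin N) :
    |(sv θ (w l))⁻¹| ≤ C := by
  rw [S_inv_eq hD hs] at hc hr
  exact abs_le_of_specMat_sums_le hD.left hc hr l

theorem summable_abs_specMat_pow (hO : Oᵀ * O = 1) (hO' : O * Oᵀ = 1) {a : Fin N → ℝ}
    (ha : ∀ l, |a l| < 1) (i j : Fin N) : Summable fun h : ℕ => |(specMat O a ^ (h + 1)) i j| := by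
  have hsum : Summable fun h : ℕ => ∑ l, |O i l| * |O j l| * |a l| ^ (h + 1) := by
    refine summable_sum fun l _ => Summable.mul_left _ ?_
    exact (summable_nat_add_iff 1).mpr (summable_geometric_of_lt_one (abs_nonneg _) (ha l))
  refine Summable.of_nonneg_of_le (fun _ => abs_nonneg _) (fun h => ?_) hsum
  rw [specMat_pow hO hO', specMat_apply]
  refine (Finset.abs_sum_le_sum_abs _ _).trans (Finset.sum_le_sum fun l _ => le_of_eq ?_)
  rw [Pi.pow_apply, abs_mul, abs_mul, abs_pow]
  ring

/-- Let e be the sign of the chosen eigenvalue a of A. The partial sums of the powers of eA are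
dominated entrywise by the sum of absolute powers, and the chosen eigenvalue of their limit is
|a|/(1 - |a|). Hence |a|/(1 - |a|) ≤ C, a stability margin free of N. -/
theorem abs_ratio_le_of_absPowSum (hD : Diagonalizes O w W) {θ : Theta}
    (hs : ∀ l, sv θ (w l) ≠ 0) (ha : ∀ l, |rv θ (w l) / sv θ (w l)| < 1) {C : ℝ} (hC : 0 ≤ C)
    (hc : ∀ j, ∑ i, |absPowSum W θ i j| ≤ C) (hr : ∀ i, ∑ j, |absPowSum W θ i j| ≤ C)
    (l : Fin N) : |rv θ (w l) / sv θ (w l)| ≤ C / (1 + C) := by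
  set a : Fin N → ℝ := fun l => rv θ (w l) / sv θ (w l) with ha_def
  have hA : A W θ = specMat O a := A_eq hD hs
  obtain ⟨e, he, hea⟩ : ∃ e : ℝ, |e| = 1 ∧ e * a l = |a l| := by
    rcases le_total 0 (a l) with h | h
    · exact ⟨1, by simp, by rw [abs_of_nonneg h, one_mul]⟩
    · exact ⟨-1, by simp, by rw [abs_of_nonpos h]; ring⟩
  have hent : ∀ (H : ℕ) i j, |specMat O (fun l' => ∑ h ∈ Finset.range H, (e * a l') ^ (h + 1)) i j|
      ≤ |absPowSum W θ i j| := by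
    intro H i j
    have h1 : specMat O (fun l' => ∑ h ∈ Finset.range H, (e * a l') ^ (h + 1)) i j
        = ∑ h ∈ Finset.range H, e ^ (h + 1) * (specMat O a ^ (h + 1)) i j := by
      simp_rw [specMat_pow hD.left hD.right, specMat_apply, Finset.mul_sum, Finset.sum_mul]
      rw [Finset.sum_comm]
      refine Finset.sum_congr rfl fun h _ => Finset.sum_congr rfl fun l' _ => ?_
      rw [Pi.pow_apply, mul_pow]; ring
    rw [h1]
    refine (Finset.abs_sum_le_sum_abs _ _).trans ?_
    have h2 : ∀ h ∈ Finset.range H, |e ^ (h + 1) * (specMat O a ^ (h + 1)) i j|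
        ≤ |(specMat O a ^ (h + 1)) i j| := by
      intro h _
      rw [abs_mul, abs_pow, he, one_pow, one_mul]
    refine (Finset.sum_le_sum h2).trans (le_trans ?_ (le_abs_self _))
    rw [absPowSum, Matrix.of_apply, hA]
    exact (summable_abs_specMat_pow hD.left hD.right ha i j).sum_le_tsum _ fun _ _ => abs_nonneg _
  have hH : ∀ H : ℕ, |a l| * ∑ h ∈ Finset.range H, |a l| ^ h ≤ C := by
    intro H
    have h1 := abs_le_of_specMat_sums_le hD.left
      (d := fun l' => ∑ h ∈ Finset.range H, (e * a l') ^ (h + 1)) (C := C)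
      (fun j => (Finset.sum_le_sum fun i _ => hent H i j).trans (hc j))
      (fun i => (Finset.sum_le_sum fun j _ => hent H i j).trans (hr i)) l
    refine le_trans (le_of_eq ?_) ((le_abs_self _).trans h1)
    rw [Finset.mul_sum]
    refine Finset.sum_congr rfl fun h _ => ?_
    rw [hea]; ring
  have hlim : Tendsto (fun H : ℕ => |a l| * ∑ h ∈ Finset.range H, |a l| ^ h) atTop
      (𝓝 (|a l| * (1 - |a l|)⁻¹)) :=
    Tendsto.const_mul _ (hasSum_geometric_of_lt_one (abs_nonneg _) (ha l)).tendsto_sum_nat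
  have h1 := le_of_tendsto' hlim hH
  have h2 : 0 < 1 - |a l| := by have := ha l; linarith
  rw [← div_eq_mul_inv, div_le_iff₀ h2] at h1
  rw [le_div_iff₀ (by positivity)]
  change |a l| * (1 + C) ≤ C
  linarith

/-- The test vector is a unit eigenvector placed in the first time slice. Its quadratic form is (s²
- r²) + r²; the second term comes from predicting the second slice, so two observation times are
needed. -/
theorem sv_sq_le_of_prec_sums (hD : Diagonalizes O w W) {n : ℕ} {θ : Theta}
    (hs : ∀ l, sv θ (w l) ≠ 0) (ha : ∀ l, |rv θ (w l) / sv θ (w l)| < 1) {C : ℝ}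
    (hc : ∀ j, ∑ i, |Prec (n + 1 + 1) W θ i j| ≤ C) (hr : ∀ i, ∑ j, |Prec (n + 1 + 1) W θ i j| ≤ C)
    (l : Fin N) : sv θ (w l) ^ 2 ≤ C := by
  set y : Fin (n + 1 + 1) × Fin N → ℝ := fun p => if p.1 = 0 then O p.2 l else 0 with hy
  have h := (le_abs_self _).trans (abs_dotProduct_mulVec_le hc hr y)
  have hsum : ∑ p, y p ^ 2 = 1 := by
    rw [Fintype.sum_prod_type]
    simp only [hy, ite_pow, zero_pow two_ne_zero]
    rw [Finset.sum_eq_single 0 (fun t _ ht => by simp [ht]) (by simp)]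
    have := sum_col_mul_col hD.left l l
    simpa [sq] using this
  have hrot : ∀ l', rot O y l' = if l' = l then Pi.single 0 1 else 0 := by
    intro l'
    ext t
    rw [rot]
    by_cases ht : t = 0
    · subst ht
      simp only [hy, if_true, sum_col_mul_col hD.left]
      split_ifs <;> simp
    · simp only [hy, if_neg ht, mul_zero, Finset.sum_const_zero]
      split_ifs <;> simp [ht]
  have hform : y ⬝ᵥ (Prec (n + 1 + 1) W θ *ᵥ y) = sv θ (w l) ^ 2 := by
    rw [Prec_eq hD _ hs ha, dotProduct_specBlock_mulVec,
      Finset.sum_eq_single l (fun l' _ hl' => by rw [hrot, if_neg hl', zero_dotProduct]) (by simp),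
      hrot, if_pos rfl, precMat_bilin (hs l), Fin.sum_univ_succ,
      Finset.sum_eq_zero]
    · have : (Pi.single 0 1 : Fin (n + 1 + 1) → ℝ) (Fin.succ 0) = 0 := by simp
      rw [this]
      simp
      ring
    · intro u _
      have h1 : (Pi.single 0 1 : Fin (n + 1 + 1) → ℝ) u.succ.succ = 0 := by simp
      have h2 : (Pi.single 0 1 : Fin (n + 1 + 1) → ℝ) u.succ.castSucc = 0 := by
        rw [← Fin.succ_castSucc]; simp
      rw [h1, h2]; simp
  rw [hform, hsum, mul_one] at h
  exact h

end UniformBounds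

/-! ### One compact set for all spectra, and the sign of the eigenvalues of S -/

section UniformBoundsSeq

variable {N : ℕ → ℕ} {O : ∀ m, Matrix (Fin (N m)) (Fin (N m)) ℝ} {w : ∀ m, Fin (N m) → ℝ}
  {W : ∀ m, Matrix (Fin (N m)) (Fin (N m)) ℝ}

/-- The uniform boundedness assumptions confine the eigenvalues of all weight matrices to a
compact set on which the true model is uniformly stable. -/
theorem exists_mem_eigSet (hD : ∀ m, Diagonalizes (O m) (w m) (W m)) {n : ℕ} {Θθ : Set Theta}
    {θ₀ : Theta} (hΘ : Θθ ∈ 𝓝 θ₀) (hadm : ∀ m, ∀ θ ∈ Θθ, Admissible (W m) θ)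
    (hUBprec : ∀ θ ∈ Θθ, UB fun m => Prec (n + 1 + 1) (W m) θ)
    (hUBinv : ∀ θ ∈ Θθ, UB fun m => (S (W m) θ)⁻¹)
    (hUBpow : UB fun m => absPowSum (W m) θ₀) :
    ∃ M c q : ℝ, 0 < c ∧ q < 1 ∧ ∀ m l, w m l ∈ eigSet θ₀ M c q := by
  have h0 := mem_of_mem_nhds hΘ
  -- A bound on s = 1 - λw controls w only if λ ≠ 0. The true λ may be zero, so a nearby parameter
  -- is used.
  obtain ⟨θ₁, hθ₁, hne⟩ : ∃ θ ∈ Θθ, θ 0 ≠ 0 := by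
    have hcont : Continuous fun x : ℝ => Function.update θ₀ 0 x := by fun_prop
    have hmem : ∀ᶠ x in 𝓝 (θ₀ 0), Function.update θ₀ 0 x ∈ Θθ :=
      hcont.continuousAt.eventually_mem (by simpa using hΘ)
    have hx : ∃ᶠ x in 𝓝 (θ₀ 0), x ≠ 0 := by
      rcases eq_or_ne (θ₀ 0) 0 with h | h
      · rw [h]
        exact (eventually_mem_nhdsWithin (s := {0}ᶜ) (a := (0 : ℝ))).frequently.filter_mono
          nhdsWithin_le_nhds
      · exact (eventually_ne_nhds h).frequently
    obtain ⟨x, hx1, hx2⟩ := (hx.and_eventually hmem).exists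
    exact ⟨_, hx2, by simpa using hx1⟩
  obtain ⟨C₁, hC₁⟩ := hUBprec θ₁ hθ₁
  obtain ⟨C₂, hC₂⟩ := hUBinv θ₀ h0
  obtain ⟨C₃, hC₃⟩ := hUBpow
  -- The constants come from |1 - s| ≤ s² + 2 ≤ C₁ + 2 at θ₁, from |1/s| ≤ C₂ at θ₀, and from the
  -- stability margin at θ₀.
  refine ⟨(C₁ + 2) / |θ₁ 0|, (|C₂| + 1)⁻¹, |C₃| / (1 + |C₃|), by positivity, ?_, ?_⟩
  · rw [div_lt_one (by positivity)]; linarith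
  intro m l
  have hs := sv_ne_zero (hD m) (hadm m θ₀ h0).1
  have ha := abs_ratio_lt_one (hD m) (hadm m θ₀ h0)
  have hs1 := sv_ne_zero (hD m) (hadm m θ₁ hθ₁).1
  have ha1 := abs_ratio_lt_one (hD m) (hadm m θ₁ hθ₁)
  refine ⟨?_, ?_, ?_⟩
  · have h1 := sv_sq_le_of_prec_sums (hD m) hs1 ha1 (hC₁ m).1 (hC₁ m).2 l
    rw [le_div_iff₀ (abs_pos.mpr hne), ← abs_mul]
    have h2 : w m l * θ₁ 0 = 1 - sv θ₁ (w m l) := by rw [sv]; ring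
    rw [h2, abs_le]
    constructor <;> nlinarith [sq_nonneg (sv θ₁ (w m l) - 1), sq_nonneg (sv θ₁ (w m l) + 1)]
  · have h1 := abs_sv_inv_le (hD m) hs (hC₂ m).1 (hC₂ m).2 l
    rw [abs_inv] at h1
    have h2 : 0 < |sv θ₀ (w m l)| := abs_pos.mpr (hs l)
    rw [inv_le_comm₀ (by positivity) h2]
    exact h1.trans ((le_abs_self _).trans (by linarith))
  · have h1 := abs_ratio_le_of_absPowSum (hD m) hs ha (abs_nonneg C₃)
      (fun j => ((hC₃ m).1 j).trans (le_abs_self _))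
      (fun i => ((hC₃ m).2 i).trans (le_abs_self _)) l
    rwa [abs_div, div_le_iff₀ (abs_pos.mpr (hs l))] at h1

theorem statVar_le_of_mem_eigSet {θ₀ : Theta} {M c q : ℝ} (hc : 0 < c) (hq : q < 1) {w : ℝ}
    (hw : w ∈ eigSet θ₀ M c q) : statVar θ₀ w ≤ (c ^ 2 * (1 - max q 0 ^ 2))⁻¹ := by
  have hq0 : max q 0 < 1 := max_lt hq one_pos
  have hq0' : 0 ≤ max q 0 := le_max_right _ _
  have hq2 : max q 0 ^ 2 < 1 := by nlinarith
  rw [statVar]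
  have h1 : |rv θ₀ w| ≤ max q 0 * |sv θ₀ w| :=
    hw.2.2.trans (mul_le_mul_of_nonneg_right (le_max_left _ _) (abs_nonneg _))
  have h2 : rv θ₀ w ^ 2 ≤ max q 0 ^ 2 * sv θ₀ w ^ 2 := by
    rw [← sq_abs (rv θ₀ w), ← sq_abs (sv θ₀ w), ← mul_pow]
    exact pow_le_pow_left₀ (abs_nonneg _) h1 2
  have h3 : c ^ 2 ≤ sv θ₀ w ^ 2 := by
    rw [← sq_abs (sv θ₀ w)]
    exact pow_le_pow_left₀ hc.le hw.2.1 2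
  have h4 : 0 < 1 - max q 0 ^ 2 := by linarith
  refine inv_anti₀ (by positivity) ?_
  nlinarith

/-- The eigenvalues of `S(λ)` do not change sign on a connected set of admissible parameters. -/
theorem sv_mul_sv_pos {N : ℕ} {O : Matrix (Fin N) (Fin N) ℝ} {w : Fin N → ℝ}
    {W : Matrix (Fin N) (Fin N) ℝ} (hD : Diagonalizes O w W) {C : Set Theta} (hC : IsPreconnected C)
    (hadm : ∀ θ ∈ C, Admissible W θ) {θ θ' : Theta} (hθ : θ ∈ C) (hθ' : θ' ∈ C) (l : Fin N) :
    0 < sv θ (w l) * sv θ' (w l) := by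
  have hne : ∀ θ ∈ C, sv θ (w l) ≠ 0 := fun θ h => sv_ne_zero hD (hadm θ h).1 l
  by_contra hneg
  have h1 := hne θ hθ
  have h2 := hne θ' hθ'
  have hcont : ContinuousOn (fun θ : Theta => sv θ (w l)) C := (continuous_sv _).continuousOn
  rcases lt_or_gt_of_ne h1 with h3 | h3 <;> rcases lt_or_gt_of_ne h2 with h4 | h4
  · exact hneg (mul_pos_of_neg_of_neg h3 h4)
  · obtain ⟨x, hx, hx0⟩ := hC.intermediate_value hθ hθ' hcont ⟨h3.le, h4.le⟩
    exact hne x hx hx0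
  · obtain ⟨x, hx, hx0⟩ := hC.intermediate_value hθ' hθ hcont ⟨h4.le, h3.le⟩
    exact hne x hx hx0
  · exact hneg (mul_pos h3 h4)

end UniformBoundsSeq

/-! ### Lower bounds for the divergence between parameters -/

section Divergence

variable {n : ℕ} {θ θ₀ : Theta} {v v₀ w : ℝ}

theorem expForm_self (hs : sv θ w ≠ 0) (ha : |rv θ w / sv θ w| < 1) :
    expForm n θ θ w = n + 1 := by
  have hg := (sq_sub_sq_pos hs ha).ne'
  have h : sv θ w ^ 2 + rv θ w ^ 2 - 2 * (rv θ w * sv θ w * (rv θ w / sv θ w))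
      = sv θ w ^ 2 - rv θ w ^ 2 := by
    field_simp; ring
  rw [expForm, h]
  field_simp
  ring

theorem logPart_eq (hs : sv θ w ≠ 0) (ha : |rv θ w / sv θ w| < 1) :
    logPart n θ v w = (n + 1) * Real.log v - n * Real.log (sv θ w ^ 2)
      - Real.log (sv θ w ^ 2 - rv θ w ^ 2) := by
  have hg := sq_sub_sq_pos hs ha
  have h : 1 - (rv θ w / sv θ w) ^ 2 = (sv θ w ^ 2 - rv θ w ^ 2) / sv θ w ^ 2 := by
    field_simp
  rw [logPart, h, Real.log_div hg.ne' (pow_ne_zero _ hs), Real.log_pow]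
  push_cast
  ring

/-- With p and q the changes of s/σ and r/σ, the right side controls p² and (q - ap)². Since |a| ≤
1, passing back to p² + q² costs only a factor three. -/
theorem normalized_sq_le {s r s₀ r₀ σ σ₀ a γ b : ℝ} (hσ : 0 < σ) (hσ₀ : 0 < σ₀) (hs₀ : s₀ ≠ 0)
    (hr₀ : r₀ = a * s₀) (ha : a ^ 2 ≤ 1) (hγ : (s₀ ^ 2)⁻¹ ≤ γ) (hb : s₀ ^ 2 ≤ b) :
    σ₀ ^ 2 / (3 * b) * ((s / σ - s₀ / σ₀) ^ 2 + (r / σ - r₀ / σ₀) ^ 2)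
      ≤ (σ₀ * s / (σ * s₀) - 1) ^ 2 + σ₀ ^ 2 / σ ^ 2 * γ * (r - s * a) ^ 2 := by
  obtain ⟨p, hp⟩ : ∃ p, p = s / σ - s₀ / σ₀ := ⟨_, rfl⟩
  obtain ⟨q, hq⟩ : ∃ q, q = r / σ - r₀ / σ₀ := ⟨_, rfl⟩
  have h1 : (σ₀ * s / (σ * s₀) - 1) ^ 2 = σ₀ ^ 2 * (s₀ ^ 2)⁻¹ * p ^ 2 := by
    rw [hp]; field_simp
  have h2 : σ₀ ^ 2 / σ ^ 2 * γ * (r - s * a) ^ 2 = σ₀ ^ 2 * γ * (q - a * p) ^ 2 := by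
    have : q - a * p = (r - s * a) / σ := by rw [hq, hp, hr₀]; ring
    rw [this]; ring
  have h3 : p ^ 2 + q ^ 2 ≤ 3 * (p ^ 2 + (q - a * p) ^ 2) := by
    linear_combination sq_nonneg (q - 2 * (a * p)) + 2 * mul_le_mul_of_nonneg_right ha (sq_nonneg p)
      + sq_nonneg (q - a * p)
  have hs₀2 : 0 < s₀ ^ 2 := by positivity
  have hbpos : 0 < b := hs₀2.trans_le hb
  rw [h1, h2, ← hp, ← hq]
  calc σ₀ ^ 2 / (3 * b) * (p ^ 2 + q ^ 2)
      ≤ σ₀ ^ 2 / (3 * b) * (3 * (p ^ 2 + (q - a * p) ^ 2)) := by gcongr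
    _ = σ₀ ^ 2 * b⁻¹ * (p ^ 2 + (q - a * p) ^ 2) := by field_simp
    _ ≤ σ₀ ^ 2 * (s₀ ^ 2)⁻¹ * (p ^ 2 + (q - a * p) ^ 2) := by gcongr
    _ = σ₀ ^ 2 * (s₀ ^ 2)⁻¹ * p ^ 2 + σ₀ ^ 2 * (s₀ ^ 2)⁻¹ * (q - a * p) ^ 2 := by ring
    _ ≤ _ := by gcongr

/-- Lower bound for the divergence between two parameters on an eigenspace of `W`. -/
theorem divergence_ge (hs : sv θ w ≠ 0) (ha : |rv θ w / sv θ w| < 1) (hs₀ : sv θ₀ w ≠ 0)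
    (ha₀ : |rv θ₀ w / sv θ₀ w| < 1) (hpos : 0 < sv θ w * sv θ₀ w) (hv : 0 < v) (hv₀ : 0 < v₀)
    {b : ℝ} (hb : sv θ₀ w ^ 2 ≤ b) :
    n * (v₀ / (3 * b)) * ((sv θ w / √v - sv θ₀ w / √v₀) ^ 2 + (rv θ w / √v - rv θ₀ w / √v₀) ^ 2)
      ≤ logPart n θ v w + v₀ / v * expForm n θ₀ θ w
        - (logPart n θ₀ v₀ w + v₀ / v₀ * expForm n θ₀ θ₀ w) := by
  have hg := sq_sub_sq_pos hs ha
  have hg₀ := sq_sub_sq_pos hs₀ ha₀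
  rw [expForm_self hs₀ ha₀, logPart_eq hs ha, logPart_eq hs₀ ha₀, expForm]
  set s := sv θ w
  set r := rv θ w
  set s₀ := sv θ₀ w
  set r₀ := rv θ₀ w
  obtain ⟨σ, hσ, rfl⟩ : ∃ σ, 0 < σ ∧ v = σ ^ 2 := ⟨√v, by positivity, (Real.sq_sqrt hv.le).symm⟩
  obtain ⟨σ₀, hσ₀, rfl⟩ : ∃ σ, 0 < σ ∧ v₀ = σ ^ 2 :=
    ⟨√v₀, by positivity, (Real.sq_sqrt hv₀.le).symm⟩
  rw [Real.sqrt_sq hσ.le, Real.sqrt_sq hσ₀.le]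
  set a := r₀ / s₀ with ha_def
  have hr₀ : r₀ = a * s₀ := by rw [ha_def]; field_simp
  set γ := (s₀ ^ 2 - r₀ ^ 2)⁻¹ with hγ
  have hγpos : 0 < γ := inv_pos.mpr hg₀
  have hs₀2 : 0 < s₀ ^ 2 := by positivity
  have hγs : (s₀ ^ 2)⁻¹ ≤ γ := inv_anti₀ hg₀ (by nlinarith [sq_nonneg r₀])
  have hγa : γ * (1 - a ^ 2) = (s₀ ^ 2)⁻¹ := by
    have h1 : s₀ ^ 2 - r₀ ^ 2 = s₀ ^ 2 * (1 - a ^ 2) := by rw [hr₀]; ring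
    have h2 : 1 - a ^ 2 ≠ 0 := fun h => hg₀.ne' (by rw [h1, h, mul_zero])
    rw [hγ, h1, mul_inv, mul_assoc, inv_mul_cancel₀ h2, mul_one]
  set y := σ₀ * s / (σ * s₀) with hy
  -- The criterion sees only s², so log y² would not tell y = 1 from y = -1; the common sign of s
  -- and s₀ selects the former.
  have hypos : 0 < y := by
    rw [hy, show σ₀ * s / (σ * s₀) = σ₀ * (s * s₀) / (σ * s₀ ^ 2) by field_simp]
    positivity
  have hlogy := Real.log_le_sub_one_of_pos hypos
  have hlogy2 : 2 * Real.log y = Real.log (σ₀ ^ 2) + Real.log (s ^ 2) - Real.log (σ ^ 2)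
      - Real.log (s₀ ^ 2) := by
    have : y ^ 2 = σ₀ ^ 2 * s ^ 2 / (σ ^ 2 * s₀ ^ 2) := by rw [hy]; ring
    rw [← Nat.cast_two (R := ℝ), ← Real.log_pow, this, Real.log_div (by positivity) (by positivity),
      Real.log_mul (by positivity) (by positivity), Real.log_mul (by positivity) (by positivity)]
    ring
  set x := σ₀ ^ 2 / σ ^ 2 * (γ * (s ^ 2 - r ^ 2)) with hx
  have hxpos : 0 < x := by positivity
  have hlogx := Real.log_le_sub_one_of_pos hxpos
  have hlogx2 : Real.log x = Real.log (σ₀ ^ 2) - Real.log (σ ^ 2) + Real.log (s ^ 2 - r ^ 2)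
      - Real.log (s₀ ^ 2 - r₀ ^ 2) := by
    rw [hx, Real.log_mul (by positivity) (by positivity), Real.log_div (by positivity)
      (by positivity), Real.log_mul (by positivity) (by positivity), hγ, Real.log_inv]
    ring
  -- The initial observation contributes x - 1 - log x ≥ 0. Each of the n transitions contributes y²
  -- - 1 - 2 log y ≥ (y - 1)² plus the squared error of the autoregressive coefficient.
  have hmain : (n : ℝ) * ((y - 1) ^ 2 + σ₀ ^ 2 / σ ^ 2 * γ * (r - s * a) ^ 2)
      ≤ (n + 1) * Real.log (σ ^ 2) - n * Real.log (s ^ 2) - Real.log (s ^ 2 - r ^ 2)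
        + σ₀ ^ 2 / σ ^ 2 * (γ * (s ^ 2 - r ^ 2 + n * (s ^ 2 + r ^ 2 - 2 * (r * s * a))))
        - ((n + 1) * Real.log (σ₀ ^ 2) - n * Real.log (s₀ ^ 2) - Real.log (s₀ ^ 2 - r₀ ^ 2)
          + σ₀ ^ 2 / σ₀ ^ 2 * (n + 1)) := by
    have h1 : σ₀ ^ 2 / σ ^ 2 * (γ * (s ^ 2 + r ^ 2 - 2 * (r * s * a)))
        = y ^ 2 + σ₀ ^ 2 / σ ^ 2 * γ * (r - s * a) ^ 2 := by
      have : y ^ 2 = σ₀ ^ 2 / σ ^ 2 * s ^ 2 * (γ * (1 - a ^ 2)) := by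
        rw [hγa, hy]; field_simp
      rw [this]; ring
    have h2 : σ₀ ^ 2 / σ ^ 2 * (γ * (s ^ 2 - r ^ 2 + n * (s ^ 2 + r ^ 2 - 2 * (r * s * a))))
        = x + n * (y ^ 2 + σ₀ ^ 2 / σ ^ 2 * γ * (r - s * a) ^ 2) := by
      rw [← h1, hx]; ring
    rw [h2, div_self (by positivity)]
    have h3 := mul_nonneg (Nat.cast_nonneg (α := ℝ) n)
      (sub_nonneg.mpr hlogy)
    have h4 : (n : ℝ) * (2 * Real.log y) = n * (Real.log (σ₀ ^ 2) + Real.log (s ^ 2)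
      - Real.log (σ ^ 2) - Real.log (s₀ ^ 2)) := by rw [hlogy2]
    linear_combination hlogx + 2 * h3 - hlogx2 - h4
  refine le_trans ?_ hmain
  rw [mul_assoc]
  exact mul_le_mul_of_nonneg_left (normalized_sq_le hσ hσ₀ hs₀ hr₀
    ((sq_lt_one_iff_abs_lt_one _).mpr ha₀).le hγs hb) (Nat.cast_nonneg n)

/-- Squared distance of the scale-normalized parameters `(1, θ) / σ`. -/
def scaledDistSq (θ₀ : Theta) (v₀ : ℝ) (θ : Theta) (v : ℝ) : ℝ :=
  (1 / √v - 1 / √v₀) ^ 2 + ∑ i, (θ i / √v - θ₀ i / √v₀) ^ 2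

/-- The scaled distance is continuous and vanishes only at the true parameter: equal 1/σ forces
equal σ, and then equal θ. Compactness makes this quantitative. -/
theorem exists_le_scaledDistSq {Θθ : Set Theta} (hΘ : IsCompact Θθ) {vlo vhi : ℝ} (hvlo : 0 < vlo)
    (θ₀ : Theta) (hv₀ : 0 < v₀) {η : ℝ} (hη : 0 < η) :
    ∃ c > 0, ∀ θ ∈ Θθ, ∀ v ∈ Set.Icc vlo vhi, η ≤ dist (θ, v) (θ₀, v₀) →
      c ≤ scaledDistSq θ₀ v₀ θ v := by
  have hK : IsCompact ((Θθ ×ˢ Set.Icc vlo vhi) ∩ {p : Theta × ℝ | η ≤ dist p (θ₀, v₀)}) :=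
    (hΘ.prod isCompact_Icc).inter_right (isClosed_le continuous_const (by fun_prop))
  have hcont : ContinuousOn (fun p : Theta × ℝ => scaledDistSq θ₀ v₀ p.1 p.2)
      ((Θθ ×ˢ Set.Icc vlo vhi) ∩ {p : Theta × ℝ | η ≤ dist p (θ₀, v₀)}) := by
    have hne : ∀ p ∈ (Θθ ×ˢ Set.Icc vlo vhi) ∩ {p : Theta × ℝ | η ≤ dist p (θ₀, v₀)},
        √p.2 ≠ 0 := fun p hp => (Real.sqrt_pos.mpr (hvlo.trans_le hp.1.2.1)).ne'
    unfold scaledDistSq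
    fun_prop (disch := assumption)
  obtain ⟨c, hc, h⟩ := hK.exists_forall_le' hcont (a := 0) (by
    intro p hp
    have hp2 : 0 < √p.2 := Real.sqrt_pos.mpr (hvlo.trans_le hp.1.2.1)
    have hnn : ∀ i, 0 ≤ (p.1 i / √p.2 - θ₀ i / √v₀) ^ 2 := fun i => sq_nonneg _
    have hnns := Finset.sum_nonneg fun i (_ : i ∈ Finset.univ) => hnn i
    refine lt_of_le_of_ne (add_nonneg (sq_nonneg _) hnns) fun h0 => ?_
    obtain ⟨h1, h2⟩ := (add_eq_zero_iff_of_nonneg (sq_nonneg _) hnns).mp h0.symm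
    have h3 : √p.2 = √v₀ := by
      have := pow_eq_zero_iff two_ne_zero |>.mp h1
      rw [sub_eq_zero, one_div, one_div, inv_inj] at this
      exact this
    have h4 : p.1 = θ₀ := by
      ext i
      have := (Finset.sum_eq_zero_iff_of_nonneg fun i _ => hnn i).mp h2 i (Finset.mem_univ i)
      have := pow_eq_zero_iff two_ne_zero |>.mp this
      rw [sub_eq_zero, ← h3, div_left_inj' hp2.ne'] at this
      exact this
    have h5 : p.2 = v₀ := (Real.sqrt_inj (hvlo.trans_le hp.1.2.1).le hv₀.le).mp h3
    have h6 : η ≤ dist p (θ₀, v₀) := hp.2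
    rw [show p = (θ₀, v₀) from Prod.ext h4 h5, dist_self] at h6
    exact absurd h6 (not_le.mpr hη))
  exact ⟨c, hc, fun θ hθ v hv hd => h (θ, v) ⟨⟨hθ, hv⟩, hd⟩⟩

/-- Averaged over a centred spectrum, the divergence separates parameters. -/
theorem sum_divergence_ge {N : ℕ} {w : Fin N → ℝ} (hsum : ∑ l, w l = 0)
    (hs : ∀ l, sv θ (w l) ≠ 0) (ha : ∀ l, |rv θ (w l) / sv θ (w l)| < 1)
    (hs₀ : ∀ l, sv θ₀ (w l) ≠ 0) (ha₀ : ∀ l, |rv θ₀ (w l) / sv θ₀ (w l)| < 1)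
    (hpos : ∀ l, 0 < sv θ (w l) * sv θ₀ (w l)) (hv : 0 < v) (hv₀ : 0 < v₀)
    {b : ℝ} (hbpos : 0 < b) (hb : ∀ l, sv θ₀ (w l) ^ 2 ≤ b) {m : ℝ} (hm : m ≤ 1)
    (hm2 : N * m ≤ ∑ l, w l ^ 2) :
    N * (n * (v₀ / (3 * b)) * m * scaledDistSq θ₀ v₀ θ v)
      ≤ ∑ l, (logPart n θ v (w l) + v₀ / v * expForm n θ₀ θ (w l))
        - ∑ l, (logPart n θ₀ v₀ (w l) + v₀ / v₀ * expForm n θ₀ θ₀ (w l)) := by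
  rw [← Finset.sum_sub_distrib]
  refine le_trans ?_ (Finset.sum_le_sum fun l _ =>
    divergence_ge (hs l) (ha l) (hs₀ l) (ha₀ l) (hpos l) hv hv₀ (hb l))
  -- Expanded in powers of w. The linear term vanishes on summation because the spectrum is centred,
  -- and no mixed term between different parameters remains.
  have hterm : ∀ l, (sv θ (w l) / √v - sv θ₀ (w l) / √v₀) ^ 2
      + (rv θ (w l) / √v - rv θ₀ (w l) / √v₀) ^ 2
      = ((1 / √v - 1 / √v₀) ^ 2 + (θ 1 / √v - θ₀ 1 / √v₀) ^ 2)
        + (2 * ((θ 1 / √v - θ₀ 1 / √v₀) * (θ 2 / √v - θ₀ 2 / √v₀)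
          - (1 / √v - 1 / √v₀) * (θ 0 / √v - θ₀ 0 / √v₀))) * w l
        + ((θ 0 / √v - θ₀ 0 / √v₀) ^ 2 + (θ 2 / √v - θ₀ 2 / √v₀) ^ 2) * w l ^ 2 := fun l => by
    simp only [sv, rv]; ring
  rw [← Finset.mul_sum, Finset.sum_congr rfl fun l _ => hterm l, Finset.sum_add_distrib,
    Finset.sum_add_distrib, ← Finset.mul_sum, ← Finset.mul_sum, hsum, Finset.sum_const,
    Finset.card_univ, Fintype.card_fin, nsmul_eq_mul, mul_zero, add_zero, scaledDistSq,
    Fin.sum_univ_three]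
  have hk : 0 ≤ (n : ℝ) * (v₀ / (3 * b)) := by positivity
  have h1 := mul_le_mul_of_nonneg_left hm2 (add_nonneg (sq_nonneg (θ 0 / √v - θ₀ 0 / √v₀))
    (sq_nonneg (θ 2 / √v - θ₀ 2 / √v₀)))
  have h2 := mul_le_mul_of_nonneg_left hm (mul_nonneg (Nat.cast_nonneg (α := ℝ) N)
    (add_nonneg (sq_nonneg (1 / √v - 1 / √v₀)) (sq_nonneg (θ 1 / √v - θ₀ 1 / √v₀))))
  refine le_of_eq_of_le ?_ (mul_le_mul_of_nonneg_left (add_le_add h2 h1) hk |>.trans_eq ?_)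
  · ring
  · ring

end Divergence

/-! ### The criterion and its mean in spectral coordinates -/

section Criterion

variable {N : ℕ} {O : Matrix (Fin N) (Fin N) ℝ} {w : Fin N → ℝ} {W : Matrix (Fin N) (Fin N) ℝ}
  {n k : ℕ}

/-- The bilinear form of the precision matrix in spectral coordinates. -/
def specForm (n : ℕ) (w : Fin N → ℝ) (θ : Theta) (x y : Fin N → Fin (n + 1) → ℝ) : ℝ :=
  ∑ l, x l ⬝ᵥ (precMat (n + 1) θ (w l) *ᵥ y l)

/-- Cross moment of two families in spectral coordinates, weighted by a power of the spectrum. -/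
def specMoment (w : Fin N → ℝ) (x y : Fin N → Fin (n + 1) → ℝ)
    (p : Fin (n + 1) × Fin (n + 1) × Fin 3) : ℝ :=
  ∑ l, w l ^ (p.2.2 : ℕ) * (x l p.1 * y l p.2.1)

/-- The parameter enters only through finitely many coefficients and the data only through finitely
many moments, whatever N is. -/
theorem specForm_eq_sum {θ : Theta} (hs : ∀ l, sv θ (w l) ≠ 0) (x y : Fin N → Fin (n + 1) → ℝ) :
    specForm n w θ x y
      = ∑ p : Fin (n + 1) × Fin (n + 1) × Fin 3,
          precCoef θ p.1 p.2.1 p.2.2 * specMoment w x y p := by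
  simp only [specForm, specMoment, Finset.mul_sum, Fintype.sum_prod_type, dotProduct, Matrix.mulVec]
  rw [Finset.sum_comm]
  refine Finset.sum_congr rfl fun t _ => ?_
  rw [Finset.sum_comm]
  refine Finset.sum_congr rfl fun s _ => ?_
  rw [Finset.sum_comm (s := Finset.univ (α := Fin 3))]
  refine Finset.sum_congr rfl fun l _ => ?_
  rw [precMat_apply (hs l), Finset.sum_mul, Finset.mul_sum]
  exact Finset.sum_congr rfl fun q _ => by ring

theorem specForm_add {θ : Theta} (hs : ∀ l, sv θ (w l) ≠ 0) (x y : Fin N → Fin (n + 1) → ℝ) :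
    specForm n w θ (x + y) (x + y)
      = specForm n w θ x x + 2 * specForm n w θ x y + specForm n w θ y y := by
  simp only [specForm, Finset.mul_sum, ← Finset.sum_add_distrib]
  refine Finset.sum_congr rfl fun l _ => ?_
  have h : y l ⬝ᵥ (precMat (n + 1) θ (w l) *ᵥ x l) = x l ⬝ᵥ (precMat (n + 1) θ (w l) *ᵥ y l) := by
    simp only [precMat_bilin (hs l), mul_comm]
  rw [Pi.add_apply, Matrix.mulVec_add, add_dotProduct, dotProduct_add, dotProduct_add, h]
  ring

theorem specForm_nonneg {θ : Theta} (hs : ∀ l, sv θ (w l) ≠ 0)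
    (ha : ∀ l, |rv θ (w l) / sv θ (w l)| < 1) (x : Fin N → Fin (n + 1) → ℝ) :
    0 ≤ specForm n w θ x x :=
  Finset.sum_nonneg fun l _ => precMat_form_nonneg (hs l) (ha l) _

/-- The observed error process in spectral coordinates. -/
def eigPath {Ω : Type*} (n : ℕ) (O : Matrix (Fin N) (Fin N) ℝ) (U : ℤ → Ω → Fin N → ℝ) (ω : Ω)
    (l : Fin N) (t : Fin (n + 1)) : ℝ :=
  eigProc O U l ((t : ℕ) + 1) ω

theorem neg_two_mul_logLik_response (hD : Diagonalizes O w W) {Ω : Type*}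
    (X : Matrix (Fin (n + 1) × Fin N) (Fin k) ℝ) (β₀ : Fin k → ℝ) (U : ℤ → Ω → Fin N → ℝ) (ω : Ω)
    {δ : Param k} (hv : 0 < δ.2.2) (hs : ∀ l, sv δ.2.1 (w l) ≠ 0)
    (ha : ∀ l, |rv δ.2.1 (w l) / sv δ.2.1 (w l)| < 1) :
    -2 * logLik W X (response X β₀ U ω) δ = N * ((n + 1) * Real.log (2 * Real.pi))
      + ∑ l, logPart n δ.2.1 δ.2.2 (w l)
      + 1 / δ.2.2 * (specForm n w δ.2.1 (rot O (X *ᵥ (β₀ - δ.1))) (rot O (X *ᵥ (β₀ - δ.1)))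
        + 2 * specForm n w δ.2.1 (rot O (X *ᵥ (β₀ - δ.1))) (eigPath n O U ω)
        + specForm n w δ.2.1 (eigPath n O U ω) (eigPath n O U ω)) := by
  have h : rot O (response X β₀ U ω - X *ᵥ δ.1) = rot O (X *ᵥ (β₀ - δ.1)) + eigPath n O U ω := by
    have : response X β₀ U ω - X *ᵥ δ.1
        = X *ᵥ (β₀ - δ.1) + fun p => U ((p.1 : ℕ) + 1 : ℤ) ω p.2 := by
      rw [response, Matrix.mulVec_sub]; abel
    rw [this]
    ext l t
    simp only [rot, Pi.add_apply, mul_add, Finset.sum_add_distrib, eigPath, eigProc]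
  rw [neg_two_mul_logLik hD X _ hv hs ha, h, ← specForm_add hs]
  rfl

/-- The expectation of `-2 log L`. -/
def meanCrit (n : ℕ) (O : Matrix (Fin N) (Fin N) ℝ) (w : Fin N → ℝ)
    (X : Matrix (Fin (n + 1) × Fin N) (Fin k) ℝ) (δ₀ δ : Param k) : ℝ :=
  N * ((n + 1) * Real.log (2 * Real.pi))
    + ∑ l, (logPart n δ.2.1 δ.2.2 (w l) + δ₀.2.2 / δ.2.2 * expForm n δ₀.2.1 δ.2.1 (w l))
    + 1 / δ.2.2 * specForm n w δ.2.1 (rot O (X *ᵥ (δ₀.1 - δ.1))) (rot O (X *ᵥ (δ₀.1 - δ.1)))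

variable {Ω : Type*} [MeasurableSpace Ω] {P : Measure Ω} [IsProbabilityMeasure P]
  {v : ℕ → ℤ → Ω → ℝ} {δ₀ : Param k} {U : ℤ → Ω → Fin N → ℝ}

theorem hasMean_specForm_eigPath (hD : Diagonalizes O w W) (hU : IsErrorProcess P W δ₀.2.1 v U)
    (hv : IIDInnovations P v δ₀.2.2) (hs₀ : ∀ l, sv δ₀.2.1 (w l) ≠ 0)
    (ha₀ : ∀ l, |rv δ₀.2.1 (w l) / sv δ₀.2.1 (w l)| < 1) {θ : Theta} (hs : ∀ l, sv θ (w l) ≠ 0) :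
    HasMean P (fun ω => specForm n w θ (eigPath n O U ω) (eigPath n O U ω))
      (∑ l, δ₀.2.2 * expForm n δ₀.2.1 θ (w l)) :=
  HasMean.sum fun l _ => hasMean_precMat_form hD hU hv hs₀ ha₀ l (hs l)

theorem hasMean_specMoment_left (hD : Diagonalizes O w W) (hU : IsErrorProcess P W δ₀.2.1 v U)
    (hv : IIDInnovations P v δ₀.2.2) (hs₀ : ∀ l, sv δ₀.2.1 (w l) ≠ 0)
    (ha₀ : ∀ l, |rv δ₀.2.1 (w l) / sv δ₀.2.1 (w l)| < 1) (x : Fin N → Fin (n + 1) → ℝ)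
    (p : Fin (n + 1) × Fin (n + 1) × Fin 3) :
    HasMean P (fun ω => specMoment w x (eigPath n O U ω) p) 0 :=
  (HasMean.sum (s := Finset.univ) fun (l : Fin N) _ =>
    (hasMean_eigProc hD hU hv hs₀ ha₀ l ((p.2.1 : ℕ) + 1)).const_mul
      (w l ^ (p.2.2 : ℕ) * x l p.1)).of_eq
    (fun ω => Finset.sum_congr rfl fun l _ => by rw [eigPath]; ring) (by simp)

theorem hasMean_neg_two_mul_logLik (hD : Diagonalizes O w W)
    (hU : IsErrorProcess P W δ₀.2.1 v U)
    (hv : IIDInnovations P v δ₀.2.2) (hs₀ : ∀ l, sv δ₀.2.1 (w l) ≠ 0)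
    (ha₀ : ∀ l, |rv δ₀.2.1 (w l) / sv δ₀.2.1 (w l)| < 1)
    (X : Matrix (Fin (n + 1) × Fin N) (Fin k) ℝ) {δ : Param k} (hδ : 0 < δ.2.2)
    (hs : ∀ l, sv δ.2.1 (w l) ≠ 0) (ha : ∀ l, |rv δ.2.1 (w l) / sv δ.2.1 (w l)| < 1) :
    HasMean P (fun ω => -2 * logLik W X (response X δ₀.1 U ω) δ) (meanCrit n O w X δ₀ δ) := by
  have h1 : HasMean P (fun ω => specForm n w δ.2.1 (rot O (X *ᵥ (δ₀.1 - δ.1))) (eigPath n O U ω))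
      0 :=
    (HasMean.sum (s := Finset.univ) fun p _ => (hasMean_specMoment_left hD hU hv hs₀ ha₀
      (rot O (X *ᵥ (δ₀.1 - δ.1))) p).const_mul (precCoef δ.2.1 p.1 p.2.1 p.2.2)).of_eq
      (fun ω => (specForm_eq_sum hs _ _).symm) (by simp)
  have h2 := hasMean_specForm_eigPath (n := n) hD hU hv hs₀ ha₀ hs
  have h3 := (((hasMean_const (P := P) (specForm n w δ.2.1 (rot O (X *ᵥ (δ₀.1 - δ.1)))
    (rot O (X *ᵥ (δ₀.1 - δ.1))))).add (h1.const_mul 2)).add h2).const_mul (1 / δ.2.2)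
  refine ((hasMean_const (N * ((n + 1) * Real.log (2 * Real.pi))
      + ∑ l, logPart n δ.2.1 δ.2.2 (w l))).add h3).of_eq
    (fun ω => (neg_two_mul_logLik_response hD X δ₀.1 U ω hδ hs ha).symm) ?_
  rw [meanCrit, Finset.sum_add_distrib, ← Finset.mul_sum, ← Finset.mul_sum]
  ring

/-- The deviation of `-2 log L` from its mean is a combination of finitely many centred moments
whose coefficients depend on the parameter. -/
theorem neg_two_mul_logLik_sub_meanCrit (hD : Diagonalizes O w W)
    (hU : IsErrorProcess P W δ₀.2.1 v U)
    (hv : IIDInnovations P v δ₀.2.2) (hs₀ : ∀ l, sv δ₀.2.1 (w l) ≠ 0)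
    (ha₀ : ∀ l, |rv δ₀.2.1 (w l) / sv δ₀.2.1 (w l)| < 1)
    (X : Matrix (Fin (n + 1) × Fin N) (Fin k) ℝ) {δ : Param k} (hδ : 0 < δ.2.2)
    (hs : ∀ l, sv δ.2.1 (w l) ≠ 0) (ha : ∀ l, |rv δ.2.1 (w l) / sv δ.2.1 (w l)| < 1) (ω : Ω) :
    -2 * logLik W X (response X δ₀.1 U ω) δ - meanCrit n O w X δ₀ δ
      = 1 / δ.2.2 * ∑ p : Fin (n + 1) × Fin (n + 1) × Fin 3, precCoef δ.2.1 p.1 p.2.1 p.2.2 *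
        ((specMoment w (eigPath n O U ω) (eigPath n O U ω) p
            - ∫ ω', specMoment w (eigPath n O U ω') (eigPath n O U ω') p ∂P)
          + 2 * ∑ j, (δ₀.1 j - δ.1 j) *
            specMoment w (rot O fun i => X i j) (eigPath n O U ω) p) := by
  have hint : ∀ p, Integrable
      (fun ω => specMoment w (eigPath n O U ω) (eigPath n O U ω) p) P := fun p =>
    integrable_finsetSum _ fun l _ => (integrable_eigProc_mul hU l l _ _).const_mul _
  have h1 : ∑ l, δ₀.2.2 * expForm n δ₀.2.1 δ.2.1 (w l)
      = ∑ p : Fin (n + 1) × Fin (n + 1) × Fin 3, precCoef δ.2.1 p.1 p.2.1 p.2.2 *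
        ∫ ω', specMoment w (eigPath n O U ω') (eigPath n O U ω') p ∂P :=
    (hasMean_specForm_eigPath hD hU hv hs₀ ha₀ hs).unique
      ((HasMean.sum (s := Finset.univ) fun p _ => HasMean.const_mul
        (precCoef δ.2.1 p.1 p.2.1 p.2.2) ⟨hint p, rfl⟩).of_eq
        (fun ω => (specForm_eq_sum hs _ _).symm) rfl)
  have h2 : ∀ p, specMoment w (rot O (X *ᵥ (δ₀.1 - δ.1))) (eigPath n O U ω) p
      = ∑ j, (δ₀.1 j - δ.1 j) * specMoment w (rot O fun i => X i j) (eigPath n O U ω) p := by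
    intro p
    have : ∀ l t, rot O (X *ᵥ (δ₀.1 - δ.1)) l t
        = ∑ j, (δ₀.1 j - δ.1 j) * rot O (fun i => X i j) l t := by
      intro l t
      simp only [rot, Matrix.mulVec, dotProduct, Finset.mul_sum, Pi.sub_apply]
      rw [Finset.sum_comm]
      exact Finset.sum_congr rfl fun j _ => Finset.sum_congr rfl fun i _ => by ring
    simp only [specMoment, this, Finset.mul_sum, Finset.sum_mul]
    rw [Finset.sum_comm]
    exact Finset.sum_congr rfl fun j _ => Finset.sum_congr rfl fun i _ => by ring
  rw [neg_two_mul_logLik_response hD X δ₀.1 U ω hδ hs ha, meanCrit, Finset.sum_add_distrib,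
    specForm_eq_sum hs _ (eigPath n O U ω), specForm_eq_sum hs (eigPath n O U ω)]
  have h3 : ∑ l, δ₀.2.2 / δ.2.2 * expForm n δ₀.2.1 δ.2.1 (w l)
      = 1 / δ.2.2 * ∑ l, δ₀.2.2 * expForm n δ₀.2.1 δ.2.1 (w l) := by
    rw [Finset.mul_sum]; exact Finset.sum_congr rfl fun l _ => by ring
  rw [h3, h1]
  simp only [h2, mul_add, mul_sub, Finset.sum_add_distrib, Finset.sum_sub_distrib,
    mul_left_comm _ (2 : ℝ), ← Finset.mul_sum]
  ring

end Criterion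

/-! ### Bounds for the regression part -/

section Design

variable {N : ℕ} {O : Matrix (Fin N) (Fin N) ℝ} {w : Fin N → ℝ} {W : Matrix (Fin N) (Fin N) ℝ}
  {n k : ℕ}

theorem abs_pow_le_sq {M x : ℝ} (hM : 1 ≤ M) (hx : |x| ≤ M) (q : Fin 3) :
    |x ^ (q : ℕ)| ≤ M ^ 2 := by
  rw [abs_pow]
  exact (pow_le_pow_left₀ (abs_nonneg _) hx _).trans
    (pow_le_pow_right₀ hM (Nat.lt_succ_iff.mp q.2))

theorem abs_specMoment_self_le {M : ℝ} (hM : 1 ≤ M) (hw : ∀ l, |w l| ≤ M)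
    {x : Fin N → Fin (n + 1) → ℝ} {C : ℝ} (hx : ∀ t, ∑ l, x l t ^ 2 ≤ C)
    (p : Fin (n + 1) × Fin (n + 1) × Fin 3) : |specMoment w x x p| ≤ M ^ 2 * C := by
  have h : |specMoment w x x p| ≤ ∑ l, M ^ 2 * ((x l p.1 ^ 2 + x l p.2.1 ^ 2) / 2) := by
    refine (Finset.abs_sum_le_sum_abs _ _).trans (Finset.sum_le_sum fun l _ => ?_)
    rw [abs_mul]
    refine mul_le_mul (abs_pow_le_sq hM (hw l) _) ?_ (abs_nonneg _) (by positivity)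
    rw [abs_le]
    constructor <;> nlinarith [sq_nonneg (x l p.1 - x l p.2.1), sq_nonneg (x l p.1 + x l p.2.1)]
  refine h.trans ?_
  rw [← Finset.mul_sum, ← Finset.sum_div, Finset.sum_add_distrib]
  have := hx p.1
  have := hx p.2.1
  gcongr
  linarith

theorem sum_rot_mulVec_sq_le (hO : O * Oᵀ = 1) {X : Matrix (Fin (n + 1) × Fin N) (Fin k) ℝ} {C : ℝ}
    (hX : ∀ p j, |X p j| ≤ C) (b : Fin k → ℝ) (t : Fin (n + 1)) :
    ∑ l, rot O (X *ᵥ b) l t ^ 2 ≤ N * (k * C) ^ 2 * ‖b‖ ^ 2 := by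
  rw [sum_rot_sq hO]
  have h : ∀ i : Fin N, (X *ᵥ b) (t, i) ^ 2 ≤ (k * C) ^ 2 * ‖b‖ ^ 2 := by
    intro i
    rw [← mul_pow, ← sq_abs]
    refine pow_le_pow_left₀ (abs_nonneg _) ?_ 2
    rw [Matrix.mulVec, dotProduct]
    refine (Finset.abs_sum_le_sum_abs _ _).trans ((Finset.sum_le_card_nsmul _ _ (C * ‖b‖)
      fun j _ => ?_).trans_eq ?_)
    · rw [abs_mul]
      exact mul_le_mul (hX _ _) (norm_le_pi_norm b j) (abs_nonneg _)
        ((abs_nonneg _).trans (hX (t, i) j))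
    · simp [mul_assoc]
  refine (Finset.sum_le_card_nsmul _ _ _ fun i _ => h i).trans_eq ?_
  simp [mul_assoc]

theorem dotProduct_design_mulVec (hD : Diagonalizes O w W)
    (X : Matrix (Fin (n + 1) × Fin N) (Fin k) ℝ) {θ : Theta} (hs : ∀ l, sv θ (w l) ≠ 0)
    (ha : ∀ l, |rv θ (w l) / sv θ (w l)| < 1) (b : Fin k → ℝ) :
    b ⬝ᵥ ((Xᵀ * Prec (n + 1) W θ * X) *ᵥ b)
      = specForm n w θ (rot O (X *ᵥ b)) (rot O (X *ᵥ b)) := by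
  rw [specForm, ← dotProduct_specBlock_mulVec, ← Prec_eq hD _ hs ha, ← Matrix.mulVec_mulVec,
    ← Matrix.mulVec_mulVec, Matrix.dotProduct_mulVec, Matrix.vecMul_transpose]

theorem exists_mul_norm_sq_le {L : Matrix (Fin k) (Fin k) ℝ} (hL : L.PosDef) :
    ∃ c > 0, ∀ b : Fin k → ℝ, c * ‖b‖ ^ 2 ≤ b ⬝ᵥ (L *ᵥ b) := by
  obtain ⟨c, hc, h⟩ := (isCompact_sphere (0 : Fin k → ℝ) 1).exists_forall_le'
    (f := fun b => b ⬝ᵥ (L *ᵥ b)) (a := 0) (by fun_prop) fun b hb => by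
      have hb0 : b ≠ 0 := by
        rintro rfl
        simp at hb
      simpa using hL.dotProduct_mulVec_pos hb0
  refine ⟨c, hc, fun b => ?_⟩
  rcases eq_or_ne b 0 with rfl | hb
  · simp
  have hb' := norm_pos_iff.mpr hb
  have h1 := h (‖b‖⁻¹ • b) (by simp [norm_smul, hb'.ne'])
  simp only [Matrix.mulVec_smul, dotProduct_smul, smul_dotProduct, smul_eq_mul] at h1
  have h2 := mul_le_mul_of_nonneg_right h1 (sq_nonneg ‖b‖)
  refine h2.trans_eq ?_
  field_simp

theorem abs_dotProduct_mulVec_le_norm_sq (G : Matrix (Fin k) (Fin k) ℝ) (b : Fin k → ℝ) :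
    |b ⬝ᵥ (G *ᵥ b)| ≤ (∑ i, ∑ j, |G i j|) * ‖b‖ ^ 2 := by
  simp only [dotProduct, Matrix.mulVec, Finset.mul_sum, Finset.sum_mul]
  refine (Finset.abs_sum_le_sum_abs _ _).trans (Finset.sum_le_sum fun i _ =>
    (Finset.abs_sum_le_sum_abs _ _).trans (Finset.sum_le_sum fun j _ => ?_))
  rw [abs_mul, abs_mul, show |G i j| * ‖b‖ ^ 2 = ‖b‖ * (|G i j| * ‖b‖) by ring]
  gcongr
  · exact norm_le_pi_norm b i
  · exact norm_le_pi_norm b j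

end Design

/-! ### Positive definiteness of the design near the true parameter -/

section Identification

variable {N : ℕ → ℕ} {O : ∀ m, Matrix (Fin (N m)) (Fin (N m)) ℝ} {w : ∀ m, Fin (N m) → ℝ}
  {W : ∀ m, Matrix (Fin (N m)) (Fin (N m)) ℝ} {n k : ℕ}
  {X : ∀ m, Matrix (Fin (n + 1) × Fin (N m)) (Fin k) ℝ}

/-- A limit of positive semidefinite matrices is positive semidefinite, and nonsingularity upgrades
it. -/
theorem posDef_design_limit (hD : ∀ m, Diagonalizes (O m) (w m) (W m)) {θ : Theta}
    (hs : ∀ m l, sv θ (w m l) ≠ 0) (ha : ∀ m l, |rv θ (w m l) / sv θ (w m l)| < 1)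
    {L : Matrix (Fin k) (Fin k) ℝ}
    (hlim : Tendsto (fun m => (1 / (N m : ℝ)) • ((X m)ᵀ * Prec (n + 1) (W m) θ * X m)) atTop (𝓝 L))
    (hL : IsUnit L.det) : L.PosDef := by
  have hpsd : L.PosSemidef := by
    refine Matrix.PosSemidef.of_dotProduct_mulVec_nonneg ?_ fun b => ?_
    · have h1 := ((continuous_id.matrix_conjTranspose).tendsto L).comp hlim
      refine tendsto_nhds_unique (h1.congr fun m => ?_) hlim
      obtain ⟨G, hG⟩ := Prec_eq_transpose_mul (hD m) (n + 1) (hs m) (ha m)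
      simp [hG, Matrix.conjTranspose_eq_transpose_of_trivial,
        Matrix.transpose_mul, Matrix.mul_assoc]
    · have h1 : Tendsto (fun m => b ⬝ᵥ (((1 / (N m : ℝ)) •
          ((X m)ᵀ * Prec (n + 1) (W m) θ * X m)) *ᵥ b)) atTop (𝓝 (b ⬝ᵥ (L *ᵥ b))) :=
        ((show Continuous fun G : Matrix (Fin k) (Fin k) ℝ => b ⬝ᵥ (G *ᵥ b) by
          fun_prop).tendsto L).comp hlim
      simp only [star_trivial]
      refine ge_of_tendsto' h1 fun m => ?_
      rw [Matrix.smul_mulVec, dotProduct_smul, dotProduct_design_mulVec (hD m) _ (hs m) (ha m)]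
      exact smul_nonneg (by positivity) (specForm_nonneg (hs m) (ha m) _)
  exact hpsd.posDef_iff_isUnit.mpr ((Matrix.isUnit_iff_isUnit_det _).mpr hL)

/-- The normalized design is bounded below near the true parameter. -/
theorem exists_design_lower_bound (hD : ∀ m, Diagonalizes (O m) (w m) (W m)) {Θθ : Set Theta}
    {θ₀ : Theta} (hθ₀ : θ₀ ∈ Θθ) (hN : ∀ m, 0 < N m)
    (hs : ∀ m, ∀ θ ∈ Θθ, ∀ l, sv θ (w m l) ≠ 0)
    (ha : ∀ m, ∀ θ ∈ Θθ, ∀ l, |rv θ (w m l) / sv θ (w m l)| < 1)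
    {M : ℝ} (hM : 1 ≤ M) (hw : ∀ m l, |w m l| ≤ M) {C : ℝ} (hX : ∀ m p j, |X m p j| ≤ C)
    {L : Matrix (Fin k) (Fin k) ℝ}
    (hlim : Tendsto (fun m => (1 / (N m : ℝ)) • ((X m)ᵀ * Prec (n + 1) (W m) θ₀ * X m))
      atTop (𝓝 L))
    (hL : IsUnit L.det) :
    ∃ c > 0, ∃ η > 0, ∀ᶠ m in atTop, ∀ θ ∈ Θθ, dist θ θ₀ < η → ∀ b : Fin k → ℝ,
      N m * (c * ‖b‖ ^ 2) ≤ specForm n (w m) θ (rot (O m) (X m *ᵥ b)) (rot (O m) (X m *ᵥ b)) := by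
  obtain ⟨c, hc, hcL⟩ := exists_mul_norm_sq_le
    (posDef_design_limit hD (fun m => hs m θ₀ hθ₀) (fun m => ha m θ₀ hθ₀) hlim hL)
  have hcoef : Continuous fun θ : Theta => ∑ p : Fin (n + 1) × Fin (n + 1) × Fin 3,
      |precCoef θ p.1 p.2.1 p.2.2 - precCoef θ₀ p.1 p.2.1 p.2.2| * (M ^ 2 * (k * C) ^ 2) := by
    refine continuous_finsetSum _ fun p _ => ?_
    exact (((continuous_precCoef _ _ _).sub continuous_const).abs).mul continuous_const
  -- A quarter of c is spent on moving from θ₀ to θ and another quarter on replacing the limit by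
  -- finite m, leaving c / 2.
  obtain ⟨η, hη, hηc⟩ := Metric.eventually_nhds_iff.mp (hcoef.continuousAt.eventually_lt
    (continuousAt_const (y := c / 4)) (x₀ := θ₀) (by simpa using by positivity))
  have hGlim : ∀ᶠ m in atTop, ∑ i, ∑ j,
      |((1 / (N m : ℝ)) • ((X m)ᵀ * Prec (n + 1) (W m) θ₀ * X m) - L) i j| < c / 4 := by
    have hcont : Continuous fun G : Matrix (Fin k) (Fin k) ℝ => ∑ i, ∑ j, |(G - L) i j| := by
      refine continuous_finsetSum _ fun i _ => continuous_finsetSum _ fun j _ => ?_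
      exact ((continuous_id.sub continuous_const).matrix_elem i j).abs
    refine (hcont.tendsto L).comp hlim |>.eventually_lt_const ?_
    simpa using by positivity
  refine ⟨c / 2, by positivity, η, hη, hGlim.mono fun m hm θ hθ hdist b => ?_⟩
  have hNm : (0 : ℝ) < N m := by exact_mod_cast hN m
  set x := rot (O m) (X m *ᵥ b) with hx
  have h1 : N m * ((c - c / 4) * ‖b‖ ^ 2) ≤ specForm n (w m) θ₀ x x := by
    have h2 := hcL b
    have h3 := abs_dotProduct_mulVec_le_norm_sq
      ((1 / (N m : ℝ)) • ((X m)ᵀ * Prec (n + 1) (W m) θ₀ * X m) - L) b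
    rw [Matrix.sub_mulVec, dotProduct_sub, Matrix.smul_mulVec, dotProduct_smul,
      dotProduct_design_mulVec (hD m) _ (hs m θ₀ hθ₀) (ha m θ₀ hθ₀), smul_eq_mul, ← hx] at h3
    have h4 := h3.trans (mul_le_mul_of_nonneg_right hm.le (sq_nonneg _))
    have h5 := (abs_le.mp h4).1
    have h6 : (c - c / 4) * ‖b‖ ^ 2 ≤ 1 / (N m : ℝ) * specForm n (w m) θ₀ x x := by linarith
    have h7 := mul_le_mul_of_nonneg_left h6 hNm.le
    rwa [← mul_assoc (N m : ℝ) (1 / _), mul_one_div_cancel hNm.ne', one_mul] at h7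
  have h2 : |specForm n (w m) θ x x - specForm n (w m) θ₀ x x| ≤ N m * (c / 4 * ‖b‖ ^ 2) := by
    rw [specForm_eq_sum (hs m θ hθ), specForm_eq_sum (hs m θ₀ hθ₀), ← Finset.sum_sub_distrib]
    have hmom := abs_specMoment_self_le hM (hw m)
      (sum_rot_mulVec_sq_le (hD m).right (hX m) b)
    calc _ ≤ ∑ p : Fin (n + 1) × Fin (n + 1) × Fin 3,
          |precCoef θ p.1 p.2.1 p.2.2 - precCoef θ₀ p.1 p.2.1 p.2.2|
            * (M ^ 2 * (N m * (k * C) ^ 2 * ‖b‖ ^ 2)) := by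
          refine (Finset.abs_sum_le_sum_abs _ _).trans (Finset.sum_le_sum fun p _ => ?_)
          rw [← sub_mul, abs_mul]
          exact mul_le_mul_of_nonneg_left (hmom p) (abs_nonneg _)
      _ = N m * ((∑ p : Fin (n + 1) × Fin (n + 1) × Fin 3,
          |precCoef θ p.1 p.2.1 p.2.2 - precCoef θ₀ p.1 p.2.1 p.2.2| * (M ^ 2 * (k * C) ^ 2))
            * ‖b‖ ^ 2) := by
          rw [Finset.sum_mul, Finset.mul_sum]
          exact Finset.sum_congr rfl fun p _ => by ring
      _ ≤ _ := by
          have := (hηc hdist).le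
          gcongr
  have h3 := (abs_le.mp h2).1
  linarith

end Identification

/-! ### Uniform separation by the expected criterion -/

section Identification

theorem sum_eigenvalues_eq_zero {N : ℕ} {O : Matrix (Fin N) (Fin N) ℝ} {w : Fin N → ℝ}
    {W : Matrix (Fin N) (Fin N) ℝ} (hD : Diagonalizes O w W) (hdiag : ∀ i, W i i = 0) :
    ∑ l, w l = 0 := by
  rw [← specMat_trace hD.left w, ← hD.eq, Matrix.trace]
  simp [hdiag]

theorem sv_sq_le {θ : Theta} {M w : ℝ} (hw : |w| ≤ M) : sv θ w ^ 2 ≤ (1 + |θ 0| * M) ^ 2 := by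
  rw [sv, ← sq_abs]
  refine pow_le_pow_left₀ (abs_nonneg _) ((abs_sub _ _).trans ?_) 2
  rw [abs_one, abs_mul]
  gcongr

theorem meanCrit_sub {N n k : ℕ} {O : Matrix (Fin N) (Fin N) ℝ} {w : Fin N → ℝ}
    (X : Matrix (Fin (n + 1) × Fin N) (Fin k) ℝ) (δ₀ δ : Param k) :
    meanCrit n O w X δ₀ δ - meanCrit n O w X δ₀ δ₀
      = (∑ l, (logPart n δ.2.1 δ.2.2 (w l) + δ₀.2.2 / δ.2.2 * expForm n δ₀.2.1 δ.2.1 (w l))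
        - ∑ l, (logPart n δ₀.2.1 δ₀.2.2 (w l)
          + δ₀.2.2 / δ₀.2.2 * expForm n δ₀.2.1 δ₀.2.1 (w l)))
        + 1 / δ.2.2 *
          specForm n w δ.2.1 (rot O (X *ᵥ (δ₀.1 - δ.1))) (rot O (X *ᵥ (δ₀.1 - δ.1))) := by
  have h : ∀ θ, specForm n w θ (rot O (X *ᵥ (δ₀.1 - δ₀.1))) (rot O (X *ᵥ (δ₀.1 - δ₀.1))) = 0 := by
    intro θ
    have : rot O (X *ᵥ (δ₀.1 - δ₀.1)) = 0 := by ext; simp [rot]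
    rw [this]; simp [specForm]
  rw [meanCrit, meanCrit, h]
  ring

variable {N : ℕ → ℕ} {O : ∀ m, Matrix (Fin (N m)) (Fin (N m)) ℝ} {w : ∀ m, Fin (N m) → ℝ}
  {W : ∀ m, Matrix (Fin (N m)) (Fin (N m)) ℝ} {n k : ℕ}
  {X : ∀ m, Matrix (Fin (n + 1) × Fin (N m)) (Fin k) ℝ}
  {Θβ : Set (Fin k → ℝ)} {Θθ : Set Theta} {vlo vhi : ℝ} {δ₀ : Param k}

/-- The divergence bound with second-moment constant m = 0, which needs no lower bound on the
spectrum and so holds for every N. -/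
theorem meanCrit_le {N : ℕ} {O : Matrix (Fin N) (Fin N) ℝ} {w : Fin N → ℝ}
    {X : Matrix (Fin (n + 1) × Fin N) (Fin k) ℝ} {δ : Param k} (hsum : ∑ l, w l = 0)
    (hs : ∀ l, sv δ.2.1 (w l) ≠ 0) (ha : ∀ l, |rv δ.2.1 (w l) / sv δ.2.1 (w l)| < 1)
    (hs₀ : ∀ l, sv δ₀.2.1 (w l) ≠ 0) (ha₀ : ∀ l, |rv δ₀.2.1 (w l) / sv δ₀.2.1 (w l)| < 1)
    (hpos : ∀ l, 0 < sv δ.2.1 (w l) * sv δ₀.2.1 (w l)) (hv : 0 < δ.2.2) (hv₀ : 0 < δ₀.2.2)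
    {M : ℝ} (hM : 0 ≤ M) (hw : ∀ l, |w l| ≤ M) :
    meanCrit n O w X δ₀ δ₀ ≤ meanCrit n O w X δ₀ δ := by
  rw [← sub_nonneg, meanCrit_sub]
  refine add_nonneg ?_ (mul_nonneg (by positivity) (specForm_nonneg hs ha _))
  have h := sum_divergence_ge (n := n) hsum hs ha hs₀ ha₀ hpos hv hv₀
    (b := (1 + |δ₀.2.1 0| * M) ^ 2) (by positivity) (fun l => sv_sq_le (hw l)) zero_le_one
    (by simpa using Finset.sum_nonneg fun l _ => sq_nonneg (w l))
  simpa using h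

/-- The expected criterion separates the true parameter uniformly. -/
theorem exists_meanCrit_separation (hD : ∀ m, Diagonalizes (O m) (w m) (W m))
    (hn : 0 < n) (hN : ∀ m, 0 < N m) (hsum : ∀ m, ∑ l, w m l = 0) (hΘθ : IsCompact Θθ)
    (hvlo : 0 < vlo) (hδ₀ : δ₀ ∈ Θβ ×ˢ Θθ ×ˢ Set.Icc vlo vhi)
    (hs : ∀ m, ∀ θ ∈ Θθ, ∀ l, sv θ (w m l) ≠ 0)
    (ha : ∀ m, ∀ θ ∈ Θθ, ∀ l, |rv θ (w m l) / sv θ (w m l)| < 1)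
    (hpos : ∀ m, ∀ θ ∈ Θθ, ∀ l, 0 < sv θ (w m l) * sv δ₀.2.1 (w m l))
    {M : ℝ} (hM : 1 ≤ M) (hw : ∀ m l, |w m l| ≤ M) {C : ℝ} (hX : ∀ m p j, |X m p j| ≤ C)
    {L : Matrix (Fin k) (Fin k) ℝ}
    (hlim : Tendsto (fun m => (1 / (N m : ℝ)) • ((X m)ᵀ * Prec (n + 1) (W m) δ₀.2.1 * X m))
      atTop (𝓝 L))
    (hL : IsUnit L.det) (hm2 : ∃ c > 0, ∀ᶠ m in atTop, c ≤ 1 / (N m : ℝ) * ∑ l, w m l ^ 2)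
    {ε : ℝ} (hε : 0 < ε) :
    ∃ c > 0, ∀ᶠ m in atTop, ∀ δ ∈ Θβ ×ˢ Θθ ×ˢ Set.Icc vlo vhi, ε ≤ dist δ δ₀ →
      N m * c ≤ meanCrit n (O m) (w m) (X m) δ₀ δ - meanCrit n (O m) (w m) (X m) δ₀ δ₀ := by
  obtain ⟨-, hθ₀, hv₀⟩ := hδ₀
  have hv₀pos : 0 < δ₀.2.2 := hvlo.trans_le hv₀.1
  obtain ⟨c₁, hc₁, η, hη, hdesign⟩ := exists_design_lower_bound hD hθ₀ hN hs ha hM hw hX hlim hL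
  obtain ⟨c₂, hc₂, hscaled⟩ := exists_le_scaledDistSq (vhi := vhi) hΘθ hvlo δ₀.2.1 hv₀pos
    (lt_min hη hε)
  obtain ⟨c₃, hc₃, hmean⟩ := hm2
  set b := (1 + |δ₀.2.1 0| * M) ^ 2 with hb
  have hbpos : 0 < b := by positivity
  have hn' : (0 : ℝ) < n := by exact_mod_cast hn
  have hvhi : 0 < vhi := hv₀pos.trans_le hv₀.2
  set c₄ := n * (δ₀.2.2 / (3 * b)) * min c₃ 1 * c₂ with hc₄
  have hc₄pos : 0 < c₄ := by positivity
  refine ⟨min c₄ (1 / vhi * (c₁ * ε ^ 2)), by positivity, ?_⟩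
  filter_upwards [hdesign, hmean] with m hm1 hm2 δ hδ hdist
  have hNm : (0 : ℝ) < N m := by exact_mod_cast hN m
  obtain ⟨-, hθ, hv⟩ := hδ
  have hvpos : 0 < δ.2.2 := hvlo.trans_le hv.1
  have hm2' : N m * min c₃ 1 ≤ ∑ l, w m l ^ 2 := by
    have := mul_le_mul_of_nonneg_left ((min_le_left c₃ 1).trans hm2) hNm.le
    rwa [← mul_assoc (N m : ℝ) (1 / _), mul_one_div_cancel hNm.ne', one_mul] at this
  have hdiv := sum_divergence_ge (n := n) (hsum m) (hs m _ hθ) (ha m _ hθ) (hs m _ hθ₀) (ha m _ hθ₀)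
    (hpos m _ hθ) hvpos hv₀pos hbpos (fun l => sv_sq_le (hw m l)) (min_le_right c₃ 1) hm2'
  have hform := specForm_nonneg (hs m _ hθ) (ha m _ hθ)
    (rot (O m) (X m *ᵥ (δ₀.1 - δ.1)))
  have hsd : 0 ≤ scaledDistSq δ₀.2.1 δ₀.2.2 δ.2.1 δ.2.2 :=
    add_nonneg (sq_nonneg _) (Finset.sum_nonneg fun _ _ => sq_nonneg _)
  rw [meanCrit_sub]
  -- If (θ, σ²) is far from the truth, the divergence alone suffices. Otherwise β must be at
  -- distance at least ε, as the product carries the maximum metric, and θ is close enough for the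
  -- design bound.
  by_cases hfar : min η ε ≤ dist δ.2 δ₀.2
  · have h1 := hscaled δ.2.1 hθ δ.2.2 hv hfar
    calc (N m : ℝ) * min c₄ (1 / vhi * (c₁ * ε ^ 2)) ≤ N m * c₄ := by gcongr; exact min_le_left _ _
      _ ≤ N m * (n * (δ₀.2.2 / (3 * b)) * min c₃ 1 *
          scaledDistSq δ₀.2.1 δ₀.2.2 δ.2.1 δ.2.2) := by
        rw [hc₄]; gcongr
      _ ≤ _ := hdiv.trans (le_add_of_nonneg_right (mul_nonneg (by positivity) hform))
  · rw [not_le, lt_min_iff] at hfar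
    have hβ : ε ≤ ‖δ₀.1 - δ.1‖ := by
      rw [← dist_eq_norm, dist_comm]
      rcases le_max_iff.mp (hdist.trans_eq Prod.dist_eq) with h | h
      · exact h
      · exact absurd h (not_le.mpr hfar.2)
    have hθd : dist δ.2.1 δ₀.2.1 < η := lt_of_le_of_lt (le_max_left _ _) hfar.1
    have h1 := hm1 δ.2.1 hθ hθd (δ₀.1 - δ.1)
    calc (N m : ℝ) * min c₄ (1 / vhi * (c₁ * ε ^ 2)) ≤ N m * (1 / vhi * (c₁ * ε ^ 2)) := by
          gcongr; exact min_le_right _ _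
      _ = 1 / vhi * (N m * (c₁ * ε ^ 2)) := by ring
      _ ≤ 1 / δ.2.2 * (N m * (c₁ * ‖δ₀.1 - δ.1‖ ^ 2)) := by
        have := hv.2
        gcongr
      _ ≤ 1 / δ.2.2 * specForm n (w m) δ.2.1 (rot (O m) (X m *ᵥ (δ₀.1 - δ.1)))
          (rot (O m) (X m *ᵥ (δ₀.1 - δ.1))) := by gcongr
      _ ≤ _ := le_add_of_nonneg_left (le_trans (by positivity) hdiv)

end Identification

/-! ### Uniform deviations and consistency -/

section Consistency

variable {Ω : Type*} [MeasurableSpace Ω] {P : Measure Ω} {v : ℕ → ℤ → Ω → ℝ} {n k : ℕ}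
  {δ₀ : Param k}

/-- A random variable that dominates the deviation of `-2 log L` from its mean, uniformly over
bounded parameter sets. -/
def maxDeviation {N : ℕ} (n : ℕ) (P : Measure Ω) (O : Matrix (Fin N) (Fin N) ℝ) (w : Fin N → ℝ)
    (X : Matrix (Fin (n + 1) × Fin N) (Fin k) ℝ) (U : ℤ → Ω → Fin N → ℝ) (ω : Ω) : ℝ :=
  ∑ p : Fin (n + 1) × Fin (n + 1) × Fin 3,
    (|specMoment w (eigPath n O U ω) (eigPath n O U ω) p
        - ∫ ω', specMoment w (eigPath n O U ω') (eigPath n O U ω') p ∂P|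
      + 2 * ∑ j, |specMoment w (rot O fun i => X i j) (eigPath n O U ω) p|)

section Fixed

variable {N : ℕ} {O : Matrix (Fin N) (Fin N) ℝ} {w : Fin N → ℝ} {W : Matrix (Fin N) (Fin N) ℝ}
  {U : ℤ → Ω → Fin N → ℝ} {X : Matrix (Fin (n + 1) × Fin N) (Fin k) ℝ}

theorem maxDeviation_nonneg (ω : Ω) : 0 ≤ maxDeviation n P O w X U ω :=
  Finset.sum_nonneg fun _ _ => add_nonneg (abs_nonneg _)
    (mul_nonneg zero_le_two (Finset.sum_nonneg fun _ _ => abs_nonneg _))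

theorem integrable_specMoment_sub [IsProbabilityMeasure P] (hU : IsErrorProcess P W δ₀.2.1 v U)
    (p : Fin (n + 1) × Fin (n + 1) × Fin 3) :
    Integrable (fun ω => |specMoment w (eigPath n O U ω) (eigPath n O U ω) p
        - ∫ ω', specMoment w (eigPath n O U ω') (eigPath n O U ω') p ∂P|) P :=
  ((integrable_finsetSum _ fun l _ =>
    (integrable_eigProc_mul hU l l _ _).const_mul _).sub (integrable_const _)).abs

theorem integrable_specMoment_left [IsProbabilityMeasure P] (hU : IsErrorProcess P W δ₀.2.1 v U)
    (x : Fin N → Fin (n + 1) → ℝ) (p : Fin (n + 1) × Fin (n + 1) × Fin 3) :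
    Integrable (fun ω => |specMoment w x (eigPath n O U ω) p|) P :=
  (integrable_finsetSum _ fun l _ => (((memLp_eigProc hU l _).integrable
    (by norm_num)).const_mul _).const_mul _).abs

theorem integrable_maxDeviation [IsProbabilityMeasure P] (hU : IsErrorProcess P W δ₀.2.1 v U) :
    Integrable (maxDeviation n P O w X U) P :=
  integrable_finsetSum _ fun p _ => (integrable_specMoment_sub hU p).add
    ((integrable_finsetSum _ fun _ _ => integrable_specMoment_left hU _ p).const_mul 2)

theorem sum_sq_pow_mul_le {M : ℝ} (hM : 1 ≤ M) (hw : ∀ l, |w l| ≤ M) (q : Fin 3)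
    {f : Fin N → ℝ} (hf : ∀ l, 0 ≤ f l) :
    ∑ l, (w l ^ (q : ℕ)) ^ 2 * f l ≤ M ^ 4 * ∑ l, f l := by
  rw [Finset.mul_sum]
  refine Finset.sum_le_sum fun l _ => mul_le_mul_of_nonneg_right ?_ (hf l)
  rw [← sq_abs, show M ^ 4 = (M ^ 2) ^ 2 by ring]
  exact pow_le_pow_left₀ (abs_nonneg _) (abs_pow_le_sq hM (hw l) q) 2

/-- Every moment in the sum has a second-moment bound proportional to N, and the choice η = √N turns
it into a first-moment bound proportional to √N. -/
theorem integral_maxDeviation_le [IsProbabilityMeasure P] (hD : Diagonalizes O w W)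
    (hU : IsErrorProcess P W δ₀.2.1 v U) (hv : IIDInnovations P v δ₀.2.2) {κ : ℝ} (hκ0 : 0 ≤ κ)
    (hκ : ∀ j t, ∫ ω, (v j t ω ^ 2 - δ₀.2.2) ^ 2 ∂P ≤ κ) (hv₀ : 0 ≤ δ₀.2.2)
    (hs : ∀ l, sv δ₀.2.1 (w l) ≠ 0) (ha : ∀ l, |rv δ₀.2.1 (w l) / sv δ₀.2.1 (w l)| < 1)
    {M : ℝ} (hM : 1 ≤ M) (hw : ∀ l, |w l| ≤ M) {V : ℝ} (hV : ∀ l, statVar δ₀.2.1 (w l) ≤ V)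
    {C : ℝ} (hX : ∀ p j, |X p j| ≤ C) (hN : 0 < N) :
    ∫ ω, maxDeviation n P O w X U ω ∂P
      ≤ (∑ _p : Fin (n + 1) × Fin (n + 1) × Fin 3,
        (((κ + 2 * δ₀.2.2 ^ 2) * (M ^ 4 * V ^ 2) + 1)
          + 2 * ∑ _j : Fin k, (M ^ 4 * (C ^ 2 * (δ₀.2.2 * V)) + 1) / 2)) * √N := by
  have hNpos : (0 : ℝ) < N := by exact_mod_cast hN
  have hη : 0 < √(N : ℝ) := Real.sqrt_pos.mpr hNpos
  have hdiv : ∀ a : ℝ, a * N / √N = a * √N := fun a => by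
    rw [mul_div_assoc, Real.div_sqrt]
  have hstat : ∀ l, 0 ≤ statVar δ₀.2.1 (w l) := fun l =>
    (inv_pos.mpr (sq_sub_sq_pos (hs l) (ha l))).le
  have hV0 : 0 ≤ V := (hstat ⟨0, hN⟩).trans (hV ⟨0, hN⟩)
  have hA : ∀ p : Fin (n + 1) × Fin (n + 1) × Fin 3,
      ∫ ω, |specMoment w (eigPath n O U ω) (eigPath n O U ω) p
        - ∫ ω', specMoment w (eigPath n O U ω') (eigPath n O U ω') p ∂P| ∂P
      ≤ ((κ + 2 * δ₀.2.2 ^ 2) * (M ^ 4 * V ^ 2) + 1) * √N := by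
    intro p
    have h := integral_abs_quadratic_le hD hU hv hκ hs ha (fun l => w l ^ (p.2.2 : ℕ))
      ((p.1 : ℕ) + 1) ((p.2.1 : ℕ) + 1) hη
    push_cast at h
    refine h.trans ?_
    have h1 : ∑ l, (w l ^ (p.2.2 : ℕ)) ^ 2 * statVar δ₀.2.1 (w l) ^ 2 ≤ M ^ 4 * V ^ 2 * N := by
      refine (sum_sq_pow_mul_le hM hw _ fun l => sq_nonneg _).trans ?_
      rw [mul_assoc]
      refine mul_le_mul_of_nonneg_left ((Finset.sum_le_card_nsmul _ _ (V ^ 2) fun l _ =>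
        pow_le_pow_left₀ (hstat l) (hV l) 2).trans_eq ?_) (by positivity)
      simp [mul_comm]
    rw [add_mul _ (1 : ℝ), one_mul, ← hdiv, mul_assoc _ (M ^ 4 * V ^ 2)]
    gcongr
  have hB : ∀ (p : Fin (n + 1) × Fin (n + 1) × Fin 3) (j : Fin k),
      ∫ ω, |specMoment w (rot O fun i => X i j) (eigPath n O U ω) p| ∂P
      ≤ (M ^ 4 * (C ^ 2 * (δ₀.2.2 * V)) + 1) / 2 * √N := by
    intro p j
    have h := integral_abs_linear_le hD hU hv hs ha
      (fun l => w l ^ (p.2.2 : ℕ) * rot O (fun i => X i j) l p.1) ((p.2.1 : ℕ) + 1) hη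
    simp only [mul_assoc] at h
    refine h.trans ?_
    have h1 : ∑ l, (w l ^ (p.2.2 : ℕ) * rot O (fun i => X i j) l p.1) ^ 2
        * (δ₀.2.2 * statVar δ₀.2.1 (w l)) ≤ M ^ 4 * (C ^ 2 * (δ₀.2.2 * V)) * N := by
      have h2 : ∑ l, rot O (fun i => X i j) l p.1 ^ 2 ≤ N * C ^ 2 := by
        rw [sum_rot_sq hD.right]
        refine (Finset.sum_le_card_nsmul _ _ (C ^ 2) fun i _ => ?_).trans_eq (by simp)
        rw [← sq_abs]
        exact pow_le_pow_left₀ (abs_nonneg _) (hX _ j) 2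
      simp only [mul_pow, mul_assoc]
      refine (sum_sq_pow_mul_le hM hw _ fun l => mul_nonneg (sq_nonneg _)
        (mul_nonneg hv₀ (hstat l))).trans (mul_le_mul_of_nonneg_left ?_ (by positivity))
      calc ∑ l, rot O (fun i => X i j) l p.1 ^ 2 * (δ₀.2.2 * statVar δ₀.2.1 (w l))
          ≤ ∑ l, rot O (fun i => X i j) l p.1 ^ 2 * (δ₀.2.2 * V) :=
            Finset.sum_le_sum fun l _ => mul_le_mul_of_nonneg_left
              (mul_le_mul_of_nonneg_left (hV l) hv₀) (sq_nonneg _)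
        _ ≤ N * C ^ 2 * (δ₀.2.2 * V) := by
            rw [← Finset.sum_mul]; gcongr
        _ = _ := by ring
    simp only [mul_assoc] at h1
    rw [div_mul_eq_mul_div, add_mul, one_mul, ← hdiv]
    simp only [mul_assoc]
    gcongr
  have hmean : ∫ ω, maxDeviation n P O w X U ω ∂P = ∑ p : Fin (n + 1) × Fin (n + 1) × Fin 3,
      (∫ ω, |specMoment w (eigPath n O U ω) (eigPath n O U ω) p
        - ∫ ω', specMoment w (eigPath n O U ω') (eigPath n O U ω') p ∂P| ∂P
      + 2 * ∑ j, ∫ ω, |specMoment w (rot O fun i => X i j) (eigPath n O U ω) p| ∂P) :=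
    (HasMean.sum fun p _ => HasMean.add ⟨integrable_specMoment_sub hU p, rfl⟩
      (HasMean.const_mul 2 (HasMean.sum fun j _ => ⟨integrable_specMoment_left hU _ p, rfl⟩))).2
  rw [hmean, Finset.sum_mul]
  refine Finset.sum_le_sum fun p _ => ?_
  rw [add_mul, mul_assoc 2, Finset.sum_mul]
  exact add_le_add (hA p) (mul_le_mul_of_nonneg_left (Finset.sum_le_sum fun j _ => hB p j)
    zero_le_two)

theorem abs_neg_two_mul_logLik_sub_le [IsProbabilityMeasure P] (hD : Diagonalizes O w W)
    (hU : IsErrorProcess P W δ₀.2.1 v U)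
    (hv : IIDInnovations P v δ₀.2.2) (hs₀ : ∀ l, sv δ₀.2.1 (w l) ≠ 0)
    (ha₀ : ∀ l, |rv δ₀.2.1 (w l) / sv δ₀.2.1 (w l)| < 1) {δ : Param k} {vlo : ℝ} (hvlo : 0 < vlo)
    (hδ : vlo ≤ δ.2.2) (hs : ∀ l, sv δ.2.1 (w l) ≠ 0)
    (ha : ∀ l, |rv δ.2.1 (w l) / sv δ.2.1 (w l)| < 1) {κ D : ℝ} (hD1 : 1 ≤ D)
    (hκ : ∀ p : Fin (n + 1) × Fin (n + 1) × Fin 3, |precCoef δ.2.1 p.1 p.2.1 p.2.2| ≤ κ)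
    (hβ : ‖δ₀.1 - δ.1‖ ≤ D) (ω : Ω) :
    |-2 * logLik W X (response X δ₀.1 U ω) δ - meanCrit n O w X δ₀ δ|
      ≤ 1 / vlo * (κ * D) * maxDeviation n P O w X U ω := by
  have hvpos := hvlo.trans_le hδ
  rw [neg_two_mul_logLik_sub_meanCrit hD hU hv hs₀ ha₀ X hvpos hs ha, abs_mul,
    abs_of_pos (by positivity), mul_assoc]
  refine mul_le_mul (one_div_le_one_div_of_le hvlo hδ) ?_ (abs_nonneg _) (by positivity)
  rw [maxDeviation, Finset.mul_sum]
  refine (Finset.abs_sum_le_sum_abs _ _).trans (Finset.sum_le_sum fun p _ => ?_)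
  rw [abs_mul, mul_assoc]
  refine mul_le_mul (hκ p) ?_ (abs_nonneg _) ((abs_nonneg _).trans (hκ p))
  refine (abs_add_le _ _).trans ?_
  rw [mul_add, abs_mul, abs_two]
  refine add_le_add (le_mul_of_one_le_left (abs_nonneg _) hD1) ?_
  rw [mul_left_comm]
  refine mul_le_mul_of_nonneg_left ?_ zero_le_two
  rw [Finset.mul_sum]
  refine (Finset.abs_sum_le_sum_abs _ _).trans (Finset.sum_le_sum fun j _ => ?_)
  rw [abs_mul]
  exact mul_le_mul_of_nonneg_right ((norm_le_pi_norm (δ₀.1 - δ.1) j).trans hβ) (abs_nonneg _)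

end Fixed

variable {N : ℕ → ℕ} {O : ∀ m, Matrix (Fin (N m)) (Fin (N m)) ℝ} {w : ∀ m, Fin (N m) → ℝ}
  {W : ∀ m, Matrix (Fin (N m)) (Fin (N m)) ℝ} {U : ∀ m, ℤ → Ω → Fin (N m) → ℝ}
  {X : ∀ m, Matrix (Fin (n + 1) × Fin (N m)) (Fin k) ℝ}
  {Θβ : Set (Fin k → ℝ)} {Θθ : Set Theta} {vlo vhi : ℝ}

/-- Uniform bound for the deviation of `-2 log L` from its mean over the parameter space. -/
theorem exists_uniform_deviation_bound [IsProbabilityMeasure P]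
    (hD : ∀ m, Diagonalizes (O m) (w m) (W m)) (hU : ∀ m, IsErrorProcess P (W m) δ₀.2.1 v (U m))
    (hv : IIDInnovations P v δ₀.2.2) (hΘβ : IsCompact Θβ) (hΘθ : IsCompact Θθ) (hvlo : 0 < vlo)
    (hδ₀ : δ₀ ∈ Θβ ×ˢ Θθ ×ˢ Set.Icc vlo vhi)
    (hs : ∀ m, ∀ θ ∈ Θθ, ∀ l, sv θ (w m l) ≠ 0)
    (ha : ∀ m, ∀ θ ∈ Θθ, ∀ l, |rv θ (w m l) / sv θ (w m l)| < 1) :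
    ∃ K > 0, ∀ m, ∀ δ ∈ Θβ ×ˢ Θθ ×ˢ Set.Icc vlo vhi, ∀ ω,
      |-2 * logLik (W m) (X m) (response (X m) δ₀.1 (U m) ω) δ
          - meanCrit n (O m) (w m) (X m) δ₀ δ|
        ≤ K * maxDeviation n P (O m) (w m) (X m) (U m) ω := by
  have hcoef : Continuous fun θ : Theta => ∑ p : Fin (n + 1) × Fin (n + 1) × Fin 3,
      |precCoef θ p.1 p.2.1 p.2.2| :=
    continuous_finsetSum _ fun p _ => (continuous_precCoef _ _ _).abs
  obtain ⟨κ, hκ⟩ := hΘθ.exists_bound_of_continuousOn hcoef.continuousOn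
  obtain ⟨D, hDβ⟩ := hΘβ.exists_bound_of_continuousOn (f := fun β => δ₀.1 - β) (by fun_prop)
  refine ⟨1 / vlo * (max κ 1 * max D 1), by positivity, fun m δ hδ ω => ?_⟩
  refine abs_neg_two_mul_logLik_sub_le (hD m) (hU m) hv (hs m _ hδ₀.2.1) (ha m _ hδ₀.2.1) hvlo
    hδ.2.2.1 (hs m _ hδ.2.1) (ha m _ hδ.2.1) (le_max_right _ _) (fun p => ?_)
    ((hDβ _ hδ.1).trans (le_max_left _ _)) ω
  refine le_trans ?_ (((le_abs_self _).trans (hκ _ hδ.2.1)).trans (le_max_left _ _))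
  exact Finset.single_le_sum (f := fun p : Fin (n + 1) × Fin (n + 1) × Fin 3 =>
    |precCoef δ.2.1 p.1 p.2.1 p.2.2|) (fun _ _ => abs_nonneg _) (Finset.mem_univ p)

/-- Maximizers of the quasi likelihood are consistent once the expected criterion separates the
true parameter. -/
theorem tendstoInMeasure_of_separation [IsProbabilityMeasure P]
    (hD : ∀ m, Diagonalizes (O m) (w m) (W m)) (hU : ∀ m, IsErrorProcess P (W m) δ₀.2.1 v (U m))
    (hv : IIDInnovations P v δ₀.2.2) (hΘβ : IsCompact Θβ) (hΘθ : IsCompact Θθ) (hvlo : 0 < vlo)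
    (hδ₀ : δ₀ ∈ Θβ ×ˢ Θθ ×ˢ Set.Icc vlo vhi)
    (hs : ∀ m, ∀ θ ∈ Θθ, ∀ l, sv θ (w m l) ≠ 0)
    (ha : ∀ m, ∀ θ ∈ Θθ, ∀ l, |rv θ (w m l) / sv θ (w m l)| < 1)
    (hN : ∀ m, 0 < N m) (hNlim : Tendsto N atTop atTop)
    {M : ℝ} (hM : 1 ≤ M) (hw : ∀ m l, |w m l| ≤ M) {V : ℝ}
    (hV : ∀ m l, statVar δ₀.2.1 (w m l) ≤ V) {C : ℝ} (hX : ∀ m p j, |X m p j| ≤ C)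
    (hsep : ∀ ε > 0, ∃ c > 0, ∀ᶠ m in atTop, ∀ δ ∈ Θβ ×ˢ Θθ ×ˢ Set.Icc vlo vhi, ε ≤ dist δ δ₀ →
      N m * c ≤ meanCrit n (O m) (w m) (X m) δ₀ δ - meanCrit n (O m) (w m) (X m) δ₀ δ₀)
    {δhat : ℕ → Ω → Param k}
    (hδ : ∀ m, ∀ᵐ ω ∂P, δhat m ω ∈ Θβ ×ˢ Θθ ×ˢ Set.Icc vlo vhi ∧
      IsMaxOn (logLik (W m) (X m) (response (X m) δ₀.1 (U m) ω))
        (Θβ ×ˢ Θθ ×ˢ Set.Icc vlo vhi) (δhat m ω)) :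
    TendstoInMeasure P δhat atTop fun _ => δ₀ := by
  obtain ⟨K, hK, hdev⟩ := exists_uniform_deviation_bound (n := n) (X := X) hD hU hv hΘβ hΘθ hvlo
    hδ₀ hs ha
  obtain ⟨κ, hκ⟩ := hv.exists_fourth_moment_bound
  obtain ⟨E, hE⟩ : ∃ E : ℝ, ∀ m,
      ∫ ω, maxDeviation n P (O m) (w m) (X m) (U m) ω ∂P ≤ E * √(N m) :=
    ⟨_, fun m => integral_maxDeviation_le (hD m) (hU m) hv (le_max_right κ 0)
      (fun j t => (hκ j t).trans (le_max_left κ 0)) (hvlo.le.trans hδ₀.2.2.1) (hs m _ hδ₀.2.1)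
      (ha m _ hδ₀.2.1) hM (hw m) (hV m) (hX m) (hN m)⟩
  rw [tendstoInMeasure_iff_dist]
  intro ε hε
  obtain ⟨c, hc, hsepc⟩ := hsep ε hε
  have hbound : ∀ᶠ m in atTop, P {ω | ε ≤ dist (δhat m ω) δ₀}
      ≤ ENNReal.ofReal (2 * K * E / c * (√(N m))⁻¹) := by
    filter_upwards [hsepc] with m hm
    have hNm : (0 : ℝ) < N m := by exact_mod_cast hN m
    have hsub : P {ω | ε ≤ dist (δhat m ω) δ₀}
        ≤ P {ω | N m * c / (2 * K) ≤ maxDeviation n P (O m) (w m) (X m) (U m) ω} := by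
      refine measure_mono_ae ?_
      filter_upwards [hδ m] with ω hω hdist
      -- At a distant maximizer the expected criterion is larger by at least N c although the
      -- observed one is not larger, so the two deviations, at the maximizer and at the truth, add
      -- up to at least N c.
      have h1 := hm _ hω.1 hdist
      have h2 := hω.2 hδ₀
      have h3 := (abs_le.mp (hdev m _ hω.1 ω)).1
      have h4 := (abs_le.mp (hdev m _ hδ₀ ω)).2
      change N m * c / (2 * K) ≤ maxDeviation n P (O m) (w m) (X m) (U m) ω
      change logLik (W m) (X m) (response (X m) δ₀.1 (U m) ω) δ₀
        ≤ logLik (W m) (X m) (response (X m) δ₀.1 (U m) ω) (δhat m ω) at h2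
      rw [div_le_iff₀ (by positivity)]
      linarith
    refine hsub.trans ?_
    rw [← ofReal_measureReal]
    refine ENNReal.ofReal_le_ofReal ?_
    -- Markov: a mean of order √N against a threshold of order N.
    have h1 := mul_meas_ge_le_integral_of_nonneg (μ := P)
      (Eventually.of_forall fun ω => maxDeviation_nonneg (n := n) (P := P) (O := O m) (w := w m)
        (X := X m) (U := U m) ω) (integrable_maxDeviation (hU m)) (N m * c / (2 * K))
    have h2 := h1.trans (hE m)
    rw [← le_div_iff₀' (by positivity)] at h2
    refine h2.trans_eq ?_
    rw [← Real.sqrt_div_self]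
    field_simp
  refine tendsto_of_tendsto_of_tendsto_of_le_of_le' tendsto_const_nhds ?_
    (Eventually.of_forall fun _ => zero_le) hbound
  have h1 : Tendsto (fun m => 2 * K * E / c * (√(N m : ℝ))⁻¹) atTop (𝓝 (2 * K * E / c * 0)) :=
    ((Real.tendsto_sqrt_atTop.comp
      (tendsto_natCast_atTop_atTop.comp hNlim)).inv_tendsto_atTop).const_mul _
  rw [mul_zero] at h1
  simpa using ENNReal.tendsto_ofReal h1

end Consistency

end STAR

end

/-! ### Assembly -/

theorem theorem1
    {Ω : Type*} [MeasurableSpace Ω] (P : Measure Ω) [IsProbabilityMeasure P]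
    -- the number of times and of predictors, and the numbers of cells, which tend to infinity
    (T k : ℕ) (n : ℕ → ℕ) (hn : Tendsto n atTop atTop)
    -- weight matrices, stacked design matrices, parameter space, true parameter
    (W : ∀ m, Matrix (Fin (n m)) (Fin (n m)) ℝ)
    (X : ∀ m, Matrix (Fin T × Fin (n m)) (Fin k) ℝ)
    (Θβ : Set (Fin k → ℝ)) (Θθ : Set STAR.Theta) (vlo vhi : ℝ)
    (β₀ : Fin k → ℝ) (θ₀ : STAR.Theta) (v₀ : ℝ)
    -- innovations, error processes
    (v : ℕ → ℤ → Ω → ℝ) (U : ∀ m, ℤ → Ω → Fin (n m) → ℝ)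
    (hU : ∀ m, STAR.IsErrorProcess P (W m) θ₀ v (U m))
    -- more than two distinct eigenvalues
    (hW : ∀ m, 2 < (spectrum ℝ (W m)).ncard)
    -- symmetric weight matrices with zero diagonals
    (hsymm : ∀ m, (W m).IsSymm) (hdiag : ∀ m i, W m i i = 0)
    -- compact product parameter space of admissible parameters, true value in the interior
    (hΘβ : IsCompact Θβ) (hΘθ : IsCompact Θθ) (hvlo : 0 < vlo)
    (hadm : ∀ m, ∀ θ ∈ Θθ, STAR.Admissible (W m) θ)
    (hconn : ∃ C : Set STAR.Theta, IsPreconnected C ∧ Θθ ⊆ C ∧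
      ∀ m, ∀ θ ∈ C, STAR.Admissible (W m) θ)
    (hint : (β₀, θ₀, v₀) ∈ interior (Θβ ×ˢ Θθ ×ˢ Set.Icc vlo vhi))
    -- iid innovations
    (hv : STAR.IIDInnovations P v v₀)
    -- uniform boundedness
    (hUBprec : ∀ θ ∈ Θθ, STAR.UB (fun m => STAR.Prec T (W m) θ))
    (hUBinv : ∀ θ ∈ Θθ, STAR.UB (fun m => (STAR.S (W m) θ)⁻¹))
    (hUBpow : STAR.UB (fun m => STAR.absPowSum (W m) θ₀))
    (hUBX : ∃ C : ℝ, ∀ m p j, |X m p j| ≤ C)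
    -- nonsingular limit of the normalized weighted design
    (hX : ∀ θ ∈ Θθ, ∃ L : Matrix (Fin k) (Fin k) ℝ,
      Tendsto (fun m => (1 / (n m : ℝ)) • ((X m)ᵀ * STAR.Prec T (W m) θ * X m)) atTop (𝓝 L) ∧
      IsUnit L.det)
    -- asymptotic nonsingularity of the normalized Hessian at the true parameter
    (hH : ∃ c > 0, ∀ᶠ m in atTop, c ≤ |((1 / (n m : ℝ)) •
      STAR.hessian (STAR.sumF T (W m) θ₀ v₀) ![θ₀ 0, θ₀ 1, θ₀ 2, v₀]).det|)
    -- the quasi-maximum likelihood estimators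
    (δhat : ℕ → Ω → STAR.Param k)
    (hδ : ∀ m, ∀ᵐ ω ∂P, δhat m ω ∈ Θβ ×ˢ Θθ ×ˢ Set.Icc vlo vhi ∧
      IsMaxOn (STAR.logLik (W m) (X m) (STAR.response (X m) β₀ (U m) ω))
        (Θβ ×ˢ Θθ ×ˢ Set.Icc vlo vhi) (δhat m ω)) :
    STAR.IdentifiablyUnique
        (fun m δ => (1 / (n m : ℝ)) *
          ∫ ω, -2 * STAR.logLik (W m) (X m) (STAR.response (X m) β₀ (U m) ω) δ ∂P)
        (Θβ ×ˢ Θθ ×ˢ Set.Icc vlo vhi) (β₀, θ₀, v₀) ∧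
      TendstoInMeasure P δhat atTop (fun _ => (β₀, θ₀, v₀)) := by
  have h0 : (β₀, θ₀, v₀) ∈ Θβ ×ˢ Θθ ×ˢ Set.Icc vlo vhi := interior_subset hint
  have hv₀ : 0 < v₀ := hvlo.trans_le h0.2.2.1
  have hΘ : Θθ ∈ 𝓝 θ₀ := by
    rw [interior_prod_eq, interior_prod_eq] at hint
    exact mem_interior_iff_mem_nhds.mp hint.2.1
  have hN : ∀ m, 0 < n m := by
    intro m
    refine Nat.pos_of_ne_zero fun h => ?_
    have : IsEmpty (Fin (n m)) := by rw [h]; infer_instance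
    -- Only the nonemptiness of the index set is drawn from the eigenvalue count: for N = 0 the
    -- spectrum is empty.
    have h1 := hW m
    rw [spectrum.of_subsingleton] at h1
    simp at h1
  have hT : 2 ≤ T := by
    obtain ⟨c, hc, hHc⟩ := hH
    obtain ⟨m, hm⟩ := hHc.exists
    refine STAR.two_le_of_det_hessian_ne_zero (hsymm m) hv₀ hΘ (hadm m) fun h => ?_
    rw [Matrix.det_smul, h, mul_zero, abs_zero] at hm
    exact absurd hm (not_le.mpr hc)
  -- The divergence lemmas are applied with n = τ + 1 transitions, which is positive.
  obtain ⟨τ, rfl⟩ : ∃ τ, T = τ + 1 + 1 := ⟨T - 2, by omega⟩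
  choose O w hD using fun m => STAR.exists_diagonalizes (hsymm m)
  obtain ⟨M, c, q, hc, hq, hw⟩ := STAR.exists_mem_eigSet hD hΘ hadm hUBprec hUBinv hUBpow
  have hs : ∀ m, ∀ θ ∈ Θθ, ∀ l, STAR.sv θ (w m l) ≠ 0 := fun m θ hθ =>
    STAR.sv_ne_zero (hD m) (hadm m θ hθ).1
  have ha : ∀ m, ∀ θ ∈ Θθ, ∀ l, |STAR.rv θ (w m l) / STAR.sv θ (w m l)| < 1 := fun m θ hθ =>
    STAR.abs_ratio_lt_one (hD m) (hadm m θ hθ)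
  have hm2 := STAR.exists_le_mean_sq_of_hessian hD hv₀ hΘ hadm hc hq hw hH
  -- A bound of at least one lets its square dominate the powers 0, 1 and 2 of w alike.
  have hw' : ∀ m l, |w m l| ≤ max M 1 := fun m l => (hw m l).1.trans (le_max_left _ _)
  have hsum := fun m => STAR.sum_eigenvalues_eq_zero (hD m) (hdiag m)
  obtain ⟨D, hDpre, hDsub, hDadm⟩ := hconn
  have hpos : ∀ m, ∀ θ ∈ Θθ, ∀ l, 0 < STAR.sv θ (w m l) * STAR.sv θ₀ (w m l) :=
    fun m θ hθ => STAR.sv_mul_sv_pos (hD m) hDpre (hDadm m) (hDsub hθ) (hDsub h0.2.1)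
  obtain ⟨C, hC⟩ := hUBX
  obtain ⟨L, hlim, hL⟩ := hX θ₀ h0.2.1
  have hsep : ∀ ε > 0, ∃ c > 0, ∀ᶠ m in atTop, ∀ δ ∈ Θβ ×ˢ Θθ ×ˢ Set.Icc vlo vhi,
      ε ≤ dist δ (β₀, θ₀, v₀) → n m * c ≤
        STAR.meanCrit (τ + 1) (O m) (w m) (X m) (β₀, θ₀, v₀) δ
          - STAR.meanCrit (τ + 1) (O m) (w m) (X m) (β₀, θ₀, v₀) (β₀, θ₀, v₀) := fun ε hε =>
    STAR.exists_meanCrit_separation hD τ.succ_pos hN hsum hΘθ hvlo h0 hs ha hpos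
      (le_max_right M 1) hw' hC hlim hL hm2 hε
  have hmean : ∀ m, ∀ δ ∈ Θβ ×ˢ Θθ ×ˢ Set.Icc vlo vhi,
      ∫ ω, -2 * STAR.logLik (W m) (X m) (STAR.response (X m) β₀ (U m) ω) δ ∂P
        = STAR.meanCrit (τ + 1) (O m) (w m) (X m) (β₀, θ₀, v₀) δ := fun m δ hδ =>
    (STAR.hasMean_neg_two_mul_logLik (δ₀ := (β₀, θ₀, v₀)) (hD m) (hU m) hv (hs m _ h0.2.1)
      (ha m _ h0.2.1) (X m) (hvlo.trans_le hδ.2.2.1) (hs m _ hδ.2.1) (ha m _ hδ.2.1)).2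
  refine ⟨⟨fun m δ hδ => ?_, fun ε hε => ?_⟩, ?_⟩
  · change 1 / (n m : ℝ) * _ ≤ 1 / (n m : ℝ) * _
    rw [hmean m _ h0, hmean m _ hδ]
    exact mul_le_mul_of_nonneg_left (STAR.meanCrit_le (δ₀ := (β₀, θ₀, v₀)) (hsum m)
      (hs m _ hδ.2.1) (ha m _ hδ.2.1) (hs m _ h0.2.1) (ha m _ h0.2.1) (hpos m _ hδ.2.1)
      (hvlo.trans_le hδ.2.2.1) hv₀ (zero_le_one.trans (le_max_right M 1)) (hw' m)) (by positivity)
  · obtain ⟨c, hc, h⟩ := hsep ε hε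
    refine ⟨c, hc, h.mono fun m hm δ hδ hdist => ?_⟩
    have hNm : (0 : ℝ) < n m := by exact_mod_cast hN m
    beta_reduce
    rw [hmean m _ h0, hmean m _ hδ, ← mul_sub, one_div, ← div_eq_inv_mul, le_div_iff₀' hNm]
    exact hm δ hδ hdist
  · exact STAR.tendstoInMeasure_of_separation (n := τ + 1) (δ₀ := (β₀, θ₀, v₀)) hD hU hv hΘβ hΘθ
      hvlo h0 hs ha hN hn (le_max_right M 1) hw'
      (fun m l => STAR.statVar_le_of_mem_eigSet hc hq (hw m l)) hC hsep hδ
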